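/- Let $\Sigma\subset\mathbb C$ be a finite set. Let $D_\Sigma$ be the plane without $(-\infty,0]$ and without the rays $\{ta: t\ge 1\}$, $a\in\Sigma\setminus\{0\}$. For a word $w$ with letters in $\Sigma$ let $L_w$ be the hyperlogarithm on $D_\Sigma$ given by iterated integration along the straight line from $0^+$ to $z$: $L_{0^n}(z)=\log^n(z)/n!$ (so $L_e=1$ for the empty word $e$), and $L_{wa}(z)=\int_0^z L_w(t)\,\frac{\mathrm dt}{t-a}$ if $wa$ is not a power of the letter $0$. Let $\mathcal{HL}^{\mathbb C}_\Sigma$ be the $\mathbb C$-span of all $L_w$, and let $\partial_z\mathcal{HL}^{\mathbb C}_\Sigma$ be the space of derivatives of its elements. *Regularized values.* For $a\in\Sigma\cup\{0\}$ let $\ell_a(z)=L_a(z)+\log a$ if $a\ne0$ (a branch of $\log(a-z)$) and $\ell_0(z)=\log z$. Near $a$ every $f\in\mathcal{HL}^{\mathbb C}_\Sigma$ is a polynomial in $\ell_a$ whose coefficients are holomorphic at $a$, and $f(a)$ denotes the value at $a$ of the coefficient in degree $0$. Here $a$ is approached inside $D_\Sigma$ along the straight line from $0^+$; if this line meets another singularity,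 or $a$ is negative, then the approach is from the side where the argument is slightly smaller than that of $a$. *Residues.* For $f=\sum_w\phi_wL_w$ with $\phi_w\in\mathcal O_\Sigma=\mathbb C[z,((z-a)^{-1})_{a\in\Sigma}]$ put $\mathrm{res}_af=\sum_w(\mathrm{res}_a\phi_w)\,L_w(a)$. *Monodromy.* For $a\in\Sigma$ let $\mathcal M_a$ be analytic continuation along the loop that runs inside $D_\Sigma$ to a point close to $a$ (on the side just described), once counter-clockwise around $a$ on a small circle, and back. It is unipotent; let $m_a$ be the nilpotent operator with $\mathcal M_a=\exp(2\pi\mathrm i\,m_a)$. The generic infinitesimal monodromy is $mf=\sum_{a\in\Sigma}a\otimes m_af$. It maps $\mathcal{HL}^{\mathbb C}_\Sigma$ onto $m\mathcal{HL}^{\mathbb C}_\Sigma=\Sigma\otimes\mathcal{HL}^{\mathbb C}_\Sigma$ and $\partial_z\mathcal{HL}^{\mathbb C}_\Sigma$ onto $m\partial_z\mathcal{HL}^{\mathbb C}_\Sigma=\Sigma\otimes\partial_z\mathcal{HL}^{\mathbb C}_\Sigma$, where $\Sigma\otimes V$ is the space of formal sums $\sum_{a\in\Sigma}a\otimes v_a$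 with $v_a\in V$. **Theorem.** The following linear maps are well defined: $$\pi_{\partial_z}:\partial_z\mathcal{HL}^{\mathbb C}_\Sigma\to\partial_z\mathcal{HL}^{\mathbb C}_\Sigma,\quad f\mapsto f-\sum_{a\in\Sigma}\frac{\mathrm{res}_af}{z-a};$$ $$\int_0\mathrm dz:\partial_z\mathcal{HL}^{\mathbb C}_\Sigma\to\mathcal{HL}^{\mathbb C}_\Sigma,\quad f\mapsto F\ \text{ with } \partial_zF=f,\ F(0)=0,$$ also acting on the right factor as a map $m\partial_z\mathcal{HL}^{\mathbb C}_\Sigma\to m\mathcal{HL}^{\mathbb C}_\Sigma$; $$\pi_m:m\mathcal{HL}^{\mathbb C}_\Sigma\to m\mathcal{HL}^{\mathbb C}_\Sigma,\quad a\otimes f\mapsto a\otimes(f-f(a));$$ $$m^{-1}:m\mathcal{HL}^{\mathbb C}_\Sigma\to\mathcal{HL}^{\mathbb C}_\Sigma,\quad x\mapsto X\ \text{ with } mX=x,\ X(0)=0.$$ The hexagon formed by them and by $m:\partial_z\mathcal{HL}^{\mathbb C}_\Sigma\to m\partial_z\mathcal{HL}^{\mathbb C}_\Sigma$ commutes: for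 every $f\in\partial_z\mathcal{HL}^{\mathbb C}_\Sigma$, $$\int_0\pi_{\partial_z}f\,\mathrm dz=m^{-1}\,\pi_m\int_0 mf\,\mathrm dz .$$ -/

import Mathlib

open Filter Topology

noncomputable section

namespace Hyperlog

/-! ### Hyperlogarithms as analytic functions on a cut plane -/

/-- Auxiliary form of `hlog` on reversed words: the head is the last letter of the word. -/
def hlogRev : List ℂ → ℂ → ℂ
  | [], _ => 1
  | a :: w, z =>
      open Classical in
      if ∀ b ∈ a :: w, b = 0 then
        Complex.log z ^ (w.length + 1) / ((w.length + 1).factorial : ℂ)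
      else ∫ s in (0 : ℝ)..1, hlogRev w ((s : ℂ) * z) * (z / ((s : ℂ) * z - a))

/-- The hyperlogarithm `L_w(z)`, the iterated integral of `dt/(t - a₁), …, dt/(t - aₙ)` for
`w = a₁ … aₙ` along the straight line from `0⁺` to `z`: it is `log(z)ⁿ / n!` for the word `0ⁿ`,
and `L_{va}(z) = ∫_0^z L_v(t) dt / (t - a)` (a convergent integral) for every other word `va`. -/
def hlog (w : List ℂ) (z : ℂ) : ℂ := hlogRev w.reverse z

/-- The star-shaped domain on which the straight paths of integration meet no singularity: the
plane without `(-∞, 0]` and without the rays `{t a : t ≥ 1}`, `a ∈ S`. It is simply connected, so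
a multivalued analytic function on the complement of `S` is given by its branch on it. -/
def dom (S : Finset ℂ) : Set ℂ :=
  {z | z ∈ Complex.slitPlane ∧ ∀ a ∈ S, ∀ t : ℝ, 1 ≤ t → z ≠ (t : ℂ) * a}

/-- The branch of `L_w` on `dom S`, extended by zero. Functions on `dom S` are represented by
functions on the plane that vanish outside `dom S`. -/
def hlogOn (S : Finset ℂ) (w : List ℂ) : ℂ → ℂ := (dom S).indicator (hlog w)

/-- Hyperlogarithms with constant coefficients: the complex span of the `L_w`, `w` a word
with letters in `S`. -/
def HLC (S : Finset ℂ) : Submodule ℂ (ℂ → ℂ) :=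
  Submodule.span ℂ {f | ∃ w : List ℂ, (∀ b ∈ w, b ∈ S) ∧ f = hlogOn S w}

/-- `∂_z F = f` on `dom S`. -/
def IsDeriv (S : Finset ℂ) (F f : ℂ → ℂ) : Prop := ∀ z ∈ dom S, HasDerivAt F (f z) z

/-- The space `∂_z HL^ℂ` of derivatives of hyperlogarithms with constant coefficients. -/
def dHLC (S : Finset ℂ) : Submodule ℂ (ℂ → ℂ) where
  carrier := {f | (∀ z, z ∉ dom S → f z = 0) ∧ ∃ F ∈ HLC S, IsDeriv S F f}
  zero_mem' := ⟨fun _ _ => rfl, 0, (HLC S).zero_mem, fun z _ => hasDerivAt_const z 0⟩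
  add_mem' := by
    rintro f g ⟨hf, F, hF, hFf⟩ ⟨hg, G, hG, hGg⟩
    exact ⟨fun z hz => by simp [hf z hz, hg z hz], F + G, (HLC S).add_mem hF hG,
      fun z hz => (hFf z hz).add (hGg z hz)⟩
  smul_mem' := by
    rintro c f ⟨hf, F, hF, hFf⟩
    exact ⟨fun z hz => by simp [hf z hz], c • F, (HLC S).smul_mem c hF,
      fun z hz => (hFf z hz).const_smul c⟩

/-! ### Regularized evaluation at a singular point -/

/-- The points of `dom S` from which `a` is approached. For `a ≠ 0` this is the side of the ray
through `a` on which the argument is slightly smaller than that of `a`. If the straight path from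
`0⁺` to `a` meets no singularity, then this gives the branch along this path; otherwise the path
is moved slightly to this side. -/
def side (S : Finset ℂ) (a : ℂ) : Set ℂ := {z | z ∈ dom S ∧ (a = 0 ∨ (z / a).im < 0)}

/-- The local logarithm at `a` on `dom S`: the branch of `log (a - z)` which equals
`L_a(z) + log a` if `a ≠ 0`, and `log z = L_0(z)` if `a = 0`. -/
def locLog (a z : ℂ) : ℂ :=
  open Classical in
  if a = 0 then Complex.log z else Complex.log (1 - z / a) + Complex.log a

/-- The regularized value of `f` at `a` is `c`: near `a`, `f` is a polynomial in the local
logarithm with coefficients holomorphic at `a`, and `c` is the value at `a` of the coefficient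
in degree zero. In particular `L_{aⁿ}(a) = (-log a)ⁿ / n!` for `a ≠ 0`, and `L_{0ⁿ}(0) = 0`
for `n ≥ 1`. -/
def HasRegValue (S : Finset ℂ) (a : ℂ) (f : ℂ → ℂ) (c : ℂ) : Prop :=
  ∃ (n : ℕ) (h : ℕ → ℂ → ℂ), (∀ l, AnalyticAt ℂ (h l) a) ∧
    (∀ᶠ z in 𝓝[side S a] a, f z = ∑ l ∈ Finset.range (n + 1), h l z * locLog a z ^ l) ∧
    h 0 a = c

/-! ### Residues -/

/-- The ring of regular functions on the complement of `S`. -/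
def regFun (S : Finset ℂ) : Subalgebra ℂ (ℂ → ℂ) :=
  Algebra.adjoin ℂ ({fun z => z} ∪ {φ | ∃ a ∈ S, φ = fun z => (z - a)⁻¹})

/-- The residue of `φ` at the isolated singularity `a` is `c`. -/
def HasRes (a : ℂ) (φ : ℂ → ℂ) (c : ℂ) : Prop :=
  ∀ᶠ r in 𝓝[>] (0 : ℝ), (2 * Real.pi * Complex.I)⁻¹ * (∮ z in C(a, r), φ z) = c

/-- The residue of a hyperlogarithm with coefficients in `regFun S`: for `f = ∑_w φ_w L_w`,
it is `∑_w res_a(φ_w) L_w(a)`, with regularized values `L_w(a)`. -/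
def HasHLRes (S : Finset ℂ) (a : ℂ) (f : ℂ → ℂ) (c : ℂ) : Prop :=
  ∃ (W : Finset (List ℂ)) (φ : List ℂ → ℂ → ℂ) (ρ v : List ℂ → ℂ),
    (∀ w ∈ W, (∀ b ∈ w, b ∈ S) ∧ φ w ∈ regFun S ∧ HasRes a (φ w) (ρ w) ∧
      HasRegValue S a (hlogOn S w) (v w)) ∧
    (∀ z ∈ dom S, f z = ∑ w ∈ W, φ w z * hlogOn S w z) ∧
    ∑ w ∈ W, ρ w * v w = c

/-! ### Monodromy -/

/-- Analytic continuation along the path `γ : [0, 1] → ℂ` takes the germ of `f` at `γ 0` to the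
germ of `g` at `γ 1`. -/
def ContinuesAlong (γ : ℝ → ℂ) (f g : ℂ → ℂ) : Prop :=
  ∃ F : ℝ → ℂ → ℂ,
    (∀ t ∈ Set.Icc (0 : ℝ) 1, AnalyticAt ℂ (F t) (γ t) ∧
      ∀ᶠ s in 𝓝[Set.Icc (0 : ℝ) 1] t, F s =ᶠ[𝓝 (γ s)] F t) ∧
    F 0 =ᶠ[𝓝 (γ 0)] f ∧ F 1 =ᶠ[𝓝 (γ 1)] g

/-- The circle around `a` that starts at `q` and runs once in counter-clockwise direction. -/
def circleFrom (a q : ℂ) (t : ℝ) : ℂ := a + (q - a) * Complex.exp (2 * Real.pi * Complex.I * t)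

/-- `𝓜_a f = g`: the function `f` on `dom S` is continued along the loop which runs inside
`dom S` to a point `q` next to `a` (this does not change the branch), once around `a` on a small
circle, and back inside `dom S`. -/
def IsMonodromy (S : Finset ℂ) (a : ℂ) (f g : ℂ → ℂ) : Prop :=
  DifferentiableOn ℂ f (dom S) ∧ DifferentiableOn ℂ g (dom S) ∧
    ∀ᶠ q in 𝓝[side S a] a, ContinuesAlong (circleFrom a q) f g

/-- `m_a f = g` for the infinitesimal monodromy `m_a`, where `𝓜_a = exp (2πi m_a)`, that is,
`2πi m_a f = ∑_{k ≥ 1} (-1)^{k+1} (𝓜_a - 1)^k f / k` with `(𝓜_a - 1)^N f = 0` for some `N`.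
Here `u k` is `(𝓜_a - 1)^k f`. -/
def IsInfMonodromy (S : Finset ℂ) (a : ℂ) (f g : ℂ → ℂ) : Prop :=
  ∃ (N : ℕ) (u : ℕ → ℂ → ℂ), u 0 = f ∧
    (∀ k, IsMonodromy S a (u k) (u k + u (k + 1))) ∧
    (∀ z ∈ dom S, u N z = 0) ∧
    ∀ z ∈ dom S,
      2 * Real.pi * Complex.I * g z = ∑ k ∈ Finset.Ico 1 N, (-1) ^ (k + 1) / (k : ℂ) * u k z

/-! ### The arrows of the hexagon

The tensor products `Σ ⊗ HL^ℂ` and `Σ ⊗ ∂_z HL^ℂ` are the spaces of families `x`, indexed by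
`S`, that correspond to `∑_{a ∈ S} a ⊗ x a`. -/

/-- `m f = ∑_{a ∈ S} a ⊗ m_a f` equals `x`. -/
def IsGenMonodromy (S : Finset ℂ) (f : ℂ → ℂ) (x : S → ℂ → ℂ) : Prop :=
  ∀ a : S, IsInfMonodromy S a f (x a)

/-- `π_{∂z} f = g`: subtraction of all residues. -/
def IsResProj (S : Finset ℂ) (f g : ℂ → ℂ) : Prop :=
  ∃ r : S → ℂ, (∀ a : S, HasHLRes S a f (r a)) ∧
    ∀ z ∈ dom S, g z = f z - ∑ a : S, r a / (z - a)

/-- `∫_0 f dz = F`: `F` is a primitive of `f` with regularized value `0` at `0`. -/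
def IsIntZero (S : Finset ℂ) (f F : ℂ → ℂ) : Prop := IsDeriv S F f ∧ HasRegValue S 0 F 0

/-- `π_m x = y`: on the component `a`, subtraction of the regularized value at `a`. -/
def IsEvalProj (S : Finset ℂ) (x y : S → ℂ → ℂ) : Prop :=
  ∀ a : S, ∃ c : ℂ, HasRegValue S a (x a) c ∧ ∀ z ∈ dom S, y a z = x a z - c

/-- `m⁻¹ x = X`: `m X = x`, and `X` has regularized value `0` at `0`. -/
def IsGenMonodromyInv (S : Finset ℂ) (x : S → ℂ → ℂ) (X : ℂ → ℂ) : Prop :=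
  IsGenMonodromy S X x ∧ HasRegValue S 0 X 0

end Hyperlog

end

open Hyperlog

noncomputable section

namespace Hyperlog

section

/-! ### Geometry of the cut plane -/

/-! Near `a`, a hyperlogarithm is a polynomial in the local logarithm ℓ_a with coefficients
holomorphic at `a`. A turn around `a` adds 2πi to ℓ_a and leaves the coefficients alone. So 𝓜_a is
the Taylor shift by 2πi, and m_a is the derivative with respect to ℓ_a
(`isInfMonodromy_of_logDeriv`). The coefficients are unique, because repeated continuation of a
vanishing polynomial produces more zeros than its degree allows (`Rep.unique`). The analytic notions
thereby become linear algebra; in particular m_a commutes with ∂_z (`LogDeriv.deriv`).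

Integration letter by letter gives `hlogOn_expansion`, with two consequences. First, m_a removes an
initial letter a: m_a L_w is a combination of shorter words, and its part of length |w| - 1 is L_u
if w = au and zero otherwise. By induction on the length, the L_w are linearly independent over the
functions holomorphic outside S (`linAn_injective`), m is onto (`genMonH_surjective`), and its
kernel consists of the constants (`exists_eq_smul_one_of_genMonH`). Independence makes residues well
defined, and the kernel makes m⁻¹ well defined. Second, the coefficient of ℓ_a in L_{vb} has at a
the value L_v(a) if b = a and 0 otherwise, whence res_a(∂F) = (m_a F)(a) (`hasHLRes_derivMap`).

For the hexagon write f = ∂F with F(0) = 0. Then ∫ π f = F - ∑ (m_a F)(a) L_a. Since m_b L_a = δ_ab,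
its generic monodromy has the components m_a F - (m_a F)(a). On the other side m_a ∂F = ∂ m_a F
integrates to m_a F - (m_a F)(0), and π_m replaces the constant by (m_a F)(a). Both ends have the
same image under m and the value 0 at 0, so they agree. -/

lemma isClosed_ray (b : ℂ) : IsClosed {z : ℂ | ∃ t : ℝ, 1 ≤ t ∧ z = t * b} := by
  rcases eq_or_ne b 0 with rfl | hb
  · convert isClosed_singleton (x := (0 : ℂ)) using 1
    ext z
    simp only [mul_zero, Set.mem_ofPred_eq, Set.mem_singleton_iff]
    exact ⟨fun ⟨_, _, h⟩ => h, fun h => ⟨1, le_rfl, h⟩⟩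
  · have : {z : ℂ | ∃ t : ℝ, 1 ≤ t ∧ z = t * b} = {z | (z / b).im = 0} ∩ {z | 1 ≤ (z / b).re} := by
      ext z
      constructor
      · rintro ⟨t, ht, rfl⟩
        simp [mul_div_assoc, div_self hb, ht]
      · rintro ⟨h1, h2⟩
        refine ⟨(z / b).re, h2, ?_⟩
        have : ((z / b).re : ℂ) = z / b := Complex.ext (by simp) (by simpa using h1.symm)
        rw [this, div_mul_cancel₀ _ hb]
    rw [this]
    refine IsClosed.inter (isClosed_eq ?_ continuous_const) (isClosed_le continuous_const ?_)
    · exact Complex.continuous_im.comp (continuous_id.div_const b)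
    · exact Complex.continuous_re.comp (continuous_id.div_const b)

lemma dom_eq (S : Finset ℂ) :
    dom S = Complex.slitPlane ∩ ⋂ b ∈ S, {z : ℂ | ∃ t : ℝ, 1 ≤ t ∧ z = t * b}ᶜ := by
  ext z
  simp only [dom, Set.mem_ofPred_eq, Set.mem_inter_iff, Set.mem_iInter, Set.mem_compl_iff,
    not_exists, not_and]

lemma isOpen_dom (S : Finset ℂ) : IsOpen (dom S) := by
  rw [dom_eq]
  exact Complex.isOpen_slitPlane.inter
    (isOpen_biInter_finset fun b _ => (isClosed_ray b).isOpen_compl)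

lemma smul_mem_slitPlane {s : ℝ} (hs : 0 < s) {z : ℂ} (hz : z ∈ Complex.slitPlane) :
    (s : ℂ) * z ∈ Complex.slitPlane := by
  rw [Complex.mem_slitPlane_iff] at hz ⊢
  simpa [hs, hs.ne'] using hz

lemma smul_mem_dom {S : Finset ℂ} {z : ℂ} (hz : z ∈ dom S) {s : ℝ} (hs : 0 < s) (hs1 : s ≤ 1) :
    (s : ℂ) * z ∈ dom S := by
  refine ⟨smul_mem_slitPlane hs hz.1, fun a ha t ht h => hz.2 a ha (t / s) ?_ ?_⟩
  · rw [le_div_iff₀ hs]; linarith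
  · have : (s : ℂ) ≠ 0 := by exact_mod_cast hs.ne'
    push_cast
    rw [div_mul_eq_mul_div, eq_div_iff this, ← h, mul_comm]

lemma ne_of_mem_dom {S : Finset ℂ} {z a : ℂ} (hz : z ∈ dom S) (ha : a ∈ S) : z ≠ a := by
  simpa using hz.2 a ha 1 le_rfl

lemma ne_zero_of_mem_dom {S : Finset ℂ} {z : ℂ} (hz : z ∈ dom S) : z ≠ 0 :=
  Complex.slitPlane_ne_zero hz.1

lemma side_subset_dom (S : Finset ℂ) (a : ℂ) : side S a ⊆ dom S := fun _ h => h.1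

lemma isOpen_side (S : Finset ℂ) (a : ℂ) : IsOpen (side S a) := by
  by_cases ha : a = 0
  · have : side S a = dom S := by ext z; simp [side, ha]
    rw [this]
    exact isOpen_dom S
  · have : side S a = dom S ∩ {z | (z / a).im < 0} := by ext z; simp [side, ha]
    rw [this]
    refine (isOpen_dom S).inter ?_
    exact isOpen_lt (Complex.continuous_im.comp (continuous_id.div_const a)) continuous_const

lemma ne_of_mem_side {S : Finset ℂ} {z a : ℂ} (hz : z ∈ side S a) : z ≠ a := by
  rcases hz.2 with rfl | h
  · exact ne_zero_of_mem_dom hz.1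
  · rintro rfl
    rcases eq_or_ne z 0 with rfl | h0
    · simp at h
    · simp [div_self h0] at h

/-- The model of `side S a` near `a`. -/
def localSide (a : ℂ) : Set ℂ := if a = 0 then Complex.slitPlane else {z | (z / a).im < 0}

lemma side_subset_localSide (S : Finset ℂ) (a : ℂ) : side S a ⊆ localSide a := by
  intro z hz
  unfold localSide
  split_ifs with h
  · exact hz.1.1
  · exact hz.2.resolve_left h

/-- A closed ray that misses `a` misses a neighbourhood of `a`. For `a ≠ 0`, a ray through `a`
consists of real multiples of `a`, which the condition on the imaginary part excludes; the same
applies to the cut when `a` is negative. -/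
lemma eventually_localSide (S : Finset ℂ) (a : ℂ) : ∀ᶠ z in 𝓝 a, z ∈ localSide a → z ∈ side S a := by
  unfold localSide
  rcases eq_or_ne a 0 with rfl | ha
  · simp only [↓reduceIte]
    have : ∀ b ∈ S, ∀ᶠ z in 𝓝 (0 : ℂ), z ∈ Complex.slitPlane → ∀ t : ℝ, 1 ≤ t → z ≠ t * b := by
      intro b _
      rcases eq_or_ne b 0 with rfl | hb
      · filter_upwards with z hz t _ h
        exact Complex.slitPlane_ne_zero hz (by simpa using h)
      · have : (0 : ℂ) ∈ {z : ℂ | ∃ t : ℝ, 1 ≤ t ∧ z = t * b}ᶜ := by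
          rintro ⟨t, ht, h⟩
          rcases mul_eq_zero.1 h.symm with h | h
          · have : t = 0 := by exact_mod_cast h
            linarith
          · exact hb h
        filter_upwards [(isClosed_ray b).isOpen_compl.mem_nhds this] with z hz _ t ht h
        exact hz ⟨t, ht, h⟩
    filter_upwards [(Filter.eventually_all_finset S).2 this] with z hz h
    exact ⟨⟨h, fun b hb => hz b hb h⟩, Or.inl rfl⟩
  · simp only [ha, ↓reduceIte, Set.mem_ofPred_eq]
    have key : ∀ b : ℂ, ∀ᶠ z in 𝓝 a, (z / a).im < 0 → ∀ t : ℝ, 1 ≤ t → z ≠ t * b := by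
      intro b
      by_cases hb : a ∈ {z : ℂ | ∃ t : ℝ, 1 ≤ t ∧ z = t * b}
      · obtain ⟨t₀, ht₀, hab⟩ := hb
        filter_upwards with z hz t _ h
        have hb0 : b ≠ 0 := by rintro rfl; simp at hab; exact ha hab
        rw [h, hab, mul_div_mul_right _ _ hb0, ← Complex.ofReal_div, Complex.ofReal_im] at hz
        exact lt_irrefl _ hz
      · filter_upwards [(isClosed_ray b).isOpen_compl.mem_nhds hb] with z hz _ t ht h
        exact hz ⟨t, ht, h⟩
    have slit : ∀ᶠ z in 𝓝 a, (z / a).im < 0 → z ∈ Complex.slitPlane := by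
      by_cases hs : a ∈ Complex.slitPlane
      · filter_upwards [Complex.isOpen_slitPlane.mem_nhds hs] with z hz _ using hz
      · filter_upwards with z hz
        rw [Complex.mem_slitPlane_iff, not_or, not_lt, not_not] at hs
        rw [Complex.mem_slitPlane_iff]
        right
        intro h0
        have e : z / a = ((z.re / a.re : ℝ) : ℂ) := by
          have h1 : z = (z.re : ℂ) := Complex.ext rfl (by simpa using h0)
          have h2 : a = (a.re : ℂ) := Complex.ext rfl (by simpa using hs.2)
          rw [h1, h2]; simp
        rw [e, Complex.ofReal_im] at hz
        exact lt_irrefl _ hz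
    filter_upwards [(Filter.eventually_all_finset S).2 fun b _ => key b, slit] with z hz hs h
    exact ⟨⟨hs h, fun b hb => hz b hb h⟩, Or.inr h⟩

lemma isPreconnected_slit_ball {ε : ℝ} (hε : 0 < ε) :
    IsPreconnected (Complex.slitPlane ∩ Metric.ball (0 : ℂ) ε) := by
  have h : StarConvex ℝ ((ε / 2 : ℝ) : ℂ) (Complex.slitPlane ∩ Metric.ball (0 : ℂ) ε) := by
    refine (Complex.starConvex_ofReal_slitPlane (half_pos hε)).inter
      ((convex_ball (0 : ℂ) ε).starConvex ?_)
    simp [abs_of_pos hε, hε]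
  refine (h.isPathConnected ⟨Complex.ofReal_mem_slitPlane.2 (half_pos hε), ?_⟩).isConnected.2
  simp [abs_of_pos hε, hε]

lemma isPreconnected_localSide_ball (a : ℂ) {ε : ℝ} (hε : 0 < ε) :
    IsPreconnected (localSide a ∩ Metric.ball a ε) := by
  unfold localSide
  split_ifs with h
  · subst h; exact isPreconnected_slit_ball hε
  · refine (Convex.inter ?_ (convex_ball a ε)).isPreconnected
    have : {z : ℂ | (z / a).im < 0} =
        (Complex.imLm ∘ₗ (LinearMap.mulRight ℝ (a⁻¹))) ⁻¹' Set.Iio 0 := by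
      ext z; simp [div_eq_mul_inv]
    rw [this]
    exact (convex_Iio 0).linear_preimage _

lemma localSide_frequently (a : ℂ) {ε : ℝ} (hε : 0 < ε) :
    (localSide a ∩ Metric.ball a ε).Nonempty := by
  unfold localSide
  split_ifs with h
  · subst h
    exact ⟨((ε / 2 : ℝ) : ℂ), Complex.ofReal_mem_slitPlane.2 (half_pos hε),
      by simp [abs_of_pos hε, hε]⟩
  · have ha : 0 < ‖a‖ := norm_pos_iff.2 h
    refine ⟨a * (1 - (ε / (2 * ‖a‖) : ℝ) * Complex.I), ?_, ?_⟩
    · have : 0 < ε / (2 * ‖a‖) := by positivity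
      rw [Set.mem_ofPred_eq, mul_div_cancel_left₀ _ h]
      simp only [Complex.sub_im, Complex.one_im, Complex.im_ofReal_mul, Complex.I_im]
      linarith
    · rw [Metric.mem_ball, dist_eq_norm]
      have : a * (1 - ((ε / (2 * ‖a‖) : ℝ) : ℂ) * Complex.I) - a =
        -(a * ((ε / (2 * ‖a‖) : ℝ) : ℂ) * Complex.I) := by ring
      rw [this, norm_neg, norm_mul, norm_mul, Complex.norm_I, Complex.norm_real, Real.norm_eq_abs,
        abs_of_pos (by positivity)]
      field_simp
      linarith

/-- Arbitrarily close to `a`, the side of approach is connected. -/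
lemma exists_connected_side {S : Finset ℂ} {a : ℂ} {s : Set ℂ} (hs : s ∈ 𝓝[side S a] a) :
    ∃ U ∈ 𝓝[side S a] a, U ⊆ s ∧ U ⊆ side S a ∧ IsOpen U ∧ IsPreconnected U ∧ U.Nonempty := by
  obtain ⟨ε, hε, h⟩ := Metric.eventually_nhds_iff_ball.1
    ((eventually_localSide S a).and (mem_nhdsWithin_iff_eventually.1 hs))
  have hU : localSide a ∩ Metric.ball a ε = side S a ∩ Metric.ball a ε := by
    ext z
    exact ⟨fun hz => ⟨(h z hz.2).1 hz.1, hz.2⟩, fun hz => ⟨side_subset_localSide S a hz.1, hz.2⟩⟩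
  refine ⟨localSide a ∩ Metric.ball a ε, ?_, ?_, ?_, ?_, isPreconnected_localSide_ball a hε,
    localSide_frequently a hε⟩
  · rw [hU]
    exact inter_mem_nhdsWithin _ (Metric.ball_mem_nhds _ hε)
  · rw [hU]; exact fun z hz => (h z hz.2).2 hz.1
  · rw [hU]; exact Set.inter_subset_left
  · rw [hU]; exact (isOpen_side S a).inter Metric.isOpen_ball

instance neBot_side (S : Finset ℂ) (a : ℂ) : (𝓝[side S a] a).NeBot := by
  refine Filter.neBot_iff.2 fun h => ?_
  have h : (∅ : Set ℂ) ∈ 𝓝[side S a] a := Filter.empty_mem_iff_bot.2 h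
  obtain ⟨U, -, h1, -, -, -, h2⟩ := exists_connected_side h
  exact h2.not_subset_empty h1

/-- Every point can be moved radially towards the origin inside the domain until it enters a small
slit disc, which is connected. -/
lemma isPreconnected_dom (S : Finset ℂ) : IsPreconnected (dom S) := by
  obtain ⟨ε, hε, h⟩ := Metric.eventually_nhds_iff_ball.1 (eventually_localSide S 0)
  have hU : Complex.slitPlane ∩ Metric.ball 0 ε ⊆ dom S :=
    fun z hz => (h z hz.2 (by simpa [localSide] using hz.1)).1
  have hm : ((ε / 2 : ℝ) : ℂ) ∈ Complex.slitPlane ∩ Metric.ball 0 ε :=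
    ⟨Complex.ofReal_mem_slitPlane.2 (half_pos hε), by simp [abs_of_pos hε, hε]⟩
  refine isPreconnected_of_forall ((ε / 2 : ℝ) : ℂ) fun z hz => ?_
  set δ : ℝ := min 1 (ε / (2 * (‖z‖ + 1))) with hδ
  have hδ0 : 0 < δ := by positivity
  have hseg : IsPreconnected ((fun s : ℝ => (s : ℂ) * z) '' Set.Icc δ 1) :=
    isPreconnected_Icc.image _ (by fun_prop)
  refine ⟨(Complex.slitPlane ∩ Metric.ball 0 ε) ∪ ((fun s : ℝ => (s : ℂ) * z) '' Set.Icc δ 1),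
    ?_, Or.inl hm, Or.inr ⟨1, ⟨min_le_left _ _, le_rfl⟩, by simp⟩, ?_⟩
  · rintro w (hw | ⟨s, hs, rfl⟩)
    · exact hU hw
    · exact smul_mem_dom hz (hδ0.trans_le hs.1) hs.2
  · refine IsPreconnected.union ((δ : ℂ) * z) ⟨smul_mem_slitPlane hδ0 hz.1, ?_⟩
      ⟨δ, ⟨le_rfl, min_le_left _ _⟩, rfl⟩ (isPreconnected_slit_ball hε) hseg
    rw [mem_ball_zero_iff, norm_mul, Complex.norm_real, Real.norm_eq_abs, abs_of_pos hδ0]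
    have h1 : δ ≤ ε / (2 * (‖z‖ + 1)) := min_le_right _ _
    have h2 : ε / (2 * (‖z‖ + 1)) * (‖z‖ + 1) = ε / 2 := by field_simp
    nlinarith [norm_nonneg z]

lemma nonempty_dom (S : Finset ℂ) : (dom S).Nonempty := by
  obtain ⟨U, -, -, h1, -, -, h2⟩ := exists_connected_side (univ_mem : Set.univ ∈ 𝓝[side S 0] 0)
  exact h2.mono (h1.trans (side_subset_dom S 0))

/-- Two holomorphic functions on the cut plane that agree near `a` on the side of approach agree. -/
lemma eqOn_dom_of_eventually {S : Finset ℂ} {a : ℂ} {f g : ℂ → ℂ} (hf : DifferentiableOn ℂ f (dom S))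
    (hg : DifferentiableOn ℂ g (dom S)) (h : ∀ᶠ z in 𝓝[side S a] a, f z = g z) :
    Set.EqOn f g (dom S) := by
  obtain ⟨U, -, h1, h2, h3, -, q, hq⟩ := exists_connected_side h
  exact (hf.analyticOnNhd (isOpen_dom S)).eqOn_of_preconnected_of_eventuallyEq
    (hg.analyticOnNhd (isOpen_dom S)) (isPreconnected_dom S) (h2 hq).1
    (Filter.eventuallyEq_of_mem (h3.mem_nhds hq) h1)

/-- A property that holds near `a` on the side of approach also holds around nearby points. -/
lemma eventually_eventually_side {S : Finset ℂ} {a : ℂ} {p : ℂ → Prop}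
    (h : ∀ᶠ z in 𝓝[side S a] a, p z) : ∀ᶠ q in 𝓝[side S a] a, ∀ᶠ z in 𝓝 q, p z := by
  obtain ⟨U, hU, h1, -, h3, -, -⟩ := exists_connected_side h
  filter_upwards [hU] with q hq
  exact Filter.mem_of_superset (h3.mem_nhds hq) h1

lemma exists_eventually_eq_const {S : Finset ℂ} {a : ℂ} {f : ℂ → ℂ}
    (h : ∀ᶠ z in 𝓝[side S a] a, HasDerivAt f 0 z) : ∃ c, ∀ᶠ z in 𝓝[side S a] a, f z = c := by
  obtain ⟨U, hU, h1, h2, h3, h4, -⟩ := exists_connected_side h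
  obtain ⟨c, hc⟩ := h3.exists_is_const_of_deriv_eq_zero h4
    (fun z hz => (h1 hz).differentiableAt.differentiableWithinAt) (fun z hz => (h1 hz).deriv)
  exact ⟨c, Filter.mem_of_superset hU hc⟩

lemma nhds_side_le_punctured (S : Finset ℂ) (a : ℂ) : 𝓝[side S a] a ≤ 𝓝[≠] a :=
  nhdsWithin_mono _ fun _ hz => ne_of_mem_side hz

lemma nhds_side_le_dom (S : Finset ℂ) (a : ℂ) : ∀ᶠ z in 𝓝[side S a] a, z ∈ dom S :=
  eventually_nhdsWithin_of_forall fun _ hz => hz.1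

/-! ### The local logarithm -/

/-- The local coordinate at `a` in which the local logarithm is the principal one. -/
def coord (a z : ℂ) : ℂ := (z - a) / (if a = 0 then 1 else -a)

lemma coord_mem_slitPlane {S : Finset ℂ} {a z : ℂ} (hz : z ∈ side S a) :
    coord a z ∈ Complex.slitPlane := by
  unfold coord
  split_ifs with h
  · subst h; simpa using hz.1.1
  · rw [Complex.mem_slitPlane_iff]
    right
    have : (z - a) / -a = 1 - z / a := by field_simp; ring
    rw [this, Complex.sub_im, Complex.one_im, zero_sub, neg_ne_zero]
    exact (hz.2.resolve_left h).ne

lemma locLog_eq (a z : ℂ) :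
    locLog a z = Complex.log (coord a z) + (if a = 0 then 0 else Complex.log a) := by
  unfold locLog coord
  split_ifs with h
  · simp [h]
  · have : (z - a) / -a = 1 - z / a := by field_simp; ring
    rw [this]

lemma hasDerivAt_coord (a z : ℂ) : HasDerivAt (coord a) (1 / (if a = 0 then 1 else -a)) z :=
  ((hasDerivAt_id z).sub_const a).div_const _

lemma hasDerivAt_locLog {S : Finset ℂ} {a z : ℂ} (hz : z ∈ side S a) :
    HasDerivAt (locLog a) (z - a)⁻¹ z := by
  have h := ((hasDerivAt_coord a z).clog (coord_mem_slitPlane hz)).add_const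
    (if a = 0 then 0 else Complex.log a)
  have e : locLog a = fun z => Complex.log (coord a z) + (if a = 0 then 0 else Complex.log a) :=
    funext (locLog_eq a)
  rw [e]
  refine h.congr_deriv ?_
  have hz' : z - a ≠ 0 := sub_ne_zero.2 (ne_of_mem_side hz)
  simp only [coord]
  split_ifs with h
  · simp
  · field_simp

end

section

/-! ### Uniqueness of analytic continuation -/

/-- By the identity theorem on a disc around `γ t`, two continuations agree near `γ s` if and only
if they agree near `γ t`, for `s` close to `t`. Connectedness of the interval propagates this
equivalence from 0 to 1. -/
lemma ContinuesAlong.unique {γ : ℝ → ℂ} (hγ : Continuous γ) {f f' g g' : ℂ → ℂ}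
    (h : ContinuesAlong γ f g) (h' : ContinuesAlong γ f' g') (hf : f =ᶠ[𝓝 (γ 0)] f') :
    g =ᶠ[𝓝 (γ 1)] g' := by
  obtain ⟨F, hF, hF0, hF1⟩ := h
  obtain ⟨G, hG, hG0, hG1⟩ := h'
  have key : (F 0 =ᶠ[𝓝 (γ 0)] G 0) ↔ (F 1 =ᶠ[𝓝 (γ 1)] G 1) := by
    refine (isPreconnected_Icc (a := (0 : ℝ)) (b := 1)).induction₂
      (fun s t => (F s =ᶠ[𝓝 (γ s)] G s) ↔ (F t =ᶠ[𝓝 (γ t)] G t)) ?_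
      (fun _ _ _ _ _ _ h1 h2 => h1.trans h2) (fun _ _ _ _ h => h.symm)
      ⟨le_rfl, zero_le_one⟩ ⟨zero_le_one, le_rfl⟩
    intro t ht
    obtain ⟨ε, hε, hB⟩ := Metric.eventually_nhds_iff_ball.1
      ((hF t ht).1.eventually_analyticAt.and (hG t ht).1.eventually_analyticAt)
    have hp : IsPreconnected (Metric.ball (γ t) ε) := (convex_ball _ _).isPreconnected
    have hnear : ∀ᶠ s in 𝓝[Set.Icc (0 : ℝ) 1] t, γ s ∈ Metric.ball (γ t) ε :=
      nhdsWithin_le_nhds (hγ.continuousAt.eventually (Metric.ball_mem_nhds _ hε))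
    filter_upwards [(hF t ht).2, (hG t ht).2, hnear] with s h1 h2 h3
    have htt : γ t ∈ Metric.ball (γ t) ε := Metric.mem_ball_self hε
    constructor
    · intro h
      have := AnalyticOnNhd.eqOn_of_preconnected_of_eventuallyEq (fun z hz => (hB z hz).1)
        (fun z hz => (hB z hz).2) hp htt h
      exact (h1.trans (Filter.eventuallyEq_of_mem (Metric.isOpen_ball.mem_nhds h3) this)).trans
        h2.symm
    · intro h
      have := AnalyticOnNhd.eqOn_of_preconnected_of_eventuallyEq (fun z hz => (hB z hz).1)
        (fun z hz => (hB z hz).2) hp h3 ((h1.symm.trans h).trans h2)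
      exact Filter.eventuallyEq_of_mem (Metric.isOpen_ball.mem_nhds htt) this
  exact (hF1.symm.trans (key.1 ((hF0.trans hf).trans hG0.symm))).trans hG1

lemma continuous_circleFrom (a q : ℂ) : Continuous (circleFrom a q) := by
  unfold circleFrom
  fun_prop

lemma circleFrom_zero (a q : ℂ) : circleFrom a q 0 = q := by simp [circleFrom]

lemma circleFrom_one (a q : ℂ) : circleFrom a q 1 = q := by
  simp [circleFrom, Complex.exp_two_pi_mul_I]

/-! ### Polynomials in the local logarithm -/

open Polynomial

/-- The specialization at `z` of a polynomial with functions as coefficients. -/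
def atPt (P : (ℂ → ℂ)[X]) (z : ℂ) : ℂ[X] := P.map (Pi.evalRingHom (fun _ => ℂ) z)

/-- The value at `z` of a polynomial in the local logarithm at `a`. -/
def ev (a : ℂ) (P : (ℂ → ℂ)[X]) (z : ℂ) : ℂ := (atPt P z).eval (locLog a z)

lemma coeff_atPt (P : (ℂ → ℂ)[X]) (z : ℂ) (l : ℕ) : (atPt P z).coeff l = P.coeff l z := by
  simp [atPt]

lemma natDegree_atPt_le (P : (ℂ → ℂ)[X]) (z : ℂ) : (atPt P z).natDegree ≤ P.natDegree :=
  natDegree_map_le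

lemma eval_atPt (P : (ℂ → ℂ)[X]) (z x : ℂ) :
    (atPt P z).eval x = ∑ l ∈ Finset.range (P.natDegree + 1), P.coeff l z * x ^ l := by
  rw [eval_eq_sum_range' (Nat.lt_succ_of_le (natDegree_atPt_le P z))]
  simp [coeff_atPt]

lemma atPt_derivative (P : (ℂ → ℂ)[X]) (z : ℂ) : atPt (derivative P) z = derivative (atPt P z) :=
  (derivative_map P _).symm

/-- The coefficients are holomorphic on a punctured neighbourhood of `a`. -/
def PunctCoeffs (a : ℂ) (P : (ℂ → ℂ)[X]) : Prop :=
  ∀ l, ∀ᶠ z in 𝓝[≠] a, AnalyticAt ℂ (P.coeff l) z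

lemma PunctCoeffs.eventually {a : ℂ} {P : (ℂ → ℂ)[X]} (h : PunctCoeffs a P) :
    ∀ᶠ z in 𝓝[≠] a, ∀ l, AnalyticAt ℂ (P.coeff l) z := by
  have : ∀ᶠ z in 𝓝[≠] a, ∀ l ∈ Finset.range (P.natDegree + 1), AnalyticAt ℂ (P.coeff l) z :=
    (Filter.eventually_all_finset _).2 fun l _ => h l
  filter_upwards [this] with z hz l
  by_cases hl : l ≤ P.natDegree
  · exact hz l (Finset.mem_range.2 (Nat.lt_succ_of_le hl))
  · rw [coeff_eq_zero_of_natDegree_lt (not_le.1 hl)]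
    exact analyticAt_const

lemma analyticAt_eval_atPt {P : (ℂ → ℂ)[X]} {z : ℂ} (h : ∀ l, AnalyticAt ℂ (P.coeff l) z)
    {x : ℂ → ℂ} (hx : AnalyticAt ℂ x z) : AnalyticAt ℂ (fun y => (atPt P y).eval (x y)) z := by
  simp only [eval_atPt]
  exact Finset.analyticAt_fun_sum _ fun l _ => (h l).mul (hx.pow l)

/-- `x ↦ log` is additive near `(1, u)` for `u` in the slit plane. -/
lemma eventually_log_mul {u : ℂ} (hu : u ∈ Complex.slitPlane) :
    ∀ᶠ x in 𝓝 (1 : ℂ), Complex.log (x * u) = Complex.log x + Complex.log u := by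
  have hu0 : u ≠ 0 := Complex.slitPlane_ne_zero hu
  have hc : ContinuousAt (fun x => (Complex.log x + Complex.log u).im) 1 :=
    Complex.continuous_im.continuousAt.comp
      ((continuousAt_clog Complex.one_mem_slitPlane).add continuousAt_const)
  have h1 : (Complex.log 1 + Complex.log u).im = u.arg := by simp [Complex.log_im]
  have hlt : u.arg < Real.pi :=
    lt_of_le_of_ne (Complex.arg_le_pi u) (Complex.mem_slitPlane_iff_arg.1 hu).1
  have e1 := hc.eventually (Ioi_mem_nhds
    (show -Real.pi < (Complex.log 1 + Complex.log u).im by rw [h1]; exact Complex.neg_pi_lt_arg u))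
  have e2 := hc.eventually (Iio_mem_nhds
    (show (Complex.log 1 + Complex.log u).im < Real.pi by rw [h1]; exact hlt))
  filter_upwards [e1, e2, isOpen_ne.mem_nhds one_ne_zero] with x h2 h3 h4
  rw [← Complex.log_exp h2 h3.le, Complex.exp_add, Complex.exp_log h4, Complex.exp_log hu0]

lemma log_mul_exp_of_small {x : ℂ} (hx : 0 < x.re) {θ : ℝ} (hθ : |θ| < Real.pi / 2) :
    Complex.log (x * Complex.exp (θ * Complex.I)) = Complex.log x + θ * Complex.I := by
  have hx0 : x ≠ 0 := by rintro rfl; simp at hx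
  have h1 := abs_lt.1 (Complex.abs_arg_lt_pi_div_two_iff.2 (Or.inl hx))
  have h2 := abs_lt.1 hθ
  have him : (Complex.log x + θ * Complex.I).im = x.arg + θ := by simp [Complex.log_im]
  rw [← Complex.log_exp (x := Complex.log x + θ * Complex.I) (by rw [him]; linarith)
    (by rw [him]; linarith), Complex.exp_add, Complex.exp_log hx0]

/-- Once around `a`, the local logarithm increases by `2πi`. -/
lemma continuesAlong_circle {S : Finset ℂ} {a : ℂ} {P : (ℂ → ℂ)[X]} (hP : PunctCoeffs a P) (c : ℂ) :
    ∀ᶠ q in 𝓝[side S a] a, ∀ f g : ℂ → ℂ,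
      f =ᶠ[𝓝 q] (fun z => (atPt P z).eval (locLog a z + c)) →
      g =ᶠ[𝓝 q] (fun z => (atPt P z).eval (locLog a z + (c + 2 * Real.pi * Complex.I))) →
      ContinuesAlong (circleFrom a q) f g := by
  obtain ⟨ε, hε, hB⟩ := Metric.eventually_nhds_iff_ball.1
    (eventually_nhdsWithin_iff.1 hP.eventually)
  filter_upwards [mem_nhdsWithin_of_mem_nhds (Metric.ball_mem_nhds a hε), self_mem_nhdsWithin]
    with q hq hqs f g hf hg
  set d : ℂ := if a = 0 then 0 else Complex.log a with hd
  have hqa : q - a ≠ 0 := sub_ne_zero.2 (ne_of_mem_side hqs)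
  have hγ : ∀ t, circleFrom a q t - a = (q - a) * Complex.exp (2 * Real.pi * Complex.I * t) := by
    intro t; simp [circleFrom]
  have hγ0 : ∀ t, circleFrom a q t - a ≠ 0 := fun t => by
    rw [hγ]; exact mul_ne_zero hqa (Complex.exp_ne_zero _)
  have hγB : ∀ t : ℝ, circleFrom a q t ∈ Metric.ball a ε := by
    intro t
    rw [Metric.mem_ball, dist_eq_norm, hγ, norm_mul]
    have : (2 * Real.pi * Complex.I * t : ℂ) = ((2 * Real.pi * t : ℝ) : ℂ) * Complex.I := by
      push_cast; ring
    rw [this, Complex.norm_exp_ofReal_mul_I, mul_one, ← dist_eq_norm]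
    exact hq
  have hx1 : ∀ w : ℂ, w - a ≠ 0 → Tendsto (fun z => (z - a) / (w - a)) (𝓝 w) (𝓝 1) := by
    intro w hw
    have : ContinuousAt (fun z => (z - a) / (w - a)) w := by fun_prop
    simpa [ContinuousAt, div_self hw] using this
  -- The logarithm is re-centred at the moving point, so that the principal branch is only used near
  -- 1; the added constant accumulates 2πi t.
  let Λ : ℝ → ℂ → ℂ := fun t z => Complex.log ((z - a) / (circleFrom a q t - a)) +
    (Complex.log (coord a q) + d + 2 * Real.pi * Complex.I * t)
  have hlocal : ∀ᶠ z in 𝓝 q, Complex.log ((z - a) / (q - a)) + (Complex.log (coord a q) + d)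
      = locLog a z := by
    filter_upwards [(hx1 q hqa).eventually (eventually_log_mul (coord_mem_slitPlane hqs))] with z hz
    rw [locLog_eq, ← add_assoc, ← hz]
    congr 2
    unfold coord
    field_simp
  refine ⟨fun t z => (atPt P z).eval (Λ t z + c), fun t ht => ⟨?_, ?_⟩, ?_, ?_⟩
  · refine analyticAt_eval_atPt (hB _ (hγB t) (sub_ne_zero.1 (hγ0 t))) ?_
    refine (AnalyticAt.add (AnalyticAt.clog (by fun_prop) ?_) analyticAt_const).add analyticAt_const
    rw [div_self (hγ0 t)]
    exact Complex.one_mem_slitPlane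
  -- A quarter turn keeps the angle below π/2, as `log_mul_exp_of_small` requires.
  · have hnear : ∀ᶠ s in 𝓝[Set.Icc (0 : ℝ) 1] t, |s - t| < 1 / 4 := by
      refine nhdsWithin_le_nhds ?_
      have : ContinuousAt (fun s : ℝ => |s - t|) t := by fun_prop
      exact this.eventually (gt_mem_nhds (by norm_num))
    filter_upwards [hnear] with s hs
    filter_upwards [(hx1 _ (hγ0 s)).eventually
      ((isOpen_lt continuous_const Complex.continuous_re).mem_nhds
        (by simp : (0 : ℝ) < (1 : ℂ).re))] with z hz
    have e : (z - a) / (circleFrom a q t - a) = (z - a) / (circleFrom a q s - a) *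
        Complex.exp (((2 * Real.pi * (s - t) : ℝ) : ℂ) * Complex.I) := by
      have : (2 * Real.pi * Complex.I * s : ℂ) = 2 * Real.pi * Complex.I * t +
          ((2 * Real.pi * (s - t) : ℝ) : ℂ) * Complex.I := by push_cast; ring
      rw [hγ, hγ, this, Complex.exp_add]
      have h1 := Complex.exp_ne_zero (2 * Real.pi * Complex.I * t)
      have h2 := Complex.exp_ne_zero (((2 * Real.pi * (s - t) : ℝ) : ℂ) * Complex.I)
      field_simp
    have e2 : Λ s z = Λ t z := by
      simp only [Λ]
      rw [e, log_mul_exp_of_small hz]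
      · push_cast; ring
      · rw [abs_mul, abs_of_pos (by positivity)]
        nlinarith [Real.pi_pos]
    simp only [e2]
  · rw [circleFrom_zero]
    refine EventuallyEq.trans ?_ hf.symm
    filter_upwards [hlocal] with z hz
    simp only [Λ, circleFrom_zero, ← hz]
    simp
  · rw [circleFrom_one]
    refine EventuallyEq.trans ?_ hg.symm
    filter_upwards [hlocal] with z hz
    simp only [Λ, circleFrom_one, ← hz]
    congr 1
    push_cast
    ring

/-- A polynomial in the local logarithm that vanishes near `a` has vanishing coefficients. -/
lemma atPt_eq_zero_of_ev_eq_zero {S : Finset ℂ} {a : ℂ} {P : (ℂ → ℂ)[X]} (hP : PunctCoeffs a P)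
    (h : ∀ᶠ z in 𝓝[side S a] a, ev a P z = 0) : ∀ᶠ z in 𝓝[side S a] a, atPt P z = 0 := by
  -- The continuation of zero is zero, so the polynomial also vanishes after `n` turns, that is, at
  -- ℓ_a + 2πi n. This gives more zeros than its degree.
  have key : ∀ n : ℕ, ∀ᶠ z in 𝓝[side S a] a,
      (atPt P z).eval (locLog a z + n * (2 * Real.pi * Complex.I)) = 0 := by
    intro n
    induction n with
    | zero => simpa [ev] using h
    | succ n ih =>
      have h0 : PunctCoeffs a 0 := fun l => by simpa using .of_forall fun _ => analyticAt_const
      filter_upwards [continuesAlong_circle hP (n * (2 * Real.pi * Complex.I)),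
        continuesAlong_circle h0 0, eventually_eventually_side ih] with q h1 h2 h3
      have h4 := h1 0 _ (h3.mono fun z hz => hz.symm) EventuallyEq.rfl
      have h5 := h2 0 0 (by simp [atPt, EventuallyEq]) (by simp [atPt, EventuallyEq])
      have h6 := h4.unique (continuous_circleFrom a q) h5 EventuallyEq.rfl
      rw [circleFrom_one] at h6
      have h7 := h6.eq_of_nhds
      simp only [Pi.zero_apply] at h7
      rw [← h7]
      push_cast
      ring_nf
  have all : ∀ᶠ z in 𝓝[side S a] a, ∀ n ∈ Finset.range (P.natDegree + 1),
      (atPt P z).eval (locLog a z + n * (2 * Real.pi * Complex.I)) = 0 :=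
    (Filter.eventually_all_finset _).2 fun n _ => key n
  filter_upwards [all] with z hz
  refine eq_zero_of_natDegree_lt_card_of_eval_eq_zero (atPt P z) (ι := Fin (P.natDegree + 1))
    (f := fun n => locLog a z + (n : ℕ) * (2 * Real.pi * Complex.I)) ?_
    (fun n => hz n (Finset.mem_range.2 n.2)) ?_
  · intro n m hnm
    have h1 : (2 * Real.pi * Complex.I : ℂ) ≠ 0 := Complex.two_pi_I_ne_zero
    have h2 := mul_right_cancel₀ h1 (add_left_cancel hnm)
    exact Fin.ext (by exact_mod_cast h2)
  · simpa using Nat.lt_succ_of_le (natDegree_atPt_le P z)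

end

section

open Polynomial

/-! ### The logarithm of the shift operator on polynomials -/

/-- The forward difference of a polynomial. -/
def shiftSub (h : ℂ) (p : ℂ[X]) : ℂ[X] := taylor h p - p

/-- The Taylor shift preserves the degree and the leading coefficient, so each difference lowers the
degree. -/
lemma shiftSub_iterate_eq_zero (h : ℂ) (p : ℂ[X]) {N : ℕ} (hN : p.natDegree < N) :
    (shiftSub h)^[N] p = 0 := by
  have h0 : ∀ n, (shiftSub h)^[n] 0 = 0 := fun n =>
    Function.iterate_fixed (by simp [shiftSub]) n
  induction N generalizing p with
  | zero => exact absurd hN (Nat.not_lt_zero _)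
  | succ N ih =>
    rw [Function.iterate_succ_apply]
    by_cases hp : p.natDegree = 0
    · rw [eq_C_of_natDegree_eq_zero hp]
      simp [shiftSub, h0]
    · refine ih _ ?_
      have hp0 : p ≠ 0 := by rintro rfl; simp at hp
      have hd : (shiftSub h p).degree < p.degree := by
        have := degree_sub_lt_left (p := taylor h p) (q := p) (degree_taylor p h)
          (by simpa using hp0) (leadingCoeff_taylor h p)
        rwa [degree_taylor] at this
      have : (shiftSub h p).natDegree < p.natDegree := by
        by_cases h1 : shiftSub h p = 0
        · rw [h1, natDegree_zero]; exact Nat.pos_of_ne_zero hp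
        · exact natDegree_lt_natDegree h1 hd
      omega

lemma fwdDiff_iterate_eval (h : ℂ) (p : ℂ[X]) (k : ℕ) :
    (fwdDiff h)^[k] (fun y => p.eval y) = fun y => ((shiftSub h)^[k] p).eval y := by
  induction k generalizing p with
  | zero => rfl
  | succ k ih =>
    rw [Function.iterate_succ_apply, Function.iterate_succ_apply, ← ih]
    congr 1
    ext y
    simp [fwdDiff, shiftSub, taylor_eval]

/-- The polynomial is X times (X - 1)⋯(X - k), so its derivative at 0 is the second factor at 0.
These numbers produce the coefficients of log(1 + Δ). -/
lemma derivative_descPochhammer_eval_zero (k : ℕ) :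
    (derivative (descPochhammer ℂ (k + 1))).eval 0 = (-1) ^ k * (k.factorial : ℂ) := by
  have h1 : ∀ k : ℕ, (descPochhammer ℂ k).eval (-1) = (-1) ^ k * (k.factorial : ℂ) := by
    intro k
    induction k with
    | zero => simp
    | succ k ih =>
      rw [descPochhammer_succ_right, eval_mul, ih, Nat.factorial_succ]
      simp
      ring
  rw [descPochhammer_succ_left, derivative_mul]
  simp [h1]

/-- This is hD = log(1 + Δ) for the step `h`: Newton's interpolation formula expands t ↦ p(x + th)
in descending factorials of t, and differentiation at t = 0 gives both sides. -/
lemma mul_derivative_eval_eq_sum_shiftSub (h : ℂ) (p : ℂ[X]) {N : ℕ} (hN : p.natDegree < N)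
    (x : ℂ) : h * (derivative p).eval x =
      ∑ k ∈ Finset.Ico 1 N, (-1) ^ (k + 1) / (k : ℂ) * ((shiftSub h)^[k] p).eval x := by
  set A : ℂ[X] := p.comp (C x + C h * X) with hA
  set B : ℂ[X] := ∑ k ∈ Finset.range N,
    C (((shiftSub h)^[k] p).eval x / (k.factorial : ℂ)) * descPochhammer ℂ k with hB
  have hAB : A = B := by
    -- Both sides are polynomials in t, so it suffices to compare them at the natural numbers, where
    -- Newton's formula is a finite sum of binomial terms.
    refine eq_of_infinite_eval_eq A B
      ((Set.infinite_range_of_injective (Nat.cast_injective (R := ℂ))).mono ?_)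
    rintro _ ⟨n, rfl⟩
    have h1 : A.eval (n : ℂ) = p.eval (x + n • h) := by
      rw [hA, eval_comp, eval_add, eval_mul, eval_C, eval_C, eval_X, nsmul_eq_mul, mul_comm h]
    have h2 := shift_eq_sum_fwdDiff_iter h (fun y => p.eval y) n x
    simp only [fwdDiff_iterate_eval] at h2
    rw [Set.mem_ofPred_eq, h1, h2, hB, eval_finsetSum]
    have e1 : ∀ k, n.choose k • ((shiftSub h)^[k] p).eval x =
        (C (((shiftSub h)^[k] p).eval x / (k.factorial : ℂ)) * descPochhammer ℂ k).eval (n : ℂ) := by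
      intro k
      rw [eval_mul, eval_C, descPochhammer_eval_eq_descFactorial, Nat.descFactorial_eq_factorial_mul_choose,
        nsmul_eq_mul]
      have : (k.factorial : ℂ) ≠ 0 := by exact_mod_cast k.factorial_ne_zero
      push_cast
      field_simp
    simp only [← e1]
    rcases le_total (n + 1) N with hle | hle
    · refine Finset.sum_subset (Finset.range_mono hle) fun k _ hk => ?_
      rw [Nat.choose_eq_zero_of_lt (by simpa using hk), zero_smul]
    · symm
      refine Finset.sum_subset (Finset.range_mono hle) fun k _ hk => ?_
      rw [shiftSub_iterate_eq_zero h p (hN.trans_le (by simpa using hk)), eval_zero, smul_zero]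
  have hd : (derivative A).eval 0 = h * (derivative p).eval x := by
    rw [hA, derivative_comp]
    simp
  rw [← hd, hAB, hB, derivative_sum, eval_finsetSum, Finset.range_eq_Ico,
    Finset.sum_eq_sum_Ico_succ_bot (by omega)]
  simp only [derivative_mul, derivative_C, zero_mul, zero_add, eval_mul, eval_C, descPochhammer_zero,
    derivative_one, eval_zero, mul_zero]
  refine Finset.sum_congr rfl fun k hk => ?_
  obtain ⟨k, rfl⟩ : ∃ j, k = j + 1 := ⟨k - 1, by have := (Finset.mem_Ico.1 hk).1; omega⟩
  rw [derivative_descPochhammer_eval_zero, Nat.factorial_succ]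
  have : (k.factorial : ℂ) ≠ 0 := by exact_mod_cast k.factorial_ne_zero
  have h2 : ((k : ℂ) + 1) ≠ 0 := by exact_mod_cast k.succ_ne_zero
  push_cast
  field_simp
  ring

lemma eval_add_eq_sum_derivative (h : ℂ) (p : ℂ[X]) {N : ℕ} (hN : p.natDegree < N) (x : ℂ) :
    p.eval (x + h) =
      ∑ j ∈ Finset.range N, h ^ j / (j.factorial : ℂ) * (derivative^[j] p).eval x := by
  rw [add_comm, ← taylor_eval, eval_eq_sum_range' (by rwa [natDegree_taylor])]
  refine Finset.sum_congr rfl fun j _ => ?_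
  rw [taylor_coeff, ← factorial_smul_hasseDeriv]
  have : (j.factorial : ℂ) ≠ 0 := by exact_mod_cast j.factorial_ne_zero
  rw [LinearMap.smul_apply, eval_smul, nsmul_eq_mul]
  field_simp

/-! ### Local representations -/

lemma PunctCoeffs.add {a : ℂ} {P Q : (ℂ → ℂ)[X]} (hP : PunctCoeffs a P) (hQ : PunctCoeffs a Q) :
    PunctCoeffs a (P + Q) := fun l => by
  rw [coeff_add]
  filter_upwards [hP l, hQ l] with z h1 h2 using h1.add h2

lemma PunctCoeffs.C_mul {a : ℂ} {P : (ℂ → ℂ)[X]} {g : ℂ → ℂ} (hP : PunctCoeffs a P)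
    (hg : ∀ᶠ z in 𝓝[≠] a, AnalyticAt ℂ g z) : PunctCoeffs a (C g * P) := fun l => by
  rw [coeff_C_mul]
  filter_upwards [hP l, hg] with z h1 h2 using h2.mul h1

lemma PunctCoeffs.derivative {a : ℂ} {P : (ℂ → ℂ)[X]} (hP : PunctCoeffs a P) :
    PunctCoeffs a (derivative P) := fun l => by
  rw [coeff_derivative]
  filter_upwards [hP (l + 1)] with z h1
  exact h1.mul ((analyticAt_const (v := (l : ℂ))).add (analyticAt_const (v := (1 : ℂ))))

lemma PunctCoeffs.zero (a : ℂ) : PunctCoeffs a 0 := fun l => by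
  simpa using .of_forall fun _ => analyticAt_const

lemma atPt_add (P Q : (ℂ → ℂ)[X]) (z : ℂ) : atPt (P + Q) z = atPt P z + atPt Q z :=
  Polynomial.map_add _

lemma atPt_C_mul (g : ℂ → ℂ) (P : (ℂ → ℂ)[X]) (z : ℂ) : atPt (C g * P) z = C (g z) * atPt P z := by
  simp [atPt]

lemma atPt_zero (z : ℂ) : atPt 0 z = 0 := Polynomial.map_zero _

/-- Near `a`, on the side of approach, `f` is the polynomial `P` in the local logarithm. -/
def Rep (S : Finset ℂ) (a : ℂ) (f : ℂ → ℂ) (P : (ℂ → ℂ)[X]) : Prop :=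
  PunctCoeffs a P ∧ ∀ᶠ z in 𝓝[side S a] a, f z = ev a P z

variable {S : Finset ℂ} {a : ℂ} {f g : ℂ → ℂ} {P Q : (ℂ → ℂ)[X]}

lemma Rep.add (h1 : Rep S a f P) (h2 : Rep S a g Q) : Rep S a (f + g) (P + Q) := by
  refine ⟨h1.1.add h2.1, ?_⟩
  filter_upwards [h1.2, h2.2] with z e1 e2
  simp [ev, atPt_add, e1, e2]

lemma Rep.mul (h : Rep S a f P) (hg : ∀ᶠ z in 𝓝[≠] a, AnalyticAt ℂ g z) :
    Rep S a (g * f) (C g * P) := by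
  refine ⟨h.1.C_mul hg, ?_⟩
  filter_upwards [h.2] with z e
  simp [ev, atPt_C_mul, e]

lemma Rep.smul (c : ℂ) (h : Rep S a f P) : Rep S a (c • f) (C (fun _ => c) * P) :=
  h.mul (g := fun _ => c) (.of_forall fun _ => analyticAt_const)

lemma Rep.zero (S : Finset ℂ) (a : ℂ) : Rep S a 0 0 :=
  ⟨PunctCoeffs.zero a, .of_forall fun z => by simp [ev, atPt_zero]⟩

lemma Rep.congr (h : Rep S a f P) (hfg : ∀ᶠ z in 𝓝[side S a] a, g z = f z) : Rep S a g P :=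
  ⟨h.1, by filter_upwards [h.2, hfg] with z h1 h2 using h2.trans h1⟩

lemma Rep.congr_dom (h : Rep S a f P) (hfg : ∀ z ∈ dom S, g z = f z) : Rep S a g P :=
  h.congr ((nhds_side_le_dom S a).mono hfg)

lemma Rep.sum {ι : Type*} (s : Finset ι) {f : ι → ℂ → ℂ} {P : ι → (ℂ → ℂ)[X]}
    (h : ∀ i ∈ s, Rep S a (f i) (P i)) : Rep S a (∑ i ∈ s, f i) (∑ i ∈ s, P i) := by
  classical
  induction s using Finset.induction_on with
  | empty => simpa using Rep.zero S a
  | insert i s hi ih =>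
    rw [Finset.sum_insert hi, Finset.sum_insert hi]
    exact (h i (Finset.mem_insert_self i s)).add (ih fun j hj => h j (Finset.mem_insert_of_mem hj))

/-- The coefficients may be singular at `a` itself, so uniqueness is an equality at nearby points of
the side of approach. It is what makes the derivative with respect to the local logarithm well
defined. -/
lemma Rep.unique (h1 : Rep S a f P) (h2 : Rep S a f Q) :
    ∀ᶠ z in 𝓝[side S a] a, atPt P z = atPt Q z := by
  have h : PunctCoeffs a (P + C (fun _ => (-1 : ℂ)) * Q) :=
    h1.1.add (h2.1.C_mul (.of_forall fun _ => analyticAt_const))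
  have e : ∀ z, atPt (P + C (fun _ => (-1 : ℂ)) * Q) z = atPt P z - atPt Q z := by
    intro z; rw [atPt_add, atPt_C_mul]; simp [sub_eq_add_neg]
  filter_upwards [atPt_eq_zero_of_ev_eq_zero h (by
    filter_upwards [h1.2, h2.2] with z e1 e2
    rw [ev, e, eval_sub, ← ev, ← ev, ← e1, ← e2, sub_self])] with z hz
  rwa [e, sub_eq_zero] at hz

/-- `f` and `g` have representations near `a`, the second one being the derivative of the first
one with respect to the local logarithm. -/
def LogDeriv (S : Finset ℂ) (a : ℂ) (f g : ℂ → ℂ) : Prop :=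
  ∃ P, Rep S a f P ∧ Rep S a g (derivative P)

lemma Rep.derivative_congr (h1 : Rep S a f P) (h2 : Rep S a f Q) (hg : Rep S a g (derivative P)) :
    Rep S a g (derivative Q) := by
  refine ⟨h2.1.derivative, ?_⟩
  filter_upwards [h1.unique h2, hg.2] with z e1 e2
  rw [e2, ev, ev, atPt_derivative, atPt_derivative, e1]

lemma LogDeriv.rep (h : LogDeriv S a f g) (hf : Rep S a f P) : Rep S a g (derivative P) := by
  obtain ⟨Q, h1, h2⟩ := h
  exact h1.derivative_congr hf h2

lemma LogDeriv.unique {g' : ℂ → ℂ} (h : LogDeriv S a f g) (h' : LogDeriv S a f g') :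
    ∀ᶠ z in 𝓝[side S a] a, g z = g' z := by
  obtain ⟨P, h1, h2⟩ := h
  filter_upwards [h2.2, (h'.rep h1).2] with z e1 e2 using e1.trans e2.symm

lemma LogDeriv.add {f' g' : ℂ → ℂ} (h : LogDeriv S a f g) (h' : LogDeriv S a f' g') :
    LogDeriv S a (f + f') (g + g') := by
  obtain ⟨P, h1, h2⟩ := h
  obtain ⟨Q, h3, h4⟩ := h'
  exact ⟨P + Q, h1.add h3, by rw [derivative_add]; exact h2.add h4⟩

lemma LogDeriv.mul {φ : ℂ → ℂ} (h : LogDeriv S a f g) (hφ : ∀ᶠ z in 𝓝[≠] a, AnalyticAt ℂ φ z) :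
    LogDeriv S a (φ * f) (φ * g) := by
  obtain ⟨P, h1, h2⟩ := h
  refine ⟨C φ * P, h1.mul hφ, ?_⟩
  rw [derivative_C_mul]
  exact h2.mul hφ

lemma LogDeriv.smul (c : ℂ) (h : LogDeriv S a f g) : LogDeriv S a (c • f) (c • g) :=
  h.mul (φ := fun _ => c) (.of_forall fun _ => analyticAt_const)

lemma LogDeriv.sum {ι : Type*} (s : Finset ι) {f g : ι → ℂ → ℂ}
    (h : ∀ i ∈ s, LogDeriv S a (f i) (g i)) : LogDeriv S a (∑ i ∈ s, f i) (∑ i ∈ s, g i) := by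
  classical
  induction s using Finset.induction_on with
  | empty => exact ⟨0, by simpa using Rep.zero S a, by simpa using Rep.zero S a⟩
  | insert i s hi ih =>
    rw [Finset.sum_insert hi, Finset.sum_insert hi]
    exact (h i (Finset.mem_insert_self i s)).add (ih fun j hj => h j (Finset.mem_insert_of_mem hj))

/-! ### Infinitesimal monodromy as a logarithmic derivative -/

lemma IsMonodromy.eqOn {f' g' : ℂ → ℂ} (h : IsMonodromy S a f g) (h' : IsMonodromy S a f' g')
    (hf : Set.EqOn f f' (dom S)) : Set.EqOn g g' (dom S) := by
  refine eqOn_dom_of_eventually (a := a) h.2.1 h'.2.1 ?_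
  filter_upwards [h.2.2, h'.2.2, nhds_side_le_dom S a] with q h1 h2 h3
  have := h1.unique (continuous_circleFrom a q) h2 (by
    rw [circleFrom_zero]
    exact eventuallyEq_of_mem ((isOpen_dom S).mem_nhds h3) hf)
  rw [circleFrom_one] at this
  exact this.eq_of_nhds

/-- Uniqueness of continuation makes the two chains (𝓜_a - 1)^k f agree term by term. Their
truncation orders may differ, but a chain that has reached zero stays zero, so both sums can be
extended to the larger order. -/
lemma IsInfMonodromy.eqOn {g' : ℂ → ℂ} (h : IsInfMonodromy S a f g) (h' : IsInfMonodromy S a f g') :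
    Set.EqOn g g' (dom S) := by
  obtain ⟨N, u, hu0, hu, huN, hg⟩ := h
  obtain ⟨N', u', hu0', hu', huN', hg'⟩ := h'
  have huu : ∀ k, Set.EqOn (u k) (u' k) (dom S) := by
    intro k
    induction k with
    | zero => rw [hu0, hu0']; exact fun _ _ => rfl
    | succ k ih =>
      intro z hz
      have h1 := (hu k).eqOn (hu' k) ih hz
      simp only [Pi.add_apply, ih hz] at h1
      exact add_left_cancel h1
  have vanish : ∀ (v : ℕ → ℂ → ℂ) (M : ℕ), (∀ k, IsMonodromy S a (v k) (v k + v (k + 1))) →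
      (∀ z ∈ dom S, v M z = 0) → ∀ k, M ≤ k → ∀ z ∈ dom S, v k z = 0 := by
    intro v M hv hM k hk
    induction k, hk using Nat.le_induction with
    | base => exact hM
    | succ k hk ih =>
      have h0 : IsMonodromy S a 0 0 := by
        refine ⟨differentiableOn_const 0, differentiableOn_const 0, ?_⟩
        filter_upwards [continuesAlong_circle (S := S) (PunctCoeffs.zero a) 0] with q hq
        exact hq 0 0 (by simp [atPt, EventuallyEq]) (by simp [atPt, EventuallyEq])
      intro z hz
      have := (hv k).eqOn h0 ih hz
      simpa [ih z hz] using this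
  intro z hz
  have e : ∀ M, N ≤ M → ∑ k ∈ Finset.Ico 1 N, (-1) ^ (k + 1) / (k : ℂ) * u k z =
      ∑ k ∈ Finset.Ico 1 M, (-1) ^ (k + 1) / (k : ℂ) * u k z := by
    intro M hM
    refine Finset.sum_subset (Finset.Ico_subset_Ico_right hM) fun k hk hk' => ?_
    rw [vanish u N hu huN k _ z hz, mul_zero]
    simp only [Finset.mem_Ico] at hk hk'
    omega
  have e' : ∀ M, N' ≤ M → ∑ k ∈ Finset.Ico 1 N', (-1) ^ (k + 1) / (k : ℂ) * u' k z =
      ∑ k ∈ Finset.Ico 1 M, (-1) ^ (k + 1) / (k : ℂ) * u' k z := by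
    intro M hM
    refine Finset.sum_subset (Finset.Ico_subset_Ico_right hM) fun k hk hk' => ?_
    rw [vanish u' N' hu' huN' k _ z hz, mul_zero]
    simp only [Finset.mem_Ico] at hk hk'
    omega
  refine mul_left_cancel₀ Complex.two_pi_I_ne_zero ?_
  rw [hg z hz, hg' z hz, e _ (le_max_left N N'), e' _ (le_max_right N N')]
  exact Finset.sum_congr rfl fun k _ => by rw [huu k hz]

/-- The truncated Taylor operator minus the identity. -/
def taylorSub (h : ℂ) (N : ℕ) (P : (ℂ → ℂ)[X]) : (ℂ → ℂ)[X] :=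
  ∑ j ∈ Finset.range N, C (fun _ => h ^ j / (j.factorial : ℂ)) * derivative^[j] P +
    C (fun _ => -1) * P

lemma atPt_sum {ι : Type*} (s : Finset ι) (P : ι → (ℂ → ℂ)[X]) (z : ℂ) :
    atPt (∑ i ∈ s, P i) z = ∑ i ∈ s, atPt (P i) z := Polynomial.map_sum _ _ _

lemma atPt_iterate_derivative (P : (ℂ → ℂ)[X]) (z : ℂ) (j : ℕ) :
    atPt (derivative^[j] P) z = derivative^[j] (atPt P z) :=
  (iterate_derivative_map P _ j).symm

lemma eval_atPt_taylor (h : ℂ) {N : ℕ} {p : ℂ[X]} (hN : p.natDegree < N) :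
    ∑ j ∈ Finset.range N, C (h ^ j / (j.factorial : ℂ)) * derivative^[j] p = taylor h p := by
  refine Polynomial.funext fun x => ?_
  rw [taylor_eval, eval_add_eq_sum_derivative h p hN, eval_finsetSum]
  simp

lemma atPt_taylorSub (h : ℂ) {N : ℕ} (z : ℂ) (hN : (atPt P z).natDegree < N) :
    atPt (taylorSub h N P) z = shiftSub h (atPt P z) := by
  rw [taylorSub, atPt_add, atPt_sum, atPt_C_mul, shiftSub, ← eval_atPt_taylor h hN]
  simp [atPt_C_mul, atPt_iterate_derivative, sub_eq_add_neg]

lemma natDegree_shiftSub_le (h : ℂ) (p : ℂ[X]) : (shiftSub h p).natDegree ≤ p.natDegree :=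
  (natDegree_sub_le _ _).trans (by rw [natDegree_taylor, max_self])

lemma atPt_taylorSub_iterate (h : ℂ) {N : ℕ} (z : ℂ) (hN : P.natDegree < N) (k : ℕ) :
    atPt ((taylorSub h N)^[k] P) z = (shiftSub h)^[k] (atPt P z) ∧
      (atPt ((taylorSub h N)^[k] P) z).natDegree < N := by
  induction k with
  | zero => exact ⟨rfl, (natDegree_atPt_le P z).trans_lt hN⟩
  | succ k ih =>
    rw [Function.iterate_succ_apply', Function.iterate_succ_apply', atPt_taylorSub h z ih.2, ← ih.1]
    exact ⟨rfl, (natDegree_shiftSub_le h _).trans_lt ih.2⟩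

/-- A linear operator that acts as the derivative with respect to the local logarithm is the
infinitesimal monodromy. -/
theorem isInfMonodromy_of_logDeriv {V : Submodule ℂ (ℂ → ℂ)}
    (hV : ∀ f ∈ V, DifferentiableOn ℂ f (dom S)) (m : V →ₗ[ℂ] V)
    (hm : ∀ f : V, LogDeriv S a f (m f)) (f : V) : IsInfMonodromy S a f (m f) := by
  obtain ⟨P, hP, -⟩ := hm f
  set N := P.natDegree + 1 with hN
  have hPN : P.natDegree < N := Nat.lt_succ_self _
  set h : ℂ := 2 * Real.pi * Complex.I with hh
  -- The operator 𝓜_a - 1, written as exp(2πi m) - 1 with a truncated exponential. `N` exceeds the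
  -- degree of `P`, so the truncation is exact on `f` and on all its iterates.
  set U : V →ₗ[ℂ] V := ∑ j ∈ Finset.range N, (h ^ j / (j.factorial : ℂ)) • m ^ j +
    (-1 : ℂ) • LinearMap.id with hU
  have hmj : ∀ (j : ℕ) (g : V) (Q : (ℂ → ℂ)[X]), Rep S a g Q →
      Rep S a ((m ^ j) g : V) (derivative^[j] Q) := by
    intro j
    induction j with
    | zero => exact fun g Q hQ => hQ
    | succ j ih =>
      intro g Q hQ
      rw [pow_succ', Function.iterate_succ_apply']
      exact (hm _).rep (ih g Q hQ)
  have hUrep : ∀ (g : V) (Q : (ℂ → ℂ)[X]), Rep S a g Q → Rep S a (U g : V) (taylorSub h N Q) := by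
    intro g Q hQ
    have := (Rep.sum (Finset.range N) fun j _ =>
      (hmj j g Q hQ).smul (h ^ j / (j.factorial : ℂ))).add (hQ.smul (-1))
    refine this.congr_dom fun z _ => ?_
    simp [hU]
  have hu : ∀ k, Rep S a ((U ^ k) f : V) ((taylorSub h N)^[k] P) := by
    intro k
    induction k with
    | zero => exact hP
    | succ k ih =>
      rw [pow_succ', Function.iterate_succ_apply']
      exact hUrep _ _ ih
  refine ⟨N, fun k => ((U ^ k) f : V), rfl, fun k => ?_, ?_, ?_⟩
  · have hd : DifferentiableOn ℂ (((U ^ k) f : V) : ℂ → ℂ) (dom S) := hV _ (Subtype.mem _)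
    have hd' : DifferentiableOn ℂ (((U ^ (k + 1)) f : V) : ℂ → ℂ) (dom S) := hV _ (Subtype.mem _)
    refine ⟨hd, hd.add hd', ?_⟩
    filter_upwards [continuesAlong_circle (hu k).1 0, eventually_eventually_side (hu k).2,
      eventually_eventually_side (hu (k + 1)).2] with q h1 h2 h3
    refine h1 _ _ ?_ ?_
    · filter_upwards [h2] with z e
      rw [e, ev, add_zero]
    -- With p the polynomial of the k-th term, that of the next term is p(ℓ + 2πi) - p(ℓ), so the
    -- sum of the two terms is the continuation.
    · filter_upwards [h2, h3] with z e e'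
      rw [Pi.add_apply, e, e', ev, ev, (atPt_taylorSub_iterate h z hPN (k + 1)).1,
        Function.iterate_succ_apply', ← (atPt_taylorSub_iterate h z hPN k).1, shiftSub, eval_sub,
        taylor_eval, zero_add, ← hh]
      ring
  · refine eqOn_dom_of_eventually (a := a) (g := 0) (hV _ (Subtype.mem _))
      (differentiableOn_const 0) ?_
    filter_upwards [(hu N).2] with z e
    rw [e, ev, (atPt_taylorSub_iterate h z hPN N).1,
      shiftSub_iterate_eq_zero _ _ ((natDegree_atPt_le P z).trans_lt hPN)]
    simp
  · refine eqOn_dom_of_eventually (a := a) ((hV _ (Subtype.mem _)).const_mul _) ?_ ?_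
    · exact DifferentiableOn.fun_sum fun k _ => (hV _ (Subtype.mem _)).const_mul _
    · have hall : ∀ᶠ z in 𝓝[side S a] a, ∀ k ∈ Finset.Ico 1 N,
          (((U ^ k) f : V) : ℂ → ℂ) z = ev a ((taylorSub h N)^[k] P) z :=
        (eventually_all_finset _).2 fun k _ => (hu k).2
      filter_upwards [((hm f).rep hP).2, hall] with z e e'
      rw [e, ev, atPt_derivative, ← hh, mul_derivative_eval_eq_sum_shiftSub h _
        ((natDegree_atPt_le P z).trans_lt hPN)]
      refine Finset.sum_congr rfl fun k hk => ?_
      rw [e' k hk, ev, (atPt_taylorSub_iterate h z hPN k).1]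

end

section

open Polynomial

/-! ### Derivatives of local representations -/

/-- The coefficients are holomorphic at `a`. -/
def RegCoeffs (a : ℂ) (P : (ℂ → ℂ)[X]) : Prop := ∀ l, AnalyticAt ℂ (P.coeff l) a

lemma RegCoeffs.punct {a : ℂ} {P : (ℂ → ℂ)[X]} (h : RegCoeffs a P) : PunctCoeffs a P :=
  fun l => nhdsWithin_le_nhds (h l).eventually_analyticAt

lemma eventually_analyticAt_inv (a : ℂ) : ∀ᶠ z in 𝓝[≠] a, AnalyticAt ℂ (fun z => (z - a)⁻¹) z := by
  filter_upwards [self_mem_nhdsWithin] with z hz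
  exact (analyticAt_id.sub analyticAt_const).inv (sub_ne_zero.2 hz)

/-- The derivative of a polynomial in the local logarithm. -/
def derivPoly (a : ℂ) (P : (ℂ → ℂ)[X]) : (ℂ → ℂ)[X] :=
  ∑ l ∈ Finset.range (P.natDegree + 1), monomial l (deriv (P.coeff l)) +
    C (fun z => (z - a)⁻¹) * derivative P

lemma coeff_derivPoly (a : ℂ) (P : (ℂ → ℂ)[X]) (l : ℕ) : (derivPoly a P).coeff l =
    deriv (P.coeff l) + (fun z => (z - a)⁻¹) * (P.coeff (l + 1) * (l + 1)) := by
  rw [derivPoly, coeff_add, coeff_C_mul, coeff_derivative, finsetSum_coeff]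
  congr 1
  simp only [coeff_monomial]
  rw [Finset.sum_ite_eq']
  split_ifs with h
  · rfl
  · rw [coeff_eq_zero_of_natDegree_lt (by simpa [Nat.lt_succ_iff] using h)]
    exact (deriv_const' (0 : ℂ)).symm

lemma PunctCoeffs.derivPoly {a : ℂ} {P : (ℂ → ℂ)[X]} (hP : PunctCoeffs a P) :
    PunctCoeffs a (derivPoly a P) := fun l => by
  rw [coeff_derivPoly, ← coeff_derivative]
  filter_upwards [hP l, hP.derivative l, eventually_analyticAt_inv a] with z h1 h2 h3
  exact h1.deriv.add (h3.mul h2)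

/-- The total derivative ∂_z + (z - a)⁻¹ ∂/∂ℓ commutes with ∂/∂ℓ, as its coefficients do not involve
ℓ. -/
lemma derivPoly_derivative (a : ℂ) (P : (ℂ → ℂ)[X]) :
    derivPoly a (derivative P) = derivative (derivPoly a P) := by
  ext l z
  rw [coeff_derivative, coeff_derivPoly, coeff_derivPoly, coeff_derivative, coeff_derivative]
  have : P.coeff (l + 1) * ((l : ℂ → ℂ) + 1) = fun z => P.coeff (l + 1) z * ((l : ℂ) + 1) := by
    ext z; simp
  rw [this]
  simp only [Pi.add_apply, Pi.mul_apply, Pi.natCast_apply, Pi.one_apply]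
  rw [deriv_mul_const_field]
  push_cast
  ring

lemma ev_eq_sum (a : ℂ) (P : (ℂ → ℂ)[X]) (z : ℂ) :
    ev a P z = ∑ l ∈ Finset.range (P.natDegree + 1), P.coeff l z * locLog a z ^ l :=
  eval_atPt P z _

lemma hasDerivAt_ev {S : Finset ℂ} {a : ℂ} {P : (ℂ → ℂ)[X]} (hP : PunctCoeffs a P) :
    ∀ᶠ z in 𝓝[side S a] a, HasDerivAt (ev a P) (ev a (derivPoly a P) z) z := by
  filter_upwards [nhds_side_le_punctured S a hP.eventually, self_mem_nhdsWithin] with z hz hs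
  have e : ev a P = fun z => ∑ l ∈ Finset.range (P.natDegree + 1), P.coeff l z * locLog a z ^ l :=
    funext (ev_eq_sum a P)
  rw [e]
  have h := HasDerivAt.fun_sum (u := Finset.range (P.natDegree + 1)) fun l _ =>
    (hz l).differentiableAt.hasDerivAt.mul ((hasDerivAt_locLog hs).fun_pow l)
  refine h.congr_deriv ?_
  rw [ev, derivPoly, atPt_add, atPt_C_mul, atPt_derivative, eval_add, eval_mul, eval_C,
    derivative_eval, sum_over_range' _ (by simp) (P.natDegree + 1)
      (Nat.lt_succ_of_le (natDegree_atPt_le P z)), atPt_sum, eval_finsetSum, Finset.mul_sum,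
    ← Finset.sum_add_distrib]
  refine Finset.sum_congr rfl fun l _ => ?_
  rw [coeff_atPt]
  simp only [atPt, map_monomial, eval_monomial]
  simp only [Pi.evalRingHom_apply]
  ring

variable {S : Finset ℂ} {a : ℂ} {f g F G : ℂ → ℂ} {P Q : (ℂ → ℂ)[X]}

lemma Rep.deriv (h : Rep S a F P) (hF : IsDeriv S F f) : Rep S a f (derivPoly a P) := by
  refine ⟨h.1.derivPoly, ?_⟩
  filter_upwards [eventually_eventually_side h.2, hasDerivAt_ev h.1, nhds_side_le_dom S a]
    with z h1 h2 h3
  exact (hF z h3).unique (h2.congr_of_eventuallyEq h1)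

/-- This is the commutation of m_a with ∂_z. -/
lemma LogDeriv.deriv (h : LogDeriv S a F G) (hF : IsDeriv S F f) (hG : IsDeriv S G g) :
    LogDeriv S a f g := by
  obtain ⟨P, h1, h2⟩ := h
  exact ⟨derivPoly a P, h1.deriv hF, by rw [← derivPoly_derivative]; exact h2.deriv hG⟩

/-! ### Primitives of local representations -/

/-- `Q` is a primitive of `P / (z - a)` with regularized value `0` at `a`. -/
def Prim (a : ℂ) (Q P : (ℂ → ℂ)[X]) : Prop :=
  RegCoeffs a Q ∧ Q.coeff 0 a = 0 ∧ ∀ l, ∀ᶠ z in 𝓝 a,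
    (z - a) * _root_.deriv (Q.coeff l) z + (l + 1) * Q.coeff (l + 1) z = P.coeff l z

lemma Prim.add {P' Q' : (ℂ → ℂ)[X]} (h : Prim a Q P) (h' : Prim a Q' P') :
    Prim a (Q + Q') (P + P') := by
  refine ⟨fun l => ?_, ?_, fun l => ?_⟩
  · rw [coeff_add]; exact (h.1 l).add (h'.1 l)
  · simp [h.2.1, h'.2.1]
  · filter_upwards [h.2.2 l, h'.2.2 l, (h.1 l).eventually_analyticAt, (h'.1 l).eventually_analyticAt]
      with z e1 e2 e3 e4
    rw [coeff_add, coeff_add, coeff_add, deriv_add e3.differentiableAt e4.differentiableAt,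
      Pi.add_apply, Pi.add_apply, ← e1, ← e2]
    ring

lemma prim_zero (a : ℂ) : Prim a 0 0 := by
  refine ⟨fun l => by rw [coeff_zero]; exact analyticAt_const, by simp, fun l => .of_forall fun z => ?_⟩
  have : _root_.deriv (0 : ℂ → ℂ) z = 0 := deriv_const z (0 : ℂ)
  simp [this]

lemma regCoeffs_monomial {g : ℂ → ℂ} (hg : AnalyticAt ℂ g a) (n : ℕ) :
    RegCoeffs a (monomial n g) := fun l => by
  rw [coeff_monomial]
  split_ifs
  · exact hg
  · exact analyticAt_const

lemma prim_monomial_const (a c : ℂ) (n : ℕ) :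
    Prim a (monomial (n + 1) (fun _ => c)) (monomial n (fun _ => (n + 1) * c)) := by
  refine ⟨regCoeffs_monomial analyticAt_const _, by simp [coeff_monomial], fun l =>
    .of_forall fun z => ?_⟩
  have h0 : _root_.deriv (0 : ℂ → ℂ) z = 0 := deriv_const z (0 : ℂ)
  have h1 : _root_.deriv ((monomial (n + 1) (fun _ : ℂ => c)).coeff l) z = 0 := by
    rw [coeff_monomial]
    split_ifs
    · exact deriv_const z c
    · exact h0
  rw [h1, coeff_monomial, coeff_monomial]
  by_cases hl : n = l
  · simp [hl]
  · simp [hl]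

lemma prim_monomial_zero {h k : ℂ → ℂ} (hh : AnalyticAt ℂ h a) (h0 : h a = 0)
    (hk : ∀ᶠ z in 𝓝 a, (z - a) * _root_.deriv h z = k z) :
    Prim a (monomial 0 h) (monomial 0 k) := by
  refine ⟨regCoeffs_monomial hh _, by simpa using h0, fun l => ?_⟩
  filter_upwards [hk] with z hz
  have h0 : _root_.deriv (0 : ℂ → ℂ) z = 0 := deriv_const z (0 : ℂ)
  rw [coeff_monomial, coeff_monomial, coeff_monomial]
  by_cases hl : 0 = l
  · simp [← hl, hz]
  · simp [hl, h0]

/-- The product rule for h ℓ^(n+1), with respect to the form dz / (z - a). -/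
lemma prim_monomial_succ {h k : ℂ → ℂ} (hh : AnalyticAt ℂ h a)
    (hk : ∀ᶠ z in 𝓝 a, (z - a) * _root_.deriv h z = k z) (n : ℕ) :
    Prim a (monomial (n + 1) h) (monomial (n + 1) k + monomial n (fun z => (n + 1) * h z)) := by
  refine ⟨regCoeffs_monomial hh _, by simp [coeff_monomial], fun l => ?_⟩
  filter_upwards [hk] with z hz
  have h0 : _root_.deriv (0 : ℂ → ℂ) z = 0 := deriv_const z (0 : ℂ)
  rw [coeff_add, coeff_monomial, coeff_monomial, coeff_monomial, coeff_monomial]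
  by_cases hl : n + 1 = l
  · subst hl
    simp [hz]
  · by_cases hl' : n = l
    · subst hl'
      simp [h0]
    · simp [hl, hl', h0]

/-- The divided difference of `g` at `a` is holomorphic on a disc, hence has a primitive there. -/
lemma exists_primitive_div {g : ℂ → ℂ} (hg : AnalyticAt ℂ g a) :
    ∃ h : ℂ → ℂ, AnalyticAt ℂ h a ∧ h a = 0 ∧
      ∀ᶠ z in 𝓝 a, (z - a) * _root_.deriv h z = g z - g a := by
  obtain ⟨ε, hε, hB⟩ := Metric.eventually_nhds_iff_ball.1 hg.eventually_analyticAt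
  have hd : DifferentiableOn ℂ (dslope g a) (Metric.ball a ε) :=
    (Complex.differentiableOn_dslope (Metric.ball_mem_nhds a hε)).2
      fun z hz => (hB z hz).differentiableAt.differentiableWithinAt
  obtain ⟨H, hH⟩ := hd.isExactOn_ball
  have hH' : ∀ z ∈ Metric.ball a ε, HasDerivAt (fun z => H z - H a) (dslope g a z) z :=
    fun z hz => (hH z hz).sub_const _
  refine ⟨fun z => H z - H a, ?_, by simp, ?_⟩
  · have : DifferentiableOn ℂ (fun z => H z - H a) (Metric.ball a ε) :=
      fun z hz => (hH' z hz).differentiableAt.differentiableWithinAt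
    exact this.analyticAt (Metric.ball_mem_nhds a hε)
  · filter_upwards [Metric.ball_mem_nhds a hε] with z hz
    rw [(hH' z hz).deriv]
    exact sub_smul_dslope g a z

/-- The form g dz / (z - a) splits into a holomorphic part and g(a) dℓ. The explicit derivative
yields m_a L_b for a single letter, with no undetermined constant. -/
lemma exists_prim_C {g : ℂ → ℂ} (hg : AnalyticAt ℂ g a) :
    ∃ Q, Prim a Q (C g) ∧ derivative Q = C (fun _ => g a) := by
  obtain ⟨h, h1, h2, h3⟩ := exists_primitive_div hg
  refine ⟨monomial 0 h + monomial 1 (fun _ => g a), ?_, ?_⟩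
  · have := (prim_monomial_zero h1 h2 h3).add (prim_monomial_const a (g a) 0)
    convert this using 1
    rw [← map_add, ← C_mul_X_pow_eq_monomial, pow_zero, mul_one]
    congr 1
    ext z
    simp
  · rw [derivative_add, derivative_monomial, derivative_monomial]
    simp

lemma exists_prim_monomial {g : ℂ → ℂ} (hg : AnalyticAt ℂ g a) (n : ℕ) :
    ∃ Q, Prim a Q (monomial n g) := by
  induction n generalizing g with
  | zero =>
    obtain ⟨Q, h, -⟩ := exists_prim_C hg
    exact ⟨Q, by simpa using h⟩
  | succ n ih =>
    obtain ⟨h, h1, h2, h3⟩ := exists_primitive_div hg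
    -- Integration by parts: the part g - g(a) contributes h ℓ^(n+1), and this correction cancels
    -- the remaining term (n+1) h ℓ^n. The constant g(a) contributes g(a) ℓ^(n+2) / (n+2).
    obtain ⟨Q, hQ⟩ := ih (g := fun z => -(((n : ℂ) + 1) * h z)) (analyticAt_const.mul h1).neg
    have h4 := prim_monomial_const a (g a / (n + 1 + 1)) (n + 1)
    have := ((prim_monomial_succ h1 h3 n).add h4).add hQ
    refine ⟨_, Eq.mp (congrArg _ ?_) this⟩
    have hn : (n : ℂ) + 1 + 1 ≠ 0 := by exact_mod_cast (n + 1).succ_ne_zero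
    have : ∀ p q r s : (ℂ → ℂ)[X], p + q + r + s = (p + r) + (q + s) := fun p q r s => by ring
    rw [this, ← map_add, ← map_add]
    have e1 : ((fun z => ((n : ℂ) + 1) * h z) + fun z => -(((n : ℂ) + 1) * h z)) = 0 := by
      ext z; simp
    have e2 : ((fun z => g z - g a) + fun _ => (((n + 1 : ℕ) : ℂ) + 1) * (g a / (n + 1 + 1))) = g := by
      ext z
      simp only [Pi.add_apply]
      push_cast
      field_simp
      ring
    rw [e1, e2]
    simp

lemma exists_prim (hP : RegCoeffs a P) : ∃ Q, Prim a Q P := by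
  rw [P.as_sum_range]
  induction (Finset.range (P.natDegree + 1)) using Finset.induction_on with
  | empty => exact ⟨0, by simpa using prim_zero a⟩
  | insert l s hl ih =>
    obtain ⟨Q, hQ⟩ := ih
    obtain ⟨Q', hQ'⟩ := exists_prim_monomial (hP l) l
    exact ⟨Q' + Q, by rw [Finset.sum_insert hl]; exact hQ'.add hQ⟩

/-- The derivative term carries the factor `z - a`, so only the algebraic relation between values
survives at `a`. It controls the vanishing at the origin and later the residues. -/
lemma Prim.coeff_succ (h : Prim a Q P) (l : ℕ) : (l + 1) * Q.coeff (l + 1) a = P.coeff l a := by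
  simpa using (h.2.2 l).self_of_nhds

lemma Prim.atPt_derivPoly (h : Prim a Q P) :
    ∀ᶠ z in 𝓝[≠] a, atPt (derivPoly a Q) z = C (z - a)⁻¹ * atPt P z := by
  have hall : ∀ᶠ z in 𝓝 a, ∀ l ∈ Finset.range (max P.natDegree Q.natDegree + 1),
      (z - a) * _root_.deriv (Q.coeff l) z + (l + 1) * Q.coeff (l + 1) z = P.coeff l z :=
    (eventually_all_finset _).2 fun l _ => h.2.2 l
  filter_upwards [nhdsWithin_le_nhds hall, self_mem_nhdsWithin] with z hz hza
  have hza' : z - a ≠ 0 := sub_ne_zero.2 hza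
  ext l
  rw [coeff_C_mul, coeff_atPt, coeff_atPt, coeff_derivPoly]
  by_cases hl : l ≤ max P.natDegree Q.natDegree
  · rw [← hz l (Finset.mem_range.2 (Nat.lt_succ_of_le hl))]
    simp only [Pi.add_apply, Pi.mul_apply, Pi.natCast_apply, Pi.one_apply]
    field_simp
  · have h1 := le_max_left P.natDegree Q.natDegree
    have h2 := le_max_right P.natDegree Q.natDegree
    rw [coeff_eq_zero_of_natDegree_lt (p := P) (by omega),
      coeff_eq_zero_of_natDegree_lt (p := Q) (by omega),
      coeff_eq_zero_of_natDegree_lt (p := Q) (by omega)]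
    simp

lemma Rep.of_hasDerivAt (hQ : PunctCoeffs a Q)
    (hf : ∀ᶠ z in 𝓝[side S a] a, HasDerivAt f (ev a (derivPoly a Q) z) z) :
    ∃ c : ℂ, Rep S a f (Q + C (fun _ => c)) := by
  obtain ⟨c, hc⟩ := exists_eventually_eq_const (S := S) (a := a) (f := fun z => f z - ev a Q z) (by
    filter_upwards [hf, hasDerivAt_ev hQ] with z h1 h2
    simpa using h1.fun_sub h2)
  have hC : PunctCoeffs a (C (fun _ => c)) := fun l => .of_forall fun z => by
    rw [coeff_C]
    split_ifs <;> exact analyticAt_const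
  refine ⟨c, hQ.add hC, ?_⟩
  filter_upwards [hc] with z hz
  rw [ev, atPt_add, eval_add, ← ev]
  simp [atPt, ← hz]

/-- Integration of a local representation. -/
lemma Rep.integrate (hg : Rep S a g P) (hQ : Prim a Q P)
    (hf : ∀ᶠ z in 𝓝[side S a] a, HasDerivAt f ((z - a)⁻¹ * g z) z) :
    ∃ c : ℂ, Rep S a f (Q + C (fun _ => c)) := by
  refine Rep.of_hasDerivAt hQ.1.punct ?_
  filter_upwards [hf, hg.2, nhds_side_le_punctured S a hQ.atPt_derivPoly] with z h1 h2 h3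
  rwa [ev, h3, eval_mul, eval_C, ← ev, ← h2]

/-- The derivative in ℓ commutes with integration up to a constant. Hence a primitive of m_a g dz /
(z - a) is the ℓ-derivative of the primitive of g dz / (z - a), up to a constant. -/
lemma Rep.integrate_derivative (hg : Rep S a g (derivative P)) (hQ : Prim a Q P)
    (hf : ∀ᶠ z in 𝓝[side S a] a, HasDerivAt f ((z - a)⁻¹ * g z) z) :
    ∃ c : ℂ, Rep S a f (derivative Q + C (fun _ => c)) := by
  refine Rep.of_hasDerivAt hQ.1.punct.derivative ?_
  filter_upwards [hf, hg.2, nhds_side_le_punctured S a hQ.atPt_derivPoly] with z h1 h2 h3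
  rwa [ev, derivPoly_derivative, atPt_derivative, h3, derivative_C_mul, eval_mul, eval_C,
    ← atPt_derivative, ← ev, ← h2]

end

section

open Polynomial

/-! ### Integration along rays -/

variable {S : Finset ℂ} {g : ℂ → ℂ} {K Q : (ℂ → ℂ)[X]}

lemma tendsto_ray (z : ℂ) : Tendsto (fun s : ℝ => (s : ℂ) * z) (𝓝[>] 0) (𝓝 0) := by
  have : Continuous fun s : ℝ => (s : ℂ) * z := by fun_prop
  simpa using (this.tendsto 0).mono_left nhdsWithin_le_nhds

lemma tendsto_ray_side {z : ℂ} (hz : z ∈ dom S) :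
    Tendsto (fun s : ℝ => (s : ℂ) * z) (𝓝[>] 0) (𝓝[side S 0] 0) := by
  refine tendsto_nhdsWithin_iff.2 ⟨tendsto_ray z, ?_⟩
  filter_upwards [Ioc_mem_nhdsGT (zero_lt_one' ℝ)] with s hs
  exact ⟨smul_mem_dom hz hs.1 hs.2, Or.inl rfl⟩

/-- A coefficient that vanishes at 0 is O(s), and any power of log s is O(s^(-1/2)); the exponent
1/2 is a convenient choice that suffices for convergence. -/
lemma isBigO_ev_ray (hreg : RegCoeffs 0 K) (hK : ∀ l, K.coeff l 0 = 0) {z : ℂ} (hz : z ≠ 0) :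
    (fun s : ℝ => ev 0 K (s * z)) =O[𝓝[>] 0] fun s : ℝ => s ^ (1 / 2 : ℝ) := by
  simp only [ev_eq_sum]
  refine Asymptotics.IsBigO.fun_sum fun l _ => ?_
  have h1 : (fun s : ℝ => K.coeff l (s * z)) =O[𝓝[>] 0] fun s : ℝ => s := by
    have := ((hreg l).differentiableAt.isBigO_sub).comp_tendsto (tendsto_ray z)
    refine (this.congr_left fun s => by simp [hK]).trans ?_
    refine Asymptotics.IsBigO.of_bound ‖z‖ (.of_forall fun s => ?_)
    simp [mul_comm]
  have h2 : (fun s : ℝ => locLog 0 (s * z) ^ l) =O[𝓝[>] 0] fun s : ℝ => s ^ (-(1 / 2) : ℝ) := by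
    have hc : (fun _ : ℝ => Complex.log z) =O[𝓝[>] 0] Real.log :=
      (Asymptotics.isLittleO_const_left.2
        (Or.inr (tendsto_abs_atBot_atTop.comp Real.tendsto_log_nhdsGT_zero))).isBigO
    have hl : (fun s : ℝ => (Real.log s : ℂ)) =O[𝓝[>] 0] Real.log :=
      Asymptotics.IsBigO.of_bound 1 (.of_forall fun s => by simp)
    have h3 := ((hl.add hc).pow l).trans
      (Asymptotics.isBigO_refl (fun s : ℝ => Real.log s ^ l) (𝓝[>] 0)).norm_right
    have h4 := (isLittleO_abs_log_rpow_rpow_nhdsGT_zero (s := -(1 / 2)) l (by norm_num)).isBigO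
    refine (h3.trans (h4.congr_left fun s => ?_)).congr' ?_ EventuallyEq.rfl
    · rw [Real.rpow_natCast, norm_pow, Real.norm_eq_abs]
    · filter_upwards [self_mem_nhdsWithin] with s hs
      rw [locLog, if_pos rfl, Complex.log_ofReal_mul hs hz]
  refine (h1.mul h2).congr' EventuallyEq.rfl ?_
  filter_upwards [self_mem_nhdsWithin] with s hs
  have hs : (0 : ℝ) < s := hs
  nth_rewrite 1 [← Real.rpow_one s]
  rw [← Real.rpow_add hs]
  norm_num

lemma tendsto_ev_ray (hreg : RegCoeffs 0 K) (hK : ∀ l, K.coeff l 0 = 0) {z : ℂ} (hz : z ≠ 0) :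
    Tendsto (fun s : ℝ => ev 0 K (s * z)) (𝓝[>] 0) (𝓝 0) := by
  refine (isBigO_ev_ray hreg hK hz).trans_tendsto ?_
  have : ContinuousAt (fun s : ℝ => s ^ (1 / 2 : ℝ)) 0 :=
    Real.continuousAt_rpow_const _ _ (Or.inr (by norm_num))
  simpa using this.tendsto.mono_left nhdsWithin_le_nhds

lemma continuousOn_ray (hg : DifferentiableOn ℂ g (dom S)) {z : ℂ} (hz : z ∈ dom S) :
    ContinuousOn (fun s : ℝ => g (s * z) * z) (Set.Ioc 0 1) :=
  (hg.continuousOn.comp (by fun_prop) fun _ hs => smul_mem_dom hz hs.1 hs.2).mul continuousOn_const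

lemma intervalIntegrable_ray (hg : DifferentiableOn ℂ g (dom S)) (hreg : RegCoeffs 0 K)
    (hK : ∀ l, K.coeff l 0 = 0) (hrep : Rep S 0 (fun z => z * g z) K) {z : ℂ} (hz : z ∈ dom S) :
    IntervalIntegrable (fun s : ℝ => g (s * z) * z) MeasureTheory.volume 0 1 := by
  have hO : (fun s : ℝ => g (s * z) * z) =O[𝓝[>] 0] fun s : ℝ => s ^ (-(1 / 2) : ℝ) := by
    have h1 := isBigO_ev_ray hreg hK (ne_zero_of_mem_dom hz)
    have h2 : (fun s : ℝ => s⁻¹) =O[𝓝[>] 0] fun s : ℝ => s⁻¹ := Asymptotics.isBigO_refl _ _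
    refine (h2.smul h1).congr' ?_ ?_
    · filter_upwards [(tendsto_ray_side hz).eventually hrep.2, self_mem_nhdsWithin] with s h3 h4
      have : (s : ℂ) ≠ 0 := by exact_mod_cast (ne_of_gt h4)
      rw [← h3, Complex.real_smul]
      push_cast
      field_simp
    · filter_upwards [self_mem_nhdsWithin] with s hs
      have hs : (0 : ℝ) < s := hs
      rw [smul_eq_mul, ← Real.rpow_neg_one, ← Real.rpow_add hs]
      norm_num
  obtain ⟨C, hC⟩ := hO.bound
  obtain ⟨η, hη, hη'⟩ := mem_nhdsGT_iff_exists_Ioc_subset.1 hC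
  have hη : (0 : ℝ) < η := hη
  set δ := min η 1 with hδ
  have hδ0 : 0 < δ := lt_min hη one_pos
  have hc := continuousOn_ray hg hz
  have hi1 : IntervalIntegrable (fun s : ℝ => g (s * z) * z) MeasureTheory.volume 0 δ := by
    have hr : IntervalIntegrable (fun s : ℝ => C * s ^ (-(1 / 2) : ℝ)) MeasureTheory.volume 0 δ :=
      (intervalIntegral.intervalIntegrable_rpow' (by norm_num)).const_mul C
    refine hr.mono_fun ?_ ?_
    · rw [Set.uIoc_of_le hδ0.le]
      exact (hc.mono (Set.Ioc_subset_Ioc_right (min_le_right _ _))).aestronglyMeasurable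
        measurableSet_Ioc
    · rw [Set.uIoc_of_le hδ0.le]
      refine MeasureTheory.ae_restrict_of_forall_mem measurableSet_Ioc fun s hs => ?_
      have h1 := hη' (Set.Ioc_subset_Ioc_right (min_le_left _ _) hs)
      rw [Set.mem_ofPred_eq] at h1
      refine h1.trans ?_
      beta_reduce
      rw [norm_mul]
      exact mul_le_mul_of_nonneg_right (le_abs_self C) (norm_nonneg _)
  have hi2 : IntervalIntegrable (fun s : ℝ => g (s * z) * z) MeasureTheory.volume δ 1 :=
    (hc.mono fun s hs => ⟨hδ0.trans_le hs.1, hs.2⟩).intervalIntegrable_of_Icc (min_le_right _ _)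
  exact hi1.trans hi2

lemma hasDerivAt_ray {f : ℂ → ℂ} {f' z : ℂ} {s : ℝ} (h : HasDerivAt f f' ((s : ℂ) * z)) :
    HasDerivAt (fun s : ℝ => f (s * z)) (f' * z) s := by
  have h1 : HasDerivAt (fun w : ℂ => w * z) z (s : ℂ) := by
    simpa using (hasDerivAt_id (s : ℂ)).mul_const z
  exact (h.comp (s : ℂ) h1).comp_ofReal

/-- Near the origin, the integral along the ray is the primitive with regularized value `0`. -/
lemma exists_integral_ray_eq (hg : DifferentiableOn ℂ g (dom S)) (hreg : RegCoeffs 0 K)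
    (hK : ∀ l, K.coeff l 0 = 0) (hrep : Rep S 0 (fun z => z * g z) K) (hQ : Prim 0 Q K) :
    ∃ ε > 0, ∀ z ∈ dom S, ‖z‖ < ε → HasDerivAt (ev 0 Q) (g z) z ∧
      ∫ s in (0 : ℝ)..1, g (s * z) * z = ev 0 Q z := by
  -- All coefficients vanish at the origin, not only the one in degree 0, so the boundary term of
  -- the integral at s → 0 is zero.
  have hQ0 : ∀ l, Q.coeff l 0 = 0 := by
    intro l
    rcases l with _ | l
    · exact hQ.2.1
    · have := hQ.coeff_succ l
      rw [hK] at this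
      exact (mul_eq_zero.1 this).resolve_left (by exact_mod_cast l.succ_ne_zero)
  have hev : ∀ᶠ z in 𝓝[side S 0] 0, HasDerivAt (ev 0 Q) (g z) z := by
    filter_upwards [hasDerivAt_ev hQ.1.punct, hrep.2,
      nhds_side_le_punctured S 0 hQ.atPt_derivPoly, nhds_side_le_punctured S 0 self_mem_nhdsWithin]
      with z h1 h2 h3 h4
    refine h1.congr_deriv ?_
    have : z ≠ 0 := h4
    rw [ev, h3, eval_mul, eval_C, ← ev, ← h2]
    field_simp
    simp
  obtain ⟨ε, hε, hB⟩ := Metric.eventually_nhds_iff_ball.1 (eventually_nhdsWithin_iff.1 hev)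
  have hB' : ∀ z ∈ dom S, ‖z‖ < ε → HasDerivAt (ev 0 Q) (g z) z := fun z hz hzε =>
    hB z (by simpa using hzε) ⟨hz, Or.inl rfl⟩
  refine ⟨ε, hε, fun z hz hzε => ⟨hB' z hz hzε, ?_⟩⟩
  have hd : ∀ s ∈ Set.Ioc (0 : ℝ) 1, HasDerivAt (fun s : ℝ => ev 0 Q (s * z)) (g (s * z) * z) s := by
    intro s hs
    refine hasDerivAt_ray (hB' _ (smul_mem_dom hz hs.1 hs.2) ?_)
    rw [norm_mul, Complex.norm_real, Real.norm_eq_abs, abs_of_pos hs.1]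
    nlinarith [norm_nonneg z, hs.1, hs.2]
  have h := intervalIntegral.integral_eq_sub_of_hasDerivAt_of_tendsto one_pos
    (fun s hs => hd s ⟨hs.1, hs.2.le⟩) (intervalIntegrable_ray hg hreg hK hrep hz)
    (tendsto_ev_ray hQ.1 hQ0 (ne_zero_of_mem_dom hz))
    ((hd 1 ⟨one_pos, le_rfl⟩).continuousAt.tendsto.mono_left nhdsWithin_le_nhds)
  rw [h]
  simp

/-- Away from s = 0 the integral may be differentiated under the sign, and the z-derivative of the
integrand is d/ds of s g(sz). -/
lemma hasDerivAt_integral_segment (hg : DifferentiableOn ℂ g (dom S)) {z₀ : ℂ} (hz₀ : z₀ ∈ dom S)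
    {δ : ℝ} (hδ : 0 < δ) (hδ1 : δ ≤ 1) :
    HasDerivAt (fun z => ∫ s in δ..1, g (s * z) * z) (g z₀ - δ * g (δ * z₀)) z₀ := by
  have hga := hg.analyticOnNhd (isOpen_dom S)
  have hdg : ContinuousOn (deriv g) (dom S) := hga.deriv.continuousOn
  obtain ⟨r, hr, hB⟩ := Metric.nhds_basis_closedBall.mem_iff.1 ((isOpen_dom S).mem_nhds hz₀)
  have hmem : ∀ z ∈ Metric.closedBall z₀ r, ∀ s ∈ Set.Icc δ 1, (s : ℂ) * z ∈ dom S :=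
    fun z hz s hs => smul_mem_dom (hB hz) (hδ.trans_le hs.1) hs.2
  let F' : ℂ → ℝ → ℂ := fun z s => deriv g (s * z) * s * z + g (s * z)
  have hF' : ContinuousOn (fun p : ℂ × ℝ => F' p.1 p.2) (Metric.closedBall z₀ r ×ˢ Set.Icc δ 1) := by
    have hm : ContinuousOn (fun p : ℂ × ℝ => (p.2 : ℂ) * p.1)
        (Metric.closedBall z₀ r ×ˢ Set.Icc δ 1) := by fun_prop
    have hmaps : Set.MapsTo (fun p : ℂ × ℝ => (p.2 : ℂ) * p.1)
        (Metric.closedBall z₀ r ×ˢ Set.Icc δ 1) (dom S) := fun p hp => hmem p.1 hp.1 p.2 hp.2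
    exact (((hdg.comp hm hmaps).mul (by fun_prop)).mul (by fun_prop)).add
      (hg.continuousOn.comp hm hmaps)
  obtain ⟨M, hM⟩ := ((isCompact_closedBall z₀ r).prod isCompact_Icc).exists_bound_of_continuousOn hF'
  have hcont : ∀ z ∈ dom S, ContinuousOn (fun s : ℝ => g (s * z) * z) (Set.Icc δ 1) := fun z hz =>
    (continuousOn_ray hg hz).mono fun s hs => ⟨hδ.trans_le hs.1, hs.2⟩
  have hcF' : ContinuousOn (F' z₀) (Set.Icc δ 1) :=
    hF'.comp (f := fun s : ℝ => (z₀, s)) (by fun_prop)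
      fun s hs => ⟨Metric.mem_closedBall_self hr.le, hs⟩
  have hIoc : Set.uIoc δ 1 = Set.Ioc δ 1 := Set.uIoc_of_le hδ1
  have hmeas : ∀ {u : ℝ → ℂ}, ContinuousOn u (Set.Icc δ 1) → MeasureTheory.AEStronglyMeasurable u
      (MeasureTheory.volume.restrict (Set.uIoc δ 1)) := fun hu => by
    rw [hIoc]
    exact (hu.mono Set.Ioc_subset_Icc_self).aestronglyMeasurable measurableSet_Ioc
  have main := intervalIntegral.hasDerivAt_integral_of_dominated_loc_of_deriv_le
    (μ := MeasureTheory.volume) (a := δ) (b := 1) (bound := fun _ => M)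
    (F := fun z (s : ℝ) => g (s * z) * z) (F' := F') (x₀ := z₀) (s := Metric.closedBall z₀ r)
    (Metric.closedBall_mem_nhds z₀ hr)
    (by filter_upwards [(isOpen_dom S).mem_nhds hz₀] with z hz using hmeas (hcont z hz))
    ((hcont z₀ hz₀).intervalIntegrable_of_Icc hδ1)
    (hmeas hcF')
    (.of_forall fun s hs z hz => hM (z, s) ⟨hz, Set.Ioc_subset_Icc_self (hIoc ▸ hs)⟩)
    intervalIntegrable_const
    (.of_forall fun s hs z hz => by
      have h1 := (hga _ (hmem z hz s (Set.Ioc_subset_Icc_self (hIoc ▸ hs)))).differentiableAt.hasDerivAt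
      have h2 : HasDerivAt (fun w : ℂ => (s : ℂ) * w) s z := by
        simpa using (hasDerivAt_id z).const_mul (s : ℂ)
      have h3 := (h1.comp z h2).mul (hasDerivAt_id z)
      refine h3.congr_deriv ?_
      simp [F'])
  refine main.2.congr_deriv ?_
  have hprim : ∀ s ∈ Set.uIcc δ 1, HasDerivAt (fun s : ℝ => (s : ℂ) * g (s * z₀)) (F' z₀ s) s := by
    intro s hs
    rw [Set.uIcc_of_le hδ1] at hs
    have h1 := (hga _ (hmem z₀ (Metric.mem_closedBall_self hr.le) s hs)).differentiableAt.hasDerivAt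
    have h2 : HasDerivAt (fun s : ℝ => (s : ℂ)) 1 s := (hasDerivAt_id s).ofReal_comp
    refine (h2.mul (hasDerivAt_ray h1)).congr_deriv ?_
    simp only [F']
    ring
  rw [intervalIntegral.integral_eq_sub_of_hasDerivAt hprim
    (hcF'.intervalIntegrable_of_Icc hδ1)]
  simp

/-- Cut the ray at a small δ. By scaling, the inner part is the local primitive at δz; the outer
part is an integral over a compact segment. Their derivatives contribute δ g(δz) with opposite
signs, which leaves g(z). -/
lemma integral_ray (hg : DifferentiableOn ℂ g (dom S)) (hreg : RegCoeffs 0 K)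
    (hK : ∀ l, K.coeff l 0 = 0) (hrep : Rep S 0 (fun z => z * g z) K) (hQ : Prim 0 Q K) :
    Rep S 0 (fun z => ∫ s in (0 : ℝ)..1, g (s * z) * z) Q ∧
      ∀ z ∈ dom S, HasDerivAt (fun z => ∫ s in (0 : ℝ)..1, g (s * z) * z) (g z) z := by
  obtain ⟨ε, hε, h⟩ := exists_integral_ray_eq hg hreg hK hrep hQ
  refine ⟨⟨hQ.1.punct, ?_⟩, fun z₀ hz₀ => ?_⟩
  · filter_upwards [nhds_side_le_dom S 0, mem_nhdsWithin_of_mem_nhds (Metric.ball_mem_nhds 0 hε)]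
      with z hz hzε
    exact (h z hz (by simpa using hzε)).2
  · set δ : ℝ := min 1 (ε / (2 * (‖z₀‖ + 1))) with hδ
    have hδ0 : 0 < δ := by positivity
    have hδ1 : δ ≤ 1 := min_le_left _ _
    have hsmall : ∀ z : ℂ, ‖z‖ < ‖z₀‖ + 1 → ‖(δ : ℂ) * z‖ < ε := by
      intro z hz
      rw [norm_mul, Complex.norm_real, Real.norm_eq_abs, abs_of_pos hδ0]
      have h1 : δ ≤ ε / (2 * (‖z₀‖ + 1)) := min_le_right _ _
      have h2 : ε / (2 * (‖z₀‖ + 1)) * (‖z₀‖ + 1) = ε / 2 := by field_simp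
      nlinarith [norm_nonneg z, norm_nonneg z₀]
    have hloc : ∀ᶠ z in 𝓝 z₀, ∫ s in (0 : ℝ)..1, g (s * z) * z =
        ev 0 Q (δ * z) + ∫ s in δ..1, g (s * z) * z := by
      have hn : ∀ᶠ z in 𝓝 z₀, ‖z‖ < ‖z₀‖ + 1 :=
        continuous_norm.continuousAt.eventually (gt_mem_nhds (lt_add_one _))
      filter_upwards [(isOpen_dom S).mem_nhds hz₀, hn] with z hz hzn
      have hi := intervalIntegrable_ray hg hreg hK hrep hz
      rw [← intervalIntegral.integral_add_adjacent_intervals (b := δ)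
        (hi.mono_set (by rw [Set.uIcc_of_le hδ0.le, Set.uIcc_of_le zero_le_one]; exact Set.Icc_subset_Icc_right hδ1))
        (hi.mono_set (by rw [Set.uIcc_of_le hδ1, Set.uIcc_of_le zero_le_one]; exact Set.Icc_subset_Icc_left hδ0.le)),
        ← (h _ (smul_mem_dom hz hδ0 hδ1) (hsmall z hzn)).2]
      congr 1
      have := intervalIntegral.integral_comp_mul_right (a := 0) (b := 1)
        (fun s : ℝ => g (s * z) * z) hδ0.ne'
      simp only [zero_mul, one_mul] at this
      have e : ∀ s : ℝ, g (s * (δ * z)) * (δ * z) = δ • (g (((s * δ : ℝ) : ℂ) * z) * z) := by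
        intro s
        rw [Complex.real_smul]
        push_cast
        ring_nf
      simp only [e, intervalIntegral.integral_smul]
      rw [this, smul_smul, mul_inv_cancel₀ hδ0.ne', one_smul]
    have h1 := (h _ (smul_mem_dom hz₀ hδ0 hδ1) (hsmall z₀ (lt_add_one _))).1
    have h2 : HasDerivAt (fun w : ℂ => (δ : ℂ) * w) δ z₀ := by
      simpa using (hasDerivAt_id z₀).const_mul (δ : ℂ)
    refine (((h1.comp z₀ h2).add (hasDerivAt_integral_segment hg hz₀ hδ0 hδ1)).congr_of_eventuallyEq
      hloc).congr_deriv ?_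
    ring

end

section

open Polynomial

/-! ### Hyperlogarithms: derivatives and expansions at the origin -/

variable {S : Finset ℂ} {a : ℂ}

lemma hlogRev_of_forall_eq_zero {w : List ℂ} (h : ∀ b ∈ w, b = 0) (z : ℂ) :
    hlogRev w z = Complex.log z ^ w.length / (w.length.factorial : ℂ) := by
  cases w with
  | nil => simp [hlogRev]
  | cons b w => rw [hlogRev, if_pos h, List.length_cons]

lemma hlogRev_of_not {b : ℂ} {w : List ℂ} (h : ¬∀ c ∈ b :: w, c = 0) :
    hlogRev (b :: w) = fun z => ∫ s in (0 : ℝ)..1, hlogRev w (s * z) / (s * z - b) * z := by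
  ext z
  rw [hlogRev, if_neg h]
  congr 1
  ext s
  ring

lemma rep_log_pow (S : Finset ℂ) (n : ℕ) (c : ℂ) :
    Rep S 0 (fun z => Complex.log z ^ n * c) (monomial n (fun _ => c)) := by
  refine ⟨(regCoeffs_monomial analyticAt_const n).punct, .of_forall fun z => ?_⟩
  simp [ev, atPt, locLog, mul_comm]

/-- `f` has an expansion at the origin whose coefficients vanish there, except that logarithms to
positive powers may occur if `p` does not hold. -/
def VanishingAtZero (S : Finset ℂ) (f : ℂ → ℂ) (w : List ℂ) : Prop :=
  ∃ P, RegCoeffs 0 P ∧ Rep S 0 f P ∧ ((∃ b ∈ w, b ≠ 0) → ∀ l, P.coeff l 0 = 0) ∧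
    (w ≠ [] → P.coeff 0 0 = 0)

/-- The induction step for a new last letter. Words in 0 alone are explicit powers of log. In the
other words the integrand times z has coefficients vanishing at 0: for b ≠ 0 because of the factor z
/ (z - b), for b = 0 because `w` then contains a nonzero letter. This makes the integral converge.
-/
lemma hlogRev_cons {b : ℂ} {w : List ℂ} (hb : b ∈ S)
    (hd : DifferentiableOn ℂ (hlogRev w) (dom S)) (hv : VanishingAtZero S (hlogRev w) w) :
    (∀ z ∈ dom S, HasDerivAt (hlogRev (b :: w)) (hlogRev w z / (z - b)) z) ∧
      VanishingAtZero S (hlogRev (b :: w)) (b :: w) := by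
  by_cases h : ∀ c ∈ b :: w, c = 0
  · have e : hlogRev (b :: w) = fun z => Complex.log z ^ (w.length + 1) *
        ((w.length + 1).factorial : ℂ)⁻¹ := by
      ext z; rw [hlogRev_of_forall_eq_zero h, List.length_cons, div_eq_mul_inv]
    obtain ⟨rfl, hw⟩ := List.forall_mem_cons.1 h
    refine ⟨fun z hz => ?_, monomial (w.length + 1) (fun _ => ((w.length + 1).factorial : ℂ)⁻¹),
      regCoeffs_monomial analyticAt_const _, by rw [e]; exact rep_log_pow S _ _,
      fun ⟨c, hc, hc0⟩ => absurd (h c hc) hc0, fun _ => by simp [coeff_monomial]⟩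
    rw [e, hlogRev_of_forall_eq_zero hw]
    refine (((Complex.hasDerivAt_log hz.1).fun_pow (w.length + 1)).mul_const _).congr_deriv ?_
    have h1 : (w.length.factorial : ℂ) ≠ 0 := by exact_mod_cast w.length.factorial_ne_zero
    have h2 : (w.length : ℂ) + 1 ≠ 0 := by exact_mod_cast w.length.succ_ne_zero
    have h3 := ne_zero_of_mem_dom hz
    rw [Nat.factorial_succ]
    push_cast
    rw [sub_zero]
    field_simp
  · rw [hlogRev_of_not h]
    obtain ⟨P, hreg, hrep, hP, -⟩ := hv
    have hg : DifferentiableOn ℂ (fun z => hlogRev w z / (z - b)) (dom S) := fun z hz =>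
      (hd z hz).div (by fun_prop) (sub_ne_zero.2 (ne_of_mem_dom hz hb))
    have hK : ∃ K, RegCoeffs 0 K ∧ (∀ l, K.coeff l 0 = 0) ∧
        Rep S 0 (fun z => z * (hlogRev w z / (z - b))) K := by
      by_cases hb0 : b = 0
      · have hw : ∃ c ∈ w, c ≠ 0 := by
          by_contra hcon
          push Not at hcon
          exact h (List.forall_mem_cons.2 ⟨hb0, hcon⟩)
        refine ⟨P, hreg, hP hw, hrep.congr_dom fun z hz => ?_⟩
        have := ne_zero_of_mem_dom hz
        rw [hb0, sub_zero]
        field_simp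
      · have hφ : AnalyticAt ℂ (fun z => z / (z - b)) 0 :=
          analyticAt_id.div (analyticAt_id.sub analyticAt_const) (by simpa using hb0)
        refine ⟨C (fun z => z / (z - b)) * P, fun l => ?_, fun l => ?_,
          (hrep.mul (nhdsWithin_le_nhds hφ.eventually_analyticAt)).congr_dom fun z _ => ?_⟩
        · rw [coeff_C_mul]; exact hφ.mul (hreg l)
        · rw [coeff_C_mul]; simp
        · simp only [Pi.mul_apply]; ring
    obtain ⟨K, hK1, hK2, hK3⟩ := hK
    obtain ⟨Q, hQ⟩ := exists_prim hK1
    obtain ⟨h1, h2⟩ := integral_ray hg hK1 hK2 hK3 hQ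
    have hQ0 : ∀ l, Q.coeff l 0 = 0 := by
      intro l
      rcases l with _ | l
      · exact hQ.2.1
      · have := hQ.coeff_succ l
        rw [hK2] at this
        exact (mul_eq_zero.1 this).resolve_left (by exact_mod_cast l.succ_ne_zero)
    exact ⟨h2, Q, hQ.1, h1, fun _ => hQ0, fun _ => hQ0 0⟩

lemma hlogRev_spec {w : List ℂ} (hw : ∀ b ∈ w, b ∈ S) :
    DifferentiableOn ℂ (hlogRev w) (dom S) ∧ VanishingAtZero S (hlogRev w) w := by
  induction w with
  | nil =>
    refine ⟨(differentiableOn_const 1).congr fun z _ => rfl, monomial 0 (fun _ => 1),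
      regCoeffs_monomial analyticAt_const 0, ?_, by simp, fun h => absurd rfl h⟩
    exact (rep_log_pow S 0 1).congr_dom fun z _ => by simp [hlogRev]
  | cons b w ih =>
    obtain ⟨hb, hw⟩ := List.forall_mem_cons.1 hw
    obtain ⟨h1, h2⟩ := hlogRev_cons hb (ih hw).1 (ih hw).2
    exact ⟨fun z hz => (h1 z hz).differentiableAt.differentiableWithinAt, h2⟩

lemma hlogOn_apply {w : List ℂ} {z : ℂ} (hz : z ∈ dom S) : hlogOn S w z = hlog w z :=
  Set.indicator_of_mem hz _

lemma hlogOn_of_notMem {w : List ℂ} {z : ℂ} (hz : z ∉ dom S) : hlogOn S w z = 0 :=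
  Set.indicator_of_notMem hz _

lemma hlogOn_nil {z : ℂ} (hz : z ∈ dom S) : hlogOn S [] z = 1 := by
  rw [hlogOn_apply hz]; simp [hlog, hlogRev]

lemma differentiableOn_hlogOn {w : List ℂ} (hw : ∀ b ∈ w, b ∈ S) :
    DifferentiableOn ℂ (hlogOn S w) (dom S) :=
  (hlogRev_spec (w := w.reverse) (by simpa using hw)).1.congr fun _ hz => hlogOn_apply hz

lemma hasDerivAt_hlogOn {w : List ℂ} (hw : ∀ b ∈ w, b ∈ S) {b : ℂ} (hb : b ∈ S) {z : ℂ}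
    (hz : z ∈ dom S) : HasDerivAt (hlogOn S (w ++ [b])) ((z - b)⁻¹ * hlogOn S w z) z := by
  have h := hlogRev_spec (S := S) (w := w.reverse) (by simpa using hw)
  have h1 := (hlogRev_cons hb h.1 h.2).1 z hz
  have e : hlogOn S (w ++ [b]) =ᶠ[𝓝 z] hlogRev (b :: w.reverse) := by
    filter_upwards [(isOpen_dom S).mem_nhds hz] with y hy
    rw [hlogOn_apply hy]
    simp [hlog]
  refine (h1.congr_of_eventuallyEq e).congr_deriv ?_
  rw [hlogOn_apply hz, hlog]
  ring

lemma hlogOn_zero_expansion {w : List ℂ} (hw : ∀ b ∈ w, b ∈ S) (hne : w ≠ []) :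
    ∃ P, RegCoeffs 0 P ∧ Rep S 0 (hlogOn S w) P ∧ P.coeff 0 0 = 0 := by
  obtain ⟨P, h1, h2, -, h3⟩ := (hlogRev_spec (S := S) (w := w.reverse) (by simpa using hw)).2
  exact ⟨P, h1, h2.congr_dom fun z hz => hlogOn_apply hz, h3 (by simpa using hne)⟩

/-! ### Local expansions and infinitesimal monodromy of hyperlogarithms -/

/-- The hyperlogarithm with the given coefficients. -/
def lin (S : Finset ℂ) : (List ℂ →₀ ℂ) →ₗ[ℂ] (ℂ → ℂ) := Finsupp.linearCombination ℂ (hlogOn S)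

/-- Appending a letter to all words. -/
def appendLetter (b : ℂ) (c : List ℂ →₀ ℂ) : List ℂ →₀ ℂ := c.mapDomain (· ++ [b])

lemma append_injective (b : ℂ) : Function.Injective (fun w : List ℂ => w ++ [b]) :=
  fun _ _ h => List.append_cancel_right h

lemma lin_single (S : Finset ℂ) (w : List ℂ) (x : ℂ) :
    lin S (Finsupp.single w x) = x • hlogOn S w := by
  simp [lin]

lemma hasDerivAt_lin_appendLetter {c : List ℂ →₀ ℂ} (hc : ∀ w ∈ c.support, ∀ b ∈ w, b ∈ S)
    {b : ℂ} (hb : b ∈ S) {z : ℂ} (hz : z ∈ dom S) :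
    HasDerivAt (lin S (appendLetter b c)) ((z - b)⁻¹ * lin S c z) z := by
  rw [lin, appendLetter, Finsupp.linearCombination_mapDomain, Finsupp.linearCombination_apply,
    Finsupp.linearCombination_apply, Finsupp.sum, Finsupp.sum]
  refine (HasDerivAt.sum fun w hw =>
    ((hasDerivAt_hlogOn (hc w hw) hb hz).const_smul (c w))).congr_deriv ?_
  rw [Finset.sum_apply, Finset.mul_sum]
  refine Finset.sum_congr rfl fun w _ => ?_
  simp only [Pi.smul_apply, smul_eq_mul]
  ring

/-- The coefficients `c` are those of `m_a L_w` up to terms of lower length. -/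
def IsLeading (S : Finset ℂ) (a : ℂ) (w : List ℂ) (c : List ℂ →₀ ℂ) : Prop :=
  (∀ u ∈ c.support, (∀ b ∈ u, b ∈ S) ∧ u.length < w.length) ∧
    ∀ u, u.length + 1 = w.length → c u = if w = a :: u then 1 else 0

/-- The factor relating the forms `dz / (z - b)` and `dz / (z - a)`. -/
def formRatio (a b : ℂ) : ℂ → ℂ := if b = a then fun _ => 1 else fun z => (z - a) / (z - b)

lemma analyticAt_formRatio (a b : ℂ) : AnalyticAt ℂ (formRatio a b) a := by
  unfold formRatio
  split_ifs with h
  · exact analyticAt_const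
  · exact (analyticAt_id.sub analyticAt_const).div (analyticAt_id.sub analyticAt_const)
      (sub_ne_zero.2 (Ne.symm h))

lemma formRatio_self (a b : ℂ) : formRatio a b a = if b = a then 1 else 0 := by
  unfold formRatio
  split_ifs <;> simp

lemma inv_sub_mul_formRatio {a b z : ℂ} (hz : z ≠ a) (x : ℂ) :
    (z - b)⁻¹ * x = (z - a)⁻¹ * (formRatio a b z * x) := by
  have : z - a ≠ 0 := sub_ne_zero.2 hz
  unfold formRatio
  split_ifs with h
  · rw [h, one_mul]
  · beta_reduce
    rw [div_eq_mul_inv]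
    field_simp

/-- A letter appended on the right does not affect the initial letter. The constant of integration
sits on the empty word, which is too short to be leading because `v` is nonempty. -/
lemma isLeading_append {v : List ℂ} {b : ℂ} {c : List ℂ →₀ ℂ} (hv : v ≠ []) (hb : b ∈ S)
    (hc : IsLeading S a v c) (x : ℂ) :
    IsLeading S a (v ++ [b]) (appendLetter b c + Finsupp.single [] x) := by
  classical
  have hlen : 0 < v.length := List.length_pos_of_ne_nil hv
  refine ⟨fun u hu => ?_, fun u hu => ?_⟩
  · rcases Finset.mem_union.1 (Finsupp.support_add hu) with hu | hu
    · obtain ⟨u', hu', rfl⟩ := Finset.mem_image.1 (Finsupp.mapDomain_support hu)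
      obtain ⟨h1, h2⟩ := hc.1 u' hu'
      refine ⟨fun d hd => ?_, by simpa using h2⟩
      rcases List.mem_append.1 hd with hd | hd
      · exact h1 d hd
      · rwa [List.mem_singleton.1 hd]
    · have : u = [] := by simpa using Finsupp.support_single_subset hu
      subst this
      exact ⟨by simp, by simp⟩
  · rw [List.length_append, List.length_singleton, Nat.add_right_cancel_iff] at hu
    have hu0 : u ≠ [] := by rintro rfl; simp at hu; exact hv (List.length_eq_zero_iff.1 hu.symm)
    rw [Finsupp.add_apply, Finsupp.single_eq_of_ne hu0, add_zero]
    induction u using List.reverseRecOn with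
    | nil => exact absurd rfl hu0
    | append_singleton u d _ =>
      rw [List.length_append, List.length_singleton] at hu
      by_cases hbd : d = b
      · subst hbd
        rw [appendLetter, Finsupp.mapDomain_apply (append_injective d), hc.2 u hu]
        have : (v ++ [d] = a :: (u ++ [d])) ↔ v = a :: u := by
          rw [← List.cons_append]
          exact (append_injective d).eq_iff
        simp only [this]
      · rw [appendLetter, Finsupp.mapDomain_of_notMem_range, if_neg]
        · intro h
          rw [← List.cons_append] at h
          have := (List.append_inj' h rfl).2
          exact hbd (by simpa using this.symm)
        · rintro ⟨u', hu'⟩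
          have := (List.append_inj' hu' rfl).2
          exact hbd (by simpa using this.symm)

/-- The local expansion of a hyperlogarithm at `a`, and its logarithmic derivative. -/
theorem hlogOn_expansion (a : ℂ) {w : List ℂ} (hw : ∀ b ∈ w, b ∈ S) :
    ∃ (P : (ℂ → ℂ)[X]) (c : List ℂ →₀ ℂ), RegCoeffs a P ∧ Rep S a (hlogOn S w) P ∧
      Rep S a (lin S c) (derivative P) ∧ IsLeading S a w c ∧
      ∀ v b, w = v ++ [b] → ∃ Pv, RegCoeffs a Pv ∧ Rep S a (hlogOn S v) Pv ∧
        P.coeff 1 a = if b = a then Pv.coeff 0 a else 0 := by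
  classical
  have hone : Rep S a (hlogOn S []) (C (fun _ => 1)) := by
    refine ⟨fun l => .of_forall fun z => ?_, ?_⟩
    · rw [coeff_C]; split_ifs <;> exact analyticAt_const
    · filter_upwards [nhds_side_le_dom S a] with z hz
      rw [hlogOn_nil hz]; simp [ev, atPt]
  induction w using List.reverseRecOn with
  | nil =>
    refine ⟨C (fun _ => 1), 0, fun l => ?_, hone, ?_, ⟨by simp, fun u hu => by simp at hu⟩, ?_⟩
    · rw [coeff_C]; split_ifs <;> exact analyticAt_const
    · simpa using Rep.zero S a
    · intro v b h
      simp at h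
  | append_singleton v b ih =>
    have hb : b ∈ S := hw b (by simp)
    have hv : ∀ d ∈ v, d ∈ S := fun d hd => hw d (by simp [hd])
    obtain ⟨P, c, hreg, hP, hc, hlead, -⟩ := ih hv
    have hφ := analyticAt_formRatio a b
    have hφ' : ∀ᶠ z in 𝓝[≠] a, AnalyticAt ℂ (formRatio a b) z :=
      nhdsWithin_le_nhds hφ.eventually_analyticAt
    have hderiv : ∀ᶠ z in 𝓝[side S a] a, HasDerivAt (hlogOn S (v ++ [b]))
        ((z - a)⁻¹ * (formRatio a b * hlogOn S v) z) z := by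
      filter_upwards [self_mem_nhdsWithin] with z hz
      rw [Pi.mul_apply, ← inv_sub_mul_formRatio (ne_of_mem_side hz)]
      exact hasDerivAt_hlogOn hv hb hz.1
    -- The relation of `Prim.coeff_succ` in degree 0, where the form ratio has the value δ_ab at
    -- `a`. The constant of integration `x` only enters degree 0.
    have hlast : ∀ (Pv Q : (ℂ → ℂ)[X]) (x : ℂ), RegCoeffs a Pv → Rep S a (hlogOn S v) Pv →
        Prim a Q (C (formRatio a b) * Pv) → ∀ v' b', v ++ [b] = v' ++ [b'] →
        ∃ Pv, RegCoeffs a Pv ∧ Rep S a (hlogOn S v') Pv ∧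
        (Q + C (fun _ => x)).coeff 1 a = if b' = a then Pv.coeff 0 a else 0 := by
      intro Pv Q x h1 h2 hQ v' b' h
      obtain ⟨rfl, h4⟩ := List.append_inj' h rfl
      obtain rfl : b = b' := by simpa using h4
      refine ⟨Pv, h1, h2, ?_⟩
      have := hQ.coeff_succ 0
      rw [coeff_C_mul, Pi.mul_apply, formRatio_self] at this
      rw [coeff_add, coeff_C, if_neg one_ne_zero, add_zero]
      simpa [ite_mul] using this
    -- For a single letter the empty word is itself the leading term, so its coefficient must be
    -- computed and cannot be left to an unknown constant.
    by_cases hv0 : v = []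
    · subst hv0
      obtain ⟨Q, hQ, hQ'⟩ := exists_prim_C hφ
      have hQ : Prim a Q (C (formRatio a b) * C (fun _ => 1)) := by
        rw [← C_mul]
        convert hQ using 2
        exact mul_one _
      obtain ⟨x, hx⟩ := (hone.mul hφ').integrate hQ hderiv
      have hreg1 : RegCoeffs a (C (fun _ => 1)) := fun l => by
        rw [coeff_C]; split_ifs <;> exact analyticAt_const
      refine ⟨_, Finsupp.single [] (formRatio a b a), fun l => ?_, hx, ?_, ⟨fun u hu => ?_,
        fun u hu => ?_⟩, hlast _ Q x hreg1 hone hQ⟩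
      · rw [coeff_add, coeff_C]
        refine (hQ.1 l).add ?_
        split_ifs <;> exact analyticAt_const
      · rw [lin_single, derivative_add, derivative_C, add_zero, hQ']
        have := hone.smul (formRatio a b a)
        rw [← C_mul] at this
        convert this using 2
        ext z
        simp
      · have : u = [] := by simpa using Finsupp.support_single_subset hu
        subst this
        simp
      · have hu0 : u = [] := by simpa using hu
        subst hu0
        rw [Finsupp.single_eq_same, formRatio_self]
        simp
    · obtain ⟨Q, hQ⟩ := exists_prim (a := a) (P := C (formRatio a b) * P) (fun l => by
        rw [coeff_C_mul]; exact hφ.mul (hreg l))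
      obtain ⟨x, hx⟩ := (hP.mul hφ').integrate hQ hderiv
      have hc' := hc.mul hφ'
      rw [← derivative_C_mul] at hc'
      -- Appending b to the words of m_a L_v gives m_a L_{vb} up to a constant `y`, which is removed
      -- by a multiple of the empty word.
      obtain ⟨y, hy⟩ := hc'.integrate_derivative (f := lin S (appendLetter b c)) hQ (by
        filter_upwards [self_mem_nhdsWithin] with z hz
        rw [Pi.mul_apply, ← inv_sub_mul_formRatio (ne_of_mem_side hz)]
        exact hasDerivAt_lin_appendLetter (fun u hu => (hlead.1 u hu).1) hb hz.1)
      refine ⟨_, appendLetter b c + Finsupp.single [] (-y), fun l => ?_, hx, ?_,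
        isLeading_append hv0 hb hlead _, hlast P Q x hreg hP hQ⟩
      · rw [coeff_add, coeff_C]
        refine (hQ.1 l).add ?_
        split_ifs <;> exact analyticAt_const
      · rw [map_add, lin_single, derivative_add, derivative_C, add_zero]
        have := hy.add (hone.smul (-y))
        convert this using 1
        rw [← C_mul, add_assoc, ← C_add]
        have e : ((fun _ => y) + (fun _ => -y) * fun _ => 1 : ℂ → ℂ) = 0 := by ext z; simp
        rw [e, C_0, add_zero]

end

section

open Polynomial

variable {S : Finset ℂ} {a : ℂ}

/-! ### Linear independence of hyperlogarithms -/

/-- The coefficients of `m_a L_w`. -/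
def lead (S : Finset ℂ) (a : ℂ) (w : List ℂ) : List ℂ →₀ ℂ :=
  open Classical in
  if hw : ∀ b ∈ w, b ∈ S then (hlogOn_expansion a hw).choose_spec.choose else 0

lemma isLeading_lead {w : List ℂ} (hw : ∀ b ∈ w, b ∈ S) : IsLeading S a w (lead S a w) := by
  rw [lead, dif_pos hw]
  exact (hlogOn_expansion a hw).choose_spec.choose_spec.2.2.2.1

lemma logDeriv_hlogOn {w : List ℂ} (hw : ∀ b ∈ w, b ∈ S) :
    LogDeriv S a (hlogOn S w) (lin S (lead S a w)) := by
  rw [lead, dif_pos hw]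
  have h := (hlogOn_expansion a hw).choose_spec.choose_spec
  exact ⟨_, h.2.1, h.2.2.1⟩

/-- The infinitesimal monodromy on formal combinations of words. -/
def formalMon {M : Type*} [AddCommGroup M] [Module ℂ M] (S : Finset ℂ) (a : ℂ)
    (φ : List ℂ →₀ M) : List ℂ →₀ M :=
  φ.sum fun w m => (lead S a w).mapRange (fun x => x • m) (zero_smul ℂ m)

section formal

variable {M : Type*} [AddCommGroup M] [Module ℂ M] {φ : List ℂ →₀ M}

lemma formalMon_apply (v : List ℂ) :
    formalMon S a φ v = φ.sum fun w m => lead S a w v • m := by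
  rw [formalMon, Finsupp.sum_apply]
  simp [Finsupp.mapRange_apply]

lemma mem_support_formalMon (hφ : ∀ w ∈ φ.support, ∀ b ∈ w, b ∈ S) {v : List ℂ}
    (hv : v ∈ (formalMon S a φ).support) :
    (∀ b ∈ v, b ∈ S) ∧ ∃ w ∈ φ.support, v.length < w.length := by
  rw [Finsupp.mem_support_iff, formalMon_apply, Finsupp.sum] at hv
  obtain ⟨w, hw, hne⟩ := Finset.exists_ne_zero_of_sum_ne_zero hv
  have := (isLeading_lead (a := a) (hφ w hw)).1 v
    (Finsupp.mem_support_iff.2 fun h => hne (by rw [h, zero_smul]))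
  exact ⟨this.1, w, hw, this.2⟩

/-- Take a longest word av in the support. At v, the operator m_a sees only words longer than v,
hence of length |v| + 1, and among these only av itself. So the coefficient of v in m_a φ is the
coefficient of av in φ. -/
lemma eq_zero_of_formalMon_eq_zero (hφ : ∀ w ∈ φ.support, ∀ b ∈ w, b ∈ S)
    (h : ∀ a ∈ S, formalMon S a φ = 0) {w : List ℂ} (hw : w ≠ []) : φ w = 0 := by
  classical
  by_contra hne
  obtain ⟨u, hu, hmax⟩ := (φ.support.filter (· ≠ [])).exists_max_image List.length
    ⟨w, Finset.mem_filter.2 ⟨Finsupp.mem_support_iff.2 hne, hw⟩⟩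
  obtain ⟨hu1, hu2⟩ := Finset.mem_filter.1 hu
  obtain ⟨a, v, rfl⟩ := List.exists_cons_of_ne_nil hu2
  have h0 := DFunLike.congr_fun (h a (hφ _ hu1 a (by simp))) v
  rw [formalMon_apply, Finsupp.sum, Finset.sum_eq_single_of_mem _ hu1] at h0
  · rw [(isLeading_lead (hφ _ hu1)).2 v (by simp), if_pos rfl, one_smul] at h0
    exact Finsupp.mem_support_iff.1 hu1 h0
  · intro x hx hxne
    by_cases hlt : v.length < x.length
    · have hx0 : x ≠ [] := by rintro rfl; simp at hlt
      have := hmax x (Finset.mem_filter.2 ⟨hx, hx0⟩)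
      rw [List.length_cons] at this
      rw [(isLeading_lead (hφ _ hx)).2 v (by omega), if_neg hxne, zero_smul]
    · have : lead S a x v = 0 := by
        by_contra hne'
        exact hlt ((isLeading_lead (hφ _ hx)).1 v (Finsupp.mem_support_iff.2 hne')).2
      rw [this, zero_smul]

end formal

/-- Functions that are holomorphic outside `S`, normalized to vanish on `S`. -/
def anOff (S : Finset ℂ) : Submodule ℂ (ℂ → ℂ) where
  carrier := {h | (∀ z, z ∉ S → AnalyticAt ℂ h z) ∧ ∀ z ∈ S, h z = 0}
  zero_mem' := ⟨fun _ _ => analyticAt_const, fun _ _ => rfl⟩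
  add_mem' := fun hf hg => ⟨fun z hz => (hf.1 z hz).add (hg.1 z hz),
    fun z hz => by simp [hf.2 z hz, hg.2 z hz]⟩
  smul_mem' := fun _ _ hf => ⟨fun z hz => analyticAt_const.smul (hf.1 z hz),
    fun z hz => by simp [hf.2 z hz]⟩

lemma eventually_notMem (S : Finset ℂ) (a : ℂ) : ∀ᶠ z in 𝓝[≠] a, z ∉ S := by
  have : ∀ᶠ z in 𝓝[≠] a, ∀ b ∈ S, z ≠ b := (eventually_all_finset S).2 fun b _ => by
    by_cases hb : b = a
    · subst hb; exact self_mem_nhdsWithin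
    · exact nhdsWithin_le_nhds (isOpen_ne.mem_nhds (Ne.symm hb))
  filter_upwards [this] with z hz hzS using hz z hzS rfl

lemma indicator_mem_anOff {φ : ℂ → ℂ} (h : ∀ z, z ∉ S → AnalyticAt ℂ φ z) :
    (S : Set ℂ)ᶜ.indicator φ ∈ anOff S := by
  refine ⟨fun z hz => (h z hz).congr ?_, fun z hz => Set.indicator_of_notMem (by simpa using hz) _⟩
  filter_upwards [S.finite_toSet.isClosed.isOpen_compl.mem_nhds (by simpa using hz)] with y hy
  exact (Set.indicator_of_mem hy _).symm

lemma anOff_eventually {h : ℂ → ℂ} (hh : h ∈ anOff S) (a : ℂ) :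
    ∀ᶠ z in 𝓝[≠] a, AnalyticAt ℂ h z := (eventually_notMem S a).mono hh.1

lemma dom_subset_compl (S : Finset ℂ) : dom S ⊆ (S : Set ℂ)ᶜ := fun _ hz hzS =>
  ne_of_mem_dom hz hzS rfl

/-- The complement of a finite set in the plane is connected, so the identity theorem applies; the
normalization on `S` takes care of the remaining points. -/
lemma eq_zero_of_eqOn_dom {h : ℂ → ℂ} (hh : h ∈ anOff S) (h0 : ∀ z ∈ dom S, h z = 0) : h = 0 := by
  have hc : IsPreconnected (S : Set ℂ)ᶜ :=
    (S.finite_toSet.countable.isConnected_compl_of_one_lt_rank (by simp)).isPreconnected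
  obtain ⟨q, hq⟩ := nonempty_dom S
  have := AnalyticOnNhd.eqOn_of_preconnected_of_eventuallyEq (f := h) (g := 0)
    (fun z hz => hh.1 z (by simpa using hz)) (fun _ _ => analyticAt_const) hc
    (dom_subset_compl S hq) (eventuallyEq_of_mem ((isOpen_dom S).mem_nhds hq) h0)
  ext z
  by_cases hz : z ∈ S
  · exact hh.2 z hz
  · exact this (by simpa using hz)

/-- Combinations of hyperlogarithms whose coefficients are holomorphic outside `S`. -/
def linAn (S : Finset ℂ) (φ : List ℂ →₀ anOff S) : ℂ → ℂ :=
  φ.sum fun w h => (h : ℂ → ℂ) * hlogOn S w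

lemma linAn_formalMon (φ : List ℂ →₀ anOff S) :
    linAn S (formalMon S a φ) = φ.sum fun w h => (h : ℂ → ℂ) * lin S (lead S a w) := by
  rw [linAn, formalMon, Finsupp.sum_sum_index (by simp) (by intros; simp [add_mul])]
  refine Finsupp.sum_congr fun w _ => ?_
  rw [Finsupp.sum_mapRange_index (by simp), lin, Finsupp.linearCombination_apply, Finsupp.sum,
    Finsupp.sum, Finset.mul_sum]
  refine Finset.sum_congr rfl fun u _ => ?_
  ext z
  simp only [Submodule.coe_smul, Pi.mul_apply, Pi.smul_apply, smul_eq_mul]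
  ring

/-- The coefficients are single-valued around `a`, so m_a acts on the words only. -/
lemma logDeriv_linAn {φ : List ℂ →₀ anOff S} (hφ : ∀ w ∈ φ.support, ∀ b ∈ w, b ∈ S) :
    LogDeriv S a (linAn S φ) (linAn S (formalMon S a φ)) := by
  rw [linAn_formalMon, linAn, Finsupp.sum, Finsupp.sum]
  exact LogDeriv.sum _ fun w hw => (logDeriv_hlogOn (hφ w hw)).mul (anOff_eventually (φ w).2 a)

lemma differentiableOn_linAn {φ : List ℂ →₀ anOff S} (hφ : ∀ w ∈ φ.support, ∀ b ∈ w, b ∈ S) :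
    DifferentiableOn ℂ (linAn S φ) (dom S) := by
  rw [linAn, Finsupp.sum]
  refine DifferentiableOn.sum fun w hw => DifferentiableOn.mul (fun z hz => ?_)
    (differentiableOn_hlogOn (hφ w hw))
  exact ((φ w).2.1 z (by simpa using dom_subset_compl S hz)).differentiableAt.differentiableWithinAt

lemma LogDeriv.zero (S : Finset ℂ) (a : ℂ) : LogDeriv S a 0 0 :=
  ⟨0, Rep.zero S a, by simpa using Rep.zero S a⟩

lemma LogDeriv.congr_dom {f f' g g' : ℂ → ℂ} (h : LogDeriv S a f g) (hf : ∀ z ∈ dom S, f' z = f z)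
    (hg : ∀ z ∈ dom S, g' z = g z) : LogDeriv S a f' g' := by
  obtain ⟨P, h1, h2⟩ := h
  exact ⟨P, h1.congr_dom hf, h2.congr_dom hg⟩

lemma linAn_formalMon_eq_zero {φ : List ℂ →₀ anOff S} (hφ : ∀ w ∈ φ.support, ∀ b ∈ w, b ∈ S)
    (h : LogDeriv S a (linAn S φ) 0) {z : ℂ} (hz : z ∈ dom S) :
    linAn S (formalMon S a φ) z = 0 :=
  eqOn_dom_of_eventually (a := a) (g := 0)
    (differentiableOn_linAn fun _ hw => (mem_support_formalMon hφ hw).1)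
    (differentiableOn_const 0) ((logDeriv_linAn hφ).unique h) hz

/-- Hyperlogarithms are linearly independent over the functions holomorphic outside `S`. -/
theorem linAn_injective {φ : List ℂ →₀ anOff S} (hφ : ∀ w ∈ φ.support, ∀ b ∈ w, b ∈ S)
    (h : ∀ z ∈ dom S, linAn S φ z = 0) : φ = 0 := by
  have key : ∀ (n : ℕ) (φ : List ℂ →₀ anOff S), (∀ w ∈ φ.support, ∀ b ∈ w, b ∈ S) →
      (∀ w ∈ φ.support, w.length < n) → (∀ z ∈ dom S, linAn S φ z = 0) → φ = 0 := by
    intro n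
    induction n with
    | zero =>
      intro φ _ h1 _
      ext w : 1
      by_contra hne
      exact absurd (h1 w (Finsupp.mem_support_iff.2 hne)) (Nat.not_lt_zero _)
    | succ n ih =>
      intro φ hφ h1 h2
      -- Each m_a φ again gives the zero function but has shorter words, so it vanishes formally by
      -- induction. Then only the empty word can remain in φ.
      have h3 : ∀ {w}, w ≠ [] → φ w = 0 := fun hw => by
        refine eq_zero_of_formalMon_eq_zero hφ (fun a _ => ih _
          (fun _ hw => (mem_support_formalMon hφ hw).1) (fun w hw => ?_)
          (fun z hz => linAn_formalMon_eq_zero hφ ?_ hz)) hw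
        · obtain ⟨u, hu, hlt⟩ := (mem_support_formalMon hφ hw).2
          have := h1 u hu
          omega
        · exact (LogDeriv.zero S a).congr_dom h2 fun _ _ => rfl
      have h4 : φ = Finsupp.single [] (φ []) := by
        ext w : 1
        by_cases hw : w = []
        · subst hw; simp
        · rw [h3 hw, Finsupp.single_eq_of_ne hw]
      have h5 : (φ [] : ℂ → ℂ) = 0 := by
        refine eq_zero_of_eqOn_dom (φ []).2 fun z hz => ?_
        have := h2 z hz
        rw [h4, linAn, Finsupp.sum_single_index (by simp)] at this
        simpa [hlogOn_nil hz] using this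
      rw [h4, Subtype.ext h5 (a2 := (0 : anOff S)), Finsupp.single_zero]
  exact key (φ.support.sup List.length + 1) φ hφ
    (fun w hw => Nat.lt_succ_of_le (Finset.le_sup (f := List.length) hw)) h

/-- A combination of hyperlogarithms without monodromy has no terms of positive length. -/
lemma eq_zero_of_logDeriv_zero {φ : List ℂ →₀ anOff S} (hφ : ∀ w ∈ φ.support, ∀ b ∈ w, b ∈ S)
    (h : ∀ a ∈ S, LogDeriv S a (linAn S φ) 0) {w : List ℂ} (hw : w ≠ []) : φ w = 0 :=
  eq_zero_of_formalMon_eq_zero hφ (fun a ha => linAn_injective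
    (fun _ hv => (mem_support_formalMon hφ hv).1)
    fun _ hz => linAn_formalMon_eq_zero hφ (h a ha) hz) hw

/-! ### Regularized values -/

/-- The coefficients agree along the side of approach, and continuity carries this to `a`; here
holomorphy at `a` is essential. -/
lemma RegCoeffs.coeff_eq {f : ℂ → ℂ} {P Q : (ℂ → ℂ)[X]} (hP : RegCoeffs a P) (hQ : RegCoeffs a Q)
    (h1 : Rep S a f P) (h2 : Rep S a f Q) (l : ℕ) : P.coeff l a = Q.coeff l a := by
  have hc : ∀ {R : (ℂ → ℂ)[X]}, RegCoeffs a R →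
      Tendsto (R.coeff l) (𝓝[side S a] a) (𝓝 (R.coeff l a)) := fun hR =>
    (hR l).continuousAt.tendsto.mono_left nhdsWithin_le_nhds
  refine tendsto_nhds_unique (hc hP) ((hc hQ).congr' ?_)
  filter_upwards [h1.unique h2] with z hz
  rw [← coeff_atPt, ← coeff_atPt, hz]

lemma hasRegValue_iff {f : ℂ → ℂ} {c : ℂ} : HasRegValue S a f c ↔
    ∃ P, RegCoeffs a P ∧ Rep S a f P ∧ P.coeff 0 a = c := by
  constructor
  · rintro ⟨n, h, h1, h2, h3⟩
    have hcoeff : ∀ l, (∑ i ∈ Finset.range (n + 1), monomial i (h i)).coeff l =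
        if l < n + 1 then h l else 0 := by
      intro l
      simp only [finsetSum_coeff, coeff_monomial, Finset.sum_ite_eq', Finset.mem_range]
    have hreg : RegCoeffs a (∑ i ∈ Finset.range (n + 1), monomial i (h i)) := fun l => by
      rw [hcoeff]
      split_ifs
      · exact h1 l
      · exact analyticAt_const
    refine ⟨_, hreg, ⟨hreg.punct, ?_⟩, by rw [hcoeff]; simpa using h3⟩
    filter_upwards [h2] with z hz
    rw [hz, ev, atPt_sum, eval_finsetSum]
    simp [atPt]
  · rintro ⟨P, h1, h2, h3⟩
    refine ⟨P.natDegree, P.coeff, h1, ?_, h3⟩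
    filter_upwards [h2.2] with z hz
    rw [hz, ev_eq_sum]

lemma HasRegValue.unique {f : ℂ → ℂ} {c d : ℂ} (h : HasRegValue S a f c) (h' : HasRegValue S a f d) :
    c = d := by
  obtain ⟨P, h1, h2, rfl⟩ := hasRegValue_iff.1 h
  obtain ⟨Q, h4, h5, rfl⟩ := hasRegValue_iff.1 h'
  exact h1.coeff_eq h4 h2 h5 0

lemma HasRegValue.add {f g : ℂ → ℂ} {c d : ℂ} (h : HasRegValue S a f c) (h' : HasRegValue S a g d) :
    HasRegValue S a (f + g) (c + d) := by
  obtain ⟨P, h1, h2, rfl⟩ := hasRegValue_iff.1 h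
  obtain ⟨Q, h4, h5, rfl⟩ := hasRegValue_iff.1 h'
  refine hasRegValue_iff.2 ⟨P + Q, fun l => ?_, h2.add h5, by simp⟩
  rw [coeff_add]; exact (h1 l).add (h4 l)

lemma HasRegValue.smul {f : ℂ → ℂ} {c : ℂ} (x : ℂ) (h : HasRegValue S a f c) :
    HasRegValue S a (x • f) (x * c) := by
  obtain ⟨P, h1, h2, rfl⟩ := hasRegValue_iff.1 h
  refine hasRegValue_iff.2 ⟨_, fun l => ?_, h2.smul x, by simp⟩
  rw [coeff_C_mul]; exact analyticAt_const.mul (h1 l)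

lemma exists_hasRegValue_hlogOn (a : ℂ) {w : List ℂ} (hw : ∀ b ∈ w, b ∈ S) :
    ∃ c, HasRegValue S a (hlogOn S w) c := by
  obtain ⟨P, -, h1, h2, -⟩ := hlogOn_expansion a hw
  exact ⟨_, hasRegValue_iff.2 ⟨P, h1, h2, rfl⟩⟩

/-! ### The spaces of hyperlogarithms and of their derivatives -/

/-- A total functional linear relation is a linear map. -/
lemma exists_linearMap_of_relation {V W : Type*} [AddCommGroup V] [Module ℂ V] [AddCommGroup W]
    [Module ℂ W] (R : V → W → Prop) (hadd : ∀ {f g x y}, R f x → R g y → R (f + g) (x + y))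
    (hsmul : ∀ {f x} (c : ℂ), R f x → R (c • f) (c • x)) (htotal : ∀ f, ∃ x, R f x)
    (huniq : ∀ {f x y}, R f x → R f y → x = y) :
    ∃ φ : V →ₗ[ℂ] W, ∀ f x, φ f = x ↔ R f x := by
  choose φ hφ using htotal
  exact ⟨{ toFun := φ
           map_add' := fun f g => huniq (hφ _) (hadd (hφ f) (hφ g))
           map_smul' := fun c f => huniq (hφ _) (hsmul c (hφ f)) },
    fun f x => ⟨fun h => h ▸ hφ f, fun h => huniq (hφ f) h⟩⟩

lemma hlogOn_mem {w : List ℂ} (hw : ∀ b ∈ w, b ∈ S) : hlogOn S w ∈ HLC S :=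
  Submodule.subset_span ⟨w, hw, rfl⟩

lemma lin_mem {c : List ℂ →₀ ℂ} (hc : ∀ w ∈ c.support, ∀ b ∈ w, b ∈ S) : lin S c ∈ HLC S := by
  rw [lin, Finsupp.linearCombination_apply, Finsupp.sum]
  exact Submodule.sum_mem _ fun w hw => Submodule.smul_mem _ _ (hlogOn_mem (hc w hw))

lemma exists_lin_of_mem {f : ℂ → ℂ} (hf : f ∈ HLC S) :
    ∃ c : List ℂ →₀ ℂ, (∀ w ∈ c.support, ∀ b ∈ w, b ∈ S) ∧ lin S c = f := by
  have e : {f | ∃ w : List ℂ, (∀ b ∈ w, b ∈ S) ∧ f = hlogOn S w} =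
      hlogOn S '' {w | ∀ b ∈ w, b ∈ S} := by
    ext f
    exact ⟨fun ⟨w, h1, h2⟩ => ⟨w, h1, h2.symm⟩, fun ⟨w, h1, h2⟩ => ⟨w, h1, h2.symm⟩⟩
  rw [HLC, e, Finsupp.mem_span_image_iff_linearCombination] at hf
  obtain ⟨c, h1, h2⟩ := hf
  exact ⟨c, fun w hw => (Finsupp.mem_supported _ _).1 h1 hw, h2⟩

lemma HLC_induction {p : (ℂ → ℂ) → Prop} (hw : ∀ w : List ℂ, (∀ b ∈ w, b ∈ S) → p (hlogOn S w))
    (h0 : p 0) (hadd : ∀ f ∈ HLC S, ∀ g ∈ HLC S, p f → p g → p (f + g))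
    (hsmul : ∀ (c : ℂ), ∀ f ∈ HLC S, p f → p (c • f)) {f : ℂ → ℂ} (hf : f ∈ HLC S) : p f := by
  induction hf using Submodule.span_induction with
  | mem f h => obtain ⟨w, h1, rfl⟩ := h; exact hw w h1
  | zero => exact h0
  | add f g hf hg h1 h2 => exact hadd f hf g hg h1 h2
  | smul c f hf h => exact hsmul c f hf h

lemma HLC_of_notMem {f : ℂ → ℂ} (hf : f ∈ HLC S) {z : ℂ} (hz : z ∉ dom S) : f z = 0 := by
  refine HLC_induction (p := fun f => f z = 0) (fun w _ => hlogOn_of_notMem hz) rfl ?_ ?_ hf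
  · intro f _ g _ h1 h2; simp [h1, h2]
  · intro c f _ h; simp [h]

lemma differentiableOn_HLC {f : ℂ → ℂ} (hf : f ∈ HLC S) : DifferentiableOn ℂ f (dom S) :=
  HLC_induction (p := fun f => DifferentiableOn ℂ f (dom S)) (fun _ => differentiableOn_hlogOn)
    (differentiableOn_const 0) (fun _ _ _ _ h1 h2 => h1.add h2) (fun c _ _ h => h.const_smul c) hf

lemma HLC_ext {f g : ℂ → ℂ} (hf : f ∈ HLC S) (hg : g ∈ HLC S) (h : ∀ z ∈ dom S, f z = g z) :
    f = g := by
  ext z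
  by_cases hz : z ∈ dom S
  · exact h z hz
  · rw [HLC_of_notMem hf hz, HLC_of_notMem hg hz]

lemma exists_logDeriv_HLC (a : ℂ) {f : ℂ → ℂ} (hf : f ∈ HLC S) :
    ∃ g ∈ HLC S, LogDeriv S a f g := by
  refine HLC_induction (p := fun f => ∃ g ∈ HLC S, LogDeriv S a f g) (fun w hw =>
    ⟨_, lin_mem fun u hu => ((isLeading_lead hw).1 u hu).1, logDeriv_hlogOn hw⟩)
    ⟨0, Submodule.zero_mem _, LogDeriv.zero S a⟩ ?_ ?_ hf
  · rintro f _ g _ ⟨f', h1, h2⟩ ⟨g', h3, h4⟩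
    exact ⟨f' + g', Submodule.add_mem _ h1 h3, h2.add h4⟩
  · rintro c f _ ⟨f', h1, h2⟩
    exact ⟨c • f', Submodule.smul_mem _ _ h1, h2.smul c⟩

lemma exists_mH (S : Finset ℂ) (a : ℂ) : ∃ m : HLC S →ₗ[ℂ] HLC S, ∀ f g, m f = g ↔
    LogDeriv S a f g := by
  refine exists_linearMap_of_relation (fun f g : HLC S => LogDeriv S a f g) (fun h1 h2 => h1.add h2)
    (fun c h => h.smul c) (fun f => ?_) (fun {f x y} h1 h2 => ?_)
  · obtain ⟨g, h1, h2⟩ := exists_logDeriv_HLC a f.2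
    exact ⟨⟨g, h1⟩, h2⟩
  · exact Subtype.ext (HLC_ext x.2 y.2 (eqOn_dom_of_eventually (differentiableOn_HLC x.2)
      (differentiableOn_HLC y.2) (h1.unique h2)))

/-- The infinitesimal monodromy `m_a` on hyperlogarithms. -/
def monH (S : Finset ℂ) (a : ℂ) : HLC S →ₗ[ℂ] HLC S := (exists_mH S a).choose

lemma monH_eq_iff {f g : HLC S} : monH S a f = g ↔ LogDeriv S a f g :=
  (exists_mH S a).choose_spec f g

lemma logDeriv_monH (a : ℂ) (f : HLC S) : LogDeriv S a f (monH S a f) := monH_eq_iff.1 rfl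

lemma exists_regValue (S : Finset ℂ) (a : ℂ) : ∃ v : HLC S →ₗ[ℂ] ℂ, ∀ f c, v f = c ↔
    HasRegValue S a f c := by
  refine exists_linearMap_of_relation (fun (f : HLC S) c => HasRegValue S a f c)
    (fun h1 h2 => h1.add h2) (fun c h => h.smul c) (fun f => ?_) (fun h1 h2 => h1.unique h2)
  refine HLC_induction (p := fun f => ∃ c, HasRegValue S a f c)
    (fun w => exists_hasRegValue_hlogOn a) ?_ ?_ ?_ f.2
  · obtain ⟨c, hc⟩ := exists_hasRegValue_hlogOn (S := S) a (w := []) (by simp)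
    exact ⟨0 * c, by simpa using hc.smul 0⟩
  · rintro f _ g _ ⟨c, h1⟩ ⟨d, h2⟩
    exact ⟨_, h1.add h2⟩
  · rintro x f _ ⟨c, h⟩
    exact ⟨_, h.smul x⟩

/-- The regularized value at `a`. -/
def val (S : Finset ℂ) (a : ℂ) : HLC S →ₗ[ℂ] ℂ := (exists_regValue S a).choose

lemma val_eq_iff {f : HLC S} {c : ℂ} : val S a f = c ↔ HasRegValue S a f c :=
  (exists_regValue S a).choose_spec f c

lemma hasRegValue_val (a : ℂ) (f : HLC S) : HasRegValue S a f (val S a f) := val_eq_iff.1 rfl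

/-- The hyperlogarithm of a word as an element of the space of hyperlogarithms. -/
def word (w : List ℂ) (hw : ∀ b ∈ w, b ∈ S) : HLC S := ⟨hlogOn S w, hlogOn_mem hw⟩

/-- The constant function `1`. -/
def one (S : Finset ℂ) : HLC S := word [] (by simp)

lemma one_apply {z : ℂ} (hz : z ∈ dom S) : (one S : ℂ → ℂ) z = 1 := hlogOn_nil hz

lemma hasRegValue_const {f : ℂ → ℂ} {c : ℂ} (h : ∀ z ∈ dom S, f z = c) : HasRegValue S a f c := by
  refine ⟨0, fun _ _ => c, fun _ => analyticAt_const, ?_, rfl⟩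
  filter_upwards [nhds_side_le_dom S a] with z hz
  simp [h z hz]

lemma val_one (S : Finset ℂ) (a : ℂ) : val S a (one S) = 1 :=
  val_eq_iff.2 (hasRegValue_const fun _ hz => one_apply hz)

lemma val_zero_word {w : List ℂ} (hw : ∀ b ∈ w, b ∈ S) (hne : w ≠ []) :
    val S 0 (word w hw) = 0 :=
  val_eq_iff.2 (hasRegValue_iff.2 (hlogOn_zero_expansion hw hne))

lemma coe_monH_word {w : List ℂ} (hw : ∀ b ∈ w, b ∈ S) :
    (monH S a (word w hw) : ℂ → ℂ) = lin S (lead S a w) := by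
  have := monH_eq_iff.2 (show LogDeriv S a (word w hw : HLC S)
    ((⟨_, lin_mem fun u hu => ((isLeading_lead (a := a) hw).1 u hu).1⟩ : HLC S) : ℂ → ℂ) from
    logDeriv_hlogOn hw)
  rw [this]

lemma monH_one (S : Finset ℂ) (a : ℂ) : monH S a (one S) = 0 := by
  refine Subtype.ext ?_
  rw [one, coe_monH_word]
  have : lead S a [] = 0 := by
    ext u
    by_contra hne
    have := ((isLeading_lead (S := S) (a := a) (w := []) (by simp)).1 u
      (Finsupp.mem_support_iff.2 hne)).2
    simp at this
  rw [this]
  simp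

lemma monH_letter {b : ℂ} (hb : b ∈ S) : monH S a (word [b] (by simpa using hb)) =
    (if b = a then (1 : ℂ) else 0) • one S := by
  refine Subtype.ext ?_
  rw [coe_monH_word]
  have h := isLeading_lead (S := S) (a := a) (w := [b]) (by simpa using hb)
  have : lead S a [b] = Finsupp.single [] (if b = a then 1 else 0) := by
    ext u
    by_cases hu : u = []
    · subst hu
      rw [h.2 [] rfl, Finsupp.single_eq_same]
      simp
    · rw [Finsupp.single_eq_of_ne hu]
      by_contra hne
      have := (h.1 u (Finsupp.mem_support_iff.2 hne)).2
      simp at this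
      exact hu this
  rw [this, lin_single]
  rfl

/-- The regularized value at `a` of `m_a L_{vb}`. -/
lemma val_monH_append {v : List ℂ} {b : ℂ} (hv : ∀ d ∈ v, d ∈ S) (hb : b ∈ S) :
    val S a (monH S a (word (v ++ [b]) (by simpa [or_imp, forall_and] using ⟨hv, hb⟩))) =
      if b = a then val S a (word v hv) else 0 := by
  have hw : ∀ d ∈ v ++ [b], d ∈ S := by simpa [or_imp, forall_and] using ⟨hv, hb⟩
  obtain ⟨P, c, h1, h2, -, -, h5⟩ := hlogOn_expansion a hw
  obtain ⟨Pv, h6, h7, h8⟩ := h5 v b rfl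
  have hPv : val S a (word v hv) = Pv.coeff 0 a := val_eq_iff.2 (hasRegValue_iff.2 ⟨Pv, h6, h7, rfl⟩)
  rw [hPv, ← h8]
  refine val_eq_iff.2 (hasRegValue_iff.2 ⟨derivative P, fun l => ?_,
    (logDeriv_monH a (word (v ++ [b]) hw)).rep h2, ?_⟩)
  · rw [coeff_derivative]
    exact (h1 (l + 1)).mul (analyticAt_const (v := (l : ℂ) + 1))
  · simp [coeff_derivative]

end

section

variable {S : Finset ℂ} {a : ℂ}

/-! ### Differentiation and integration -/

lemma dHLC_ext {f g : dHLC S} (h : ∀ z ∈ dom S, (f : ℂ → ℂ) z = (g : ℂ → ℂ) z) : f = g := by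
  refine Subtype.ext (funext fun z => ?_)
  by_cases hz : z ∈ dom S
  · exact h z hz
  · rw [f.2.1 z hz, g.2.1 z hz]

lemma exists_derivMap (S : Finset ℂ) : ∃ d : HLC S →ₗ[ℂ] dHLC S, ∀ F f, d F = f ↔
    IsDeriv S F f := by
  refine exists_linearMap_of_relation (fun (F : HLC S) (f : dHLC S) => IsDeriv S F f)
    (fun h1 h2 z hz => (h1 z hz).add (h2 z hz)) (fun c h z hz => (h z hz).const_smul c)
    (fun F => ?_) (fun h1 h2 => dHLC_ext fun z hz => (h1 z hz).unique (h2 z hz))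
  have h : IsDeriv S F ((dom S).indicator (deriv F)) := fun z hz => by
    rw [Set.indicator_of_mem hz]
    exact ((differentiableOn_HLC F.2).differentiableAt ((isOpen_dom S).mem_nhds hz)).hasDerivAt
  exact ⟨⟨_, fun z hz => Set.indicator_of_notMem hz _, F, F.2, h⟩, h⟩

/-- Differentiation. -/
def derivMap (S : Finset ℂ) : HLC S →ₗ[ℂ] dHLC S := (exists_derivMap S).choose

lemma derivMap_eq_iff {F : HLC S} {f : dHLC S} : derivMap S F = f ↔ IsDeriv S F f :=
  (exists_derivMap S).choose_spec F f

lemma isDeriv_derivMap (F : HLC S) : IsDeriv S F (derivMap S F) := derivMap_eq_iff.1 rfl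

lemma derivMap_surjective (S : Finset ℂ) : Function.Surjective (derivMap S) := fun f => by
  obtain ⟨F, hF, h⟩ := f.2.2
  exact ⟨⟨F, hF⟩, derivMap_eq_iff.2 h⟩

lemma derivMap_word_apply {v : List ℂ} {b : ℂ} (hv : ∀ d ∈ v, d ∈ S) (hb : b ∈ S)
    (hw : ∀ d ∈ v ++ [b], d ∈ S) {z : ℂ} (hz : z ∈ dom S) :
    (derivMap S (word (v ++ [b]) hw) : ℂ → ℂ) z = (z - b)⁻¹ * hlogOn S v z :=
  (isDeriv_derivMap _ z hz).unique (hasDerivAt_hlogOn hv hb hz)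

lemma derivMap_one (S : Finset ℂ) : derivMap S (one S) = 0 := by
  refine derivMap_eq_iff.2 fun z hz => (hasDerivAt_const z (1 : ℂ)).congr_of_eventuallyEq ?_
  filter_upwards [(isOpen_dom S).mem_nhds hz] with y hy using one_apply hy

lemma exists_eq_smul_one {F : HLC S} (h : derivMap S F = 0) : ∃ c : ℂ, F = c • one S := by
  have hF := derivMap_eq_iff.1 h
  obtain ⟨c, hc⟩ := exists_eventually_eq_const (S := S) (a := 0) (f := F) (by
    filter_upwards [nhds_side_le_dom S 0] with z hz using hF z hz)
  refine ⟨c, Subtype.ext (HLC_ext F.2 (c • one S).2 (eqOn_dom_of_eventually (a := 0)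
    (differentiableOn_HLC F.2) (differentiableOn_HLC (c • one S).2) ?_))⟩
  filter_upwards [hc, nhds_side_le_dom S 0] with z h1 h2
  rw [h1, Submodule.coe_smul, Pi.smul_apply, one_apply h2, smul_eq_mul, mul_one]

/-- A hyperlogarithm is determined by its derivative and its regularized value at the origin. -/
lemma eq_of_derivMap_eq {F G : HLC S} (h : derivMap S F = derivMap S G)
    (h0 : val S 0 F = val S 0 G) : F = G := by
  obtain ⟨c, hc⟩ := exists_eq_smul_one (F := F - G) (by rw [map_sub, h, sub_self])
  have : c = 0 := by
    have := congrArg (val S 0) hc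
    rw [map_sub, h0, sub_self, map_smul, val_one, smul_eq_mul, mul_one] at this
    exact this.symm
  rw [this, zero_smul] at hc
  exact sub_eq_zero.1 hc

lemma isIntZero_iff {f : dHLC S} {F : HLC S} :
    IsIntZero S f F ↔ derivMap S F = f ∧ val S 0 F = 0 := by
  rw [derivMap_eq_iff, val_eq_iff]
  rfl

lemma exists_integral (S : Finset ℂ) : ∃ I : dHLC S →ₗ[ℂ] HLC S, ∀ f F, I f = F ↔
    IsIntZero S f F := by
  simp only [isIntZero_iff]
  refine exists_linearMap_of_relation (fun f F => derivMap S F = f ∧ val S 0 F = 0)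
    (fun h1 h2 => by rw [map_add, map_add, h1.1, h1.2, h2.1, h2.2]; simp)
    (fun c h => by rw [map_smul, map_smul, h.1, h.2]; simp) (fun f => ?_)
    (fun h1 h2 => eq_of_derivMap_eq (h1.1.trans h2.1.symm) (h1.2.trans h2.2.symm))
  obtain ⟨F, rfl⟩ := derivMap_surjective S f
  exact ⟨F - val S 0 F • one S, by simp [derivMap_one], by simp [val_one]⟩

/-- Integration with regularized value `0` at the origin. -/
def integral (S : Finset ℂ) : dHLC S →ₗ[ℂ] HLC S := (exists_integral S).choose

lemma integral_eq_iff {f : dHLC S} {F : HLC S} : integral S f = F ↔ IsIntZero S f F :=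
  (exists_integral S).choose_spec f F

lemma derivMap_integral (f : dHLC S) : derivMap S (integral S f) = f :=
  (isIntZero_iff.1 (integral_eq_iff.1 rfl)).1

lemma val_integral (f : dHLC S) : val S 0 (integral S f) = 0 :=
  (isIntZero_iff.1 (integral_eq_iff.1 rfl)).2

lemma integral_derivMap (F : HLC S) : integral S (derivMap S F) = F - val S 0 F • one S :=
  eq_of_derivMap_eq (by rw [derivMap_integral]; simp [derivMap_one])
    (by rw [val_integral]; simp [val_one])

/-! ### The infinitesimal monodromy -/

lemma differentiableOn_dHLC {f : ℂ → ℂ} (hf : f ∈ dHLC S) : DifferentiableOn ℂ f (dom S) := by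
  obtain ⟨-, F, hF, h⟩ := hf
  exact ((differentiableOn_HLC hF).deriv (isOpen_dom S)).congr fun z hz => (h z hz).deriv.symm

lemma exists_mD (S : Finset ℂ) (a : ℂ) : ∃ m : dHLC S →ₗ[ℂ] dHLC S, ∀ f g, m f = g ↔
    LogDeriv S a f g := by
  refine exists_linearMap_of_relation (fun f g : dHLC S => LogDeriv S a f g)
    (fun h1 h2 => h1.add h2) (fun c h => h.smul c) (fun f => ?_) (fun {f x y} h1 h2 => ?_)
  · obtain ⟨F, rfl⟩ := derivMap_surjective S f
    exact ⟨derivMap S (monH S a F),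
      (logDeriv_monH a F).deriv (isDeriv_derivMap F) (isDeriv_derivMap _)⟩
  · exact dHLC_ext (eqOn_dom_of_eventually (differentiableOn_dHLC x.2)
      (differentiableOn_dHLC y.2) (h1.unique h2))

/-- The infinitesimal monodromy `m_a` on derivatives of hyperlogarithms. -/
def monD (S : Finset ℂ) (a : ℂ) : dHLC S →ₗ[ℂ] dHLC S := (exists_mD S a).choose

lemma monD_eq_iff {f g : dHLC S} : monD S a f = g ↔ LogDeriv S a f g :=
  (exists_mD S a).choose_spec f g

lemma monD_derivMap (F : HLC S) : monD S a (derivMap S F) = derivMap S (monH S a F) :=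
  monD_eq_iff.2 ((logDeriv_monH a F).deriv (isDeriv_derivMap F) (isDeriv_derivMap _))

/-- The bridge from the algebraic operator to analytic continuation: the logarithmic derivative is
an infinitesimal monodromy, and the latter is unique. -/
lemma monH_eq_iff_isInfMonodromy {f g : HLC S} : monH S a f = g ↔ IsInfMonodromy S a f g := by
  have h := isInfMonodromy_of_logDeriv (fun _ => differentiableOn_HLC) (monH S a)
    (logDeriv_monH a) f
  exact ⟨fun e => e ▸ h, fun h' => Subtype.ext (HLC_ext (monH S a f).2 g.2 (h.eqOn h'))⟩

lemma monD_eq_iff_isInfMonodromy {f g : dHLC S} : monD S a f = g ↔ IsInfMonodromy S a f g := by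
  have h := isInfMonodromy_of_logDeriv (fun _ => differentiableOn_dHLC) (monD S a)
    (fun _ => monD_eq_iff.1 rfl) f
  exact ⟨fun e => e ▸ h, fun h' => dHLC_ext (h.eqOn h')⟩

/-- The generic infinitesimal monodromy on hyperlogarithms. -/
def genMonH (S : Finset ℂ) : HLC S →ₗ[ℂ] (S → HLC S) := LinearMap.pi fun a => monH S a

/-- The generic infinitesimal monodromy on derivatives of hyperlogarithms. -/
def genMonD (S : Finset ℂ) : dHLC S →ₗ[ℂ] (S → dHLC S) := LinearMap.pi fun a => monD S a

lemma genMonH_eq_iff {f : HLC S} {x : S → HLC S} :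
    genMonH S f = x ↔ IsGenMonodromy S f (fun a => x a) :=
  funext_iff.trans (forall_congr' fun _ => monH_eq_iff_isInfMonodromy)

lemma genMonD_eq_iff {f : dHLC S} {x : S → dHLC S} :
    genMonD S f = x ↔ IsGenMonodromy S f (fun a => x a) :=
  funext_iff.trans (forall_congr' fun _ => monD_eq_iff_isInfMonodromy)

/-- Modulo words shorter than v, the generic monodromy of L_{av} is a ⊗ L_v; the remainder is in the
range by induction on the length. -/
lemma single_word_mem_range [DecidableEq ℂ] (n : ℕ) : ∀ (v : List ℂ) (hv : ∀ b ∈ v, b ∈ S), v.length < n →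
    ∀ a : S, Pi.single a (word v hv) ∈ LinearMap.range (genMonH S) := by
  induction n with
  | zero => exact fun v _ h => absurd h (Nat.not_lt_zero _)
  | succ n ih =>
    intro v hv hlen a
    have hlin : ∀ (c : List ℂ →₀ ℂ) (hc : ∀ w ∈ c.support, ∀ b ∈ w, b ∈ S),
        (∀ w ∈ c.support, w.length < n) → ∀ b : S,
        Pi.single b (⟨lin S c, lin_mem hc⟩ : HLC S) ∈ LinearMap.range (genMonH S) := by
      intro c hc hcn b
      have e : (⟨lin S c, lin_mem hc⟩ : HLC S) =
          ∑ w ∈ c.support.attach, c w • word w.1 (hc w.1 w.2) := by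
        refine Subtype.ext ?_
        simp only [AddSubmonoidClass.coe_finsetSum, Submodule.coe_smul, word]
        rw [Finset.sum_attach c.support (fun w => c w • hlogOn S w), lin,
          Finsupp.linearCombination_apply, Finsupp.sum]
      rw [e]
      have : (LinearMap.single ℂ (fun _ : S => HLC S) b)
          (∑ w ∈ c.support.attach, c w • word w.1 (hc w.1 w.2)) ∈ LinearMap.range (genMonH S) := by
        rw [map_sum]
        refine Submodule.sum_mem _ fun w _ => ?_
        rw [map_smul]
        exact Submodule.smul_mem _ _ (ih w.1 (hc w.1 w.2) (hcn w.1 w.2) b)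
      exact this
    have hw : ∀ d ∈ (a : ℂ) :: v, d ∈ S := List.forall_mem_cons.2 ⟨a.2, hv⟩
    -- The remainder of m_b L_{av} after removal of the leading term; it involves only words shorter
    -- than `v`.
    let r : S → List ℂ →₀ ℂ := fun b =>
      lead S b (a :: v) - Finsupp.single v (if b = a then 1 else 0)
    have hr0 : ∀ b : S, ∀ u ∈ (r b).support, (∀ d ∈ u, d ∈ S) ∧ u.length < v.length := by
      intro b u hu
      have hl := isLeading_lead (a := (b : ℂ)) hw
      rw [Finsupp.mem_support_iff] at hu
      have hu' : lead S b (a :: v) u ≠ 0 ∨ u = v := by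
        by_contra hcon
        push Not at hcon
        apply hu
        simp only [r, Finsupp.sub_apply]
        rw [hcon.1, Finsupp.single_eq_of_ne hcon.2, sub_zero]
      have hmem : (∀ d ∈ u, d ∈ S) ∧ u.length ≤ v.length := by
        rcases hu' with h | rfl
        · have := hl.1 u (Finsupp.mem_support_iff.2 h)
          exact ⟨this.1, Nat.lt_succ_iff.1 (by simpa using this.2)⟩
        · exact ⟨hv, le_rfl⟩
      refine ⟨hmem.1, lt_of_le_of_ne hmem.2 fun hlen => hu ?_⟩
      simp only [r, Finsupp.sub_apply]
      rw [hl.2 u (by simp [hlen])]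
      by_cases huv : u = v
      · subst huv
        have : ((a : ℂ) :: u = (b : ℂ) :: u) ↔ b = a :=
          ⟨fun h => Subtype.ext (List.head_eq_of_cons_eq h).symm, fun h => by rw [h]⟩
        simp only [this, Finsupp.single_eq_same, sub_self]
      · rw [Finsupp.single_eq_of_ne huv, if_neg (by simp [Ne.symm huv]), sub_zero]
    have e : Pi.single a (word v hv) = genMonH S (word (a :: v) hw) -
        ∑ b : S, Pi.single b (⟨lin S (r b), lin_mem fun u hu => (hr0 b u hu).1⟩ : HLC S) := by
      rw [eq_sub_iff_add_eq]
      ext b : 1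
      rw [Pi.add_apply, Finset.sum_apply, Finset.sum_pi_single, if_pos (Finset.mem_univ b)]
      refine Subtype.ext ?_
      rw [Submodule.coe_add]
      change _ = (monH S b (word (a :: v) hw) : ℂ → ℂ)
      rw [coe_monH_word]
      simp only [r, map_sub, lin_single]
      by_cases hba : b = a
      · subst hba
        simp [word]
      · simp [hba]
    rw [e]
    refine Submodule.sub_mem _ ⟨_, rfl⟩ (Submodule.sum_mem _ fun b _ =>
      hlin (r b) (fun u hu => (hr0 b u hu).1) (fun u hu => ?_) b)
    exact ((hr0 b u hu).2).trans_le (Nat.lt_succ_iff.1 hlen)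

lemma genMonH_surjective (S : Finset ℂ) : Function.Surjective (genMonH S) := by
  classical
  have hs : ∀ (a : S) (f : HLC S), Pi.single a f ∈ LinearMap.range (genMonH S) := by
    intro a f
    have hle : (⊤ : Submodule ℂ (HLC S)) ≤
        (LinearMap.range (genMonH S)).comap (LinearMap.single ℂ (fun _ : S => HLC S) a) := by
      rintro ⟨f, hf⟩ -
      refine HLC_induction (p := fun f => ∀ hf : f ∈ HLC S, (⟨f, hf⟩ : HLC S) ∈
        (LinearMap.range (genMonH S)).comap (LinearMap.single ℂ (fun _ : S => HLC S) a))
        (fun w hw _ => single_word_mem_range (w.length + 1) w hw (Nat.lt_succ_self _) a)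
        (fun _ => Submodule.zero_mem _) ?_ ?_ hf hf
      · intro f hf g hg h1 h2 _
        exact Submodule.add_mem _ (h1 hf) (h2 hg)
      · intro c f hf h _
        exact Submodule.smul_mem _ c (h hf)
    exact hle (Submodule.mem_top (x := f))
  intro x
  have : x = ∑ a : S, Pi.single a (x a) := by
    ext b : 1
    rw [Finset.sum_apply, Finset.sum_pi_single, if_pos (Finset.mem_univ b)]
  have hx : x ∈ LinearMap.range (genMonH S) := by
    rw [this]
    exact Submodule.sum_mem _ fun a _ => hs a (x a)
  exact hx

lemma genMonD_derivMap (F : HLC S) :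
    genMonD S (derivMap S F) = fun a => derivMap S (genMonH S F a) :=
  funext fun _ => monD_derivMap F

lemma genMonD_surjective (S : Finset ℂ) : Function.Surjective (genMonD S) := by
  intro y
  choose Y hY using fun a => derivMap_surjective S (y a)
  obtain ⟨F, hF⟩ := genMonH_surjective S Y
  exact ⟨derivMap S F, by rw [genMonD_derivMap, hF]; exact funext hY⟩

lemma genMonH_one (S : Finset ℂ) : genMonH S (one S) = 0 := funext fun a => monH_one S a

/-- The hyperlogarithms without monodromy are the constants. -/
lemma exists_eq_smul_one_of_genMonH {F : HLC S} (h : genMonH S F = 0) : ∃ c : ℂ, F = c • one S := by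
  obtain ⟨c, hc, hF⟩ := exists_lin_of_mem F.2
  -- Constants, set to zero on `S`, become admissible coefficients, so that the independence over
  -- holomorphic functions applies.
  let κ : ℂ →ₗ[ℂ] anOff S :=
    { toFun := fun x => ⟨_, indicator_mem_anOff (φ := fun _ => x) fun _ _ => analyticAt_const⟩
      map_add' := fun x y => Subtype.ext (Set.indicator_add _ (fun _ => x) (fun _ => y))
      map_smul' := fun x y => Subtype.ext (Set.indicator_const_smul _ x (fun _ => y)) }
  have hκ : ∀ x, κ x = 0 → x = 0 := by
    intro x hx
    obtain ⟨q, hq⟩ := nonempty_dom S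
    have := congrFun (congrArg Subtype.val hx) q
    simpa [κ, Set.indicator_of_mem (dom_subset_compl S hq)] using this
  have hφ : ∀ w ∈ (c.mapRange κ (map_zero κ)).support, ∀ b ∈ w, b ∈ S := fun w hw =>
    hc w (Finsupp.support_mapRange hw)
  have hlin : ∀ z ∈ dom S, linAn S (c.mapRange κ (map_zero κ)) z = (F : ℂ → ℂ) z := by
    intro z hz
    rw [linAn, Finsupp.sum_mapRange_index (by simp), ← hF, lin, Finsupp.linearCombination_apply,
      Finsupp.sum, Finsupp.sum, Finset.sum_apply, Finset.sum_apply]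
    refine Finset.sum_congr rfl fun w _ => ?_
    simp [κ, Set.indicator_of_mem (dom_subset_compl S hz)]
  have h0 : ∀ w, w ≠ [] → c w = 0 := fun w hw => by
    refine hκ _ ?_
    rw [← Finsupp.mapRange_apply (hf := map_zero κ)]
    refine eq_zero_of_logDeriv_zero hφ (fun a ha => ?_) hw
    have := logDeriv_monH a F
    rw [show monH S a F = 0 from congrFun h ⟨a, ha⟩] at this
    exact this.congr_dom hlin fun _ _ => rfl
  refine ⟨c [], Subtype.ext ?_⟩
  have h4 : c = Finsupp.single [] (c []) := by
    ext w
    by_cases hw : w = []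
    · subst hw; simp
    · rw [h0 w hw, Finsupp.single_eq_of_ne hw]
  rw [← hF, h4, lin_single, Finsupp.single_eq_same]
  rfl

/-! ### The inverse of the generic monodromy and the evaluation projection -/

lemma isGenMonodromyInv_iff {x : S → HLC S} {X : HLC S} :
    IsGenMonodromyInv S (fun a => x a) X ↔ genMonH S X = x ∧ val S 0 X = 0 := by
  rw [genMonH_eq_iff, val_eq_iff]
  rfl

/-- Surjectivity of m gives a preimage. It is determined up to a constant, and the value at 0 fixes
that constant. -/
lemma exists_genMonInv (S : Finset ℂ) : ∃ I : (S → HLC S) →ₗ[ℂ] HLC S, ∀ x X, I x = X ↔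
    IsGenMonodromyInv S (fun a => x a) X := by
  simp only [isGenMonodromyInv_iff]
  refine exists_linearMap_of_relation (fun x X => genMonH S X = x ∧ val S 0 X = 0)
    (fun h1 h2 => by rw [map_add, map_add, h1.1, h1.2, h2.1, h2.2]; simp)
    (fun c h => by rw [map_smul, map_smul, h.1, h.2]; simp) (fun x => ?_)
    (fun {x X Y} h1 h2 => ?_)
  · obtain ⟨F, rfl⟩ := genMonH_surjective S x
    exact ⟨F - val S 0 F • one S, by simp [genMonH_one], by simp [val_one]⟩
  · obtain ⟨c, hc⟩ := exists_eq_smul_one_of_genMonH (F := X - Y)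
      (by rw [map_sub, h1.1, h2.1, sub_self])
    have : c = 0 := by
      have := congrArg (val S 0) hc
      rw [map_sub, h1.2, h2.2, sub_self, map_smul, val_one, smul_eq_mul, mul_one] at this
      exact this.symm
    rw [this, zero_smul] at hc
    exact sub_eq_zero.1 hc

/-- Subtraction of the regularized values. -/
def evalProj (S : Finset ℂ) : (S → HLC S) →ₗ[ℂ] (S → HLC S) :=
  LinearMap.pi fun a => (LinearMap.id - (val S a).smulRight (one S)) ∘ₗ
    (LinearMap.proj a : (S → HLC S) →ₗ[ℂ] HLC S)

lemma evalProj_apply (x : S → HLC S) (a : S) :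
    evalProj S x a = x a - val S a (x a) • one S := rfl

lemma evalProj_eq_iff {x y : S → HLC S} :
    evalProj S x = y ↔ IsEvalProj S (fun a => x a) (fun a => y a) := by
  have e : ∀ (a : S) (z : ℂ), z ∈ dom S →
      (evalProj S x a : ℂ → ℂ) z = (x a : ℂ → ℂ) z - val S a (x a) := by
    intro a z hz
    rw [evalProj_apply, Submodule.coe_sub, Submodule.coe_smul, Pi.sub_apply, Pi.smul_apply,
      one_apply hz, smul_eq_mul, mul_one]
  constructor
  · rintro rfl a
    exact ⟨_, hasRegValue_val _ _, e a⟩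
  · intro h
    ext a : 1
    obtain ⟨c, h1, h2⟩ := h a
    obtain rfl := val_eq_iff.2 h1
    exact Subtype.ext (HLC_ext (evalProj S x a).2 (y a).2 fun z hz =>
      (e a z hz).trans (h2 z hz).symm)

end

section

variable {S : Finset ℂ} {a : ℂ}

/-! ### Residues -/

lemma analyticAt_regFun {φ : ℂ → ℂ} (hφ : φ ∈ regFun S) {z : ℂ} (hz : z ∉ S) : AnalyticAt ℂ φ z := by
  induction hφ using Algebra.adjoin_induction with
  | mem φ h =>
    rcases h with rfl | ⟨b, hb, rfl⟩
    · exact analyticAt_id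
    · exact (analyticAt_id.sub analyticAt_const).inv
        (sub_ne_zero.2 fun h : z = b => hz (h ▸ hb))
  | algebraMap c => exact analyticAt_const
  | add f g _ _ h1 h2 => exact h1.add h2
  | mul f g _ _ h1 h2 => exact h1.mul h2

lemma eventually_sphere {p : ℂ → Prop} (h : ∀ᶠ z in 𝓝[≠] a, p z) :
    ∀ᶠ r in 𝓝[>] (0 : ℝ), 0 < r ∧ ∀ z ∈ Metric.sphere a r, p z := by
  obtain ⟨ε, hε, hB⟩ := Metric.eventually_nhds_iff_ball.1 (eventually_nhdsWithin_iff.1 h)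
  filter_upwards [Ioo_mem_nhdsGT hε] with r hr
  refine ⟨hr.1, fun z hz => hB z ?_ ?_⟩
  · rw [Metric.mem_ball, Metric.mem_sphere.1 hz]; exact hr.2
  · rintro rfl
    rw [Metric.mem_sphere, dist_self] at hz
    exact hr.1.ne hz

lemma eventually_circleIntegrable {φ : ℂ → ℂ} (hφ : φ ∈ regFun S) (a : ℂ) :
    ∀ᶠ r in 𝓝[>] (0 : ℝ), CircleIntegrable φ a r := by
  filter_upwards [eventually_sphere ((eventually_notMem S a).mono fun z => analyticAt_regFun hφ)]
    with r hr
  exact ContinuousOn.circleIntegrable hr.1.le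
    fun z hz => (hr.2 z hz).continuousAt.continuousWithinAt

lemma HasRes.add {φ ψ : ℂ → ℂ} {c d : ℂ} (hφ : φ ∈ regFun S) (hψ : ψ ∈ regFun S)
    (h1 : HasRes a φ c) (h2 : HasRes a ψ d) : HasRes a (φ + ψ) (c + d) := by
  filter_upwards [h1, h2, eventually_circleIntegrable hφ a, eventually_circleIntegrable hψ a]
    with r e1 e2 i1 i2
  rw [← e1, ← e2, ← mul_add, ← circleIntegral.integral_add i1 i2]
  rfl

lemma HasRes.smul {φ : ℂ → ℂ} {c : ℂ} (x : ℂ) (h : HasRes a φ c) : HasRes a (x • φ) (x * c) := by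
  filter_upwards [h] with r e
  simp only [Pi.smul_apply]
  rw [circleIntegral.integral_smul, smul_eq_mul, ← e]
  ring

lemma hasRes_zero (a : ℂ) : HasRes a 0 0 := .of_forall fun r => by simp [circleIntegral]

lemma HasRes.eq_zero {φ : ℂ → ℂ} {c : ℂ} (h : HasRes a φ c) (h0 : ∀ᶠ z in 𝓝[≠] a, φ z = 0) :
    c = 0 := by
  obtain ⟨r, e, hr⟩ := (h.and (eventually_sphere h0)).exists
  rw [← e, circleIntegral.integral_congr (g := fun _ => 0) hr.1.le hr.2]
  simp [circleIntegral]

lemma inv_sub_mem_regFun {b : ℂ} (hb : b ∈ S) : (fun z => (z - b)⁻¹) ∈ regFun S :=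
  Algebra.subset_adjoin (Or.inr ⟨b, hb, rfl⟩)

lemma hasRes_inv_sub (a b : ℂ) : HasRes a (fun z => (z - b)⁻¹) (if b = a then 1 else 0) := by
  split_ifs with h
  · subst h
    filter_upwards [self_mem_nhdsWithin] with r hr
    rw [circleIntegral.integral_sub_center_inv b (ne_of_gt hr)]
    exact inv_mul_cancel₀ Complex.two_pi_I_ne_zero
  · have hab : 0 < dist b a := dist_pos.2 h
    filter_upwards [Ioo_mem_nhdsGT hab] with r hr
    have hne : ∀ z ∈ Metric.closedBall a r, z - b ≠ 0 := by
      intro z hz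
      refine sub_ne_zero.2 ?_
      rintro rfl
      exact absurd (Metric.mem_closedBall.1 hz) (not_le.2 hr.2)
    have hd : DifferentiableOn ℂ (fun z => (z - b)⁻¹) (Metric.closedBall a r) := fun z hz =>
      ((differentiableAt_id.sub_const b).inv (hne z hz)).differentiableWithinAt
    rw [(hd.diffContOnCl_ball subset_rfl).circleIntegral_eq_zero hr.1.le, mul_zero]

lemma HasHLRes.congr {f g : ℂ → ℂ} {c : ℂ} (h : HasHLRes S a f c) (hfg : ∀ z ∈ dom S, g z = f z) :
    HasHLRes S a g c := by
  obtain ⟨W, φ, ρ, v, h1, h2, h3⟩ := h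
  exact ⟨W, φ, ρ, v, h1, fun z hz => (hfg z hz).trans (h2 z hz), h3⟩

lemma hasHLRes_zero (S : Finset ℂ) (a : ℂ) : HasHLRes S a 0 0 :=
  ⟨∅, 0, 0, 0, by simp, by simp, by simp⟩

lemma HasHLRes.smul {f : ℂ → ℂ} {c : ℂ} (x : ℂ) (h : HasHLRes S a f c) :
    HasHLRes S a (x • f) (x * c) := by
  obtain ⟨W, φ, ρ, v, h1, h2, rfl⟩ := h
  refine ⟨W, fun w => x • φ w, fun w => x * ρ w, v, fun w hw => ?_, fun z hz => ?_, ?_⟩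
  · obtain ⟨e1, e2, e3, e4⟩ := h1 w hw
    exact ⟨e1, Subalgebra.smul_mem _ e2 x, e3.smul x, e4⟩
  · simp [h2 z hz, Finset.mul_sum, mul_assoc]
  · simp [Finset.mul_sum, mul_assoc]

lemma HasHLRes.add {f g : ℂ → ℂ} {c d : ℂ} (h : HasHLRes S a f c) (h' : HasHLRes S a g d) :
    HasHLRes S a (f + g) (c + d) := by
  classical
  obtain ⟨W, φ, ρ, v, h1, h2, rfl⟩ := h
  obtain ⟨W', φ', ρ', v', h1', h2', rfl⟩ := h'
  have ext1 : ∀ {V : Finset (List ℂ)} (_ : V ⊆ W ∪ W') (F : List ℂ → ℂ),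
      ∑ w ∈ V, F w = ∑ w ∈ W ∪ W', if w ∈ V then F w else 0 := by
    intro V hV F
    rw [← Finset.sum_filter, Finset.filter_mem_eq_inter, Finset.inter_eq_right.2 hV]
  -- A word that occurs in both presentations must carry the same regularized value, so that the two
  -- contributions can be merged.
  have hv : ∀ w ∈ W', w ∈ W → v w = v' w := fun w hw' hw =>
    (h1 w hw).2.2.2.unique (h1' w hw').2.2.2
  refine ⟨W ∪ W', fun w => (if w ∈ W then φ w else 0) + (if w ∈ W' then φ' w else 0),
    fun w => (if w ∈ W then ρ w else 0) + (if w ∈ W' then ρ' w else 0),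
    fun w => if w ∈ W then v w else v' w, fun w hw => ?_, fun z hz => ?_, ?_⟩
  · have a1 : (if w ∈ W then φ w else 0) ∈ regFun S := by
      split_ifs with h
      · exact (h1 w h).2.1
      · exact Subalgebra.zero_mem _
    have a2 : (if w ∈ W' then φ' w else 0) ∈ regFun S := by
      split_ifs with h
      · exact (h1' w h).2.1
      · exact Subalgebra.zero_mem _
    have r1 : HasRes a (if w ∈ W then φ w else 0) (if w ∈ W then ρ w else 0) := by
      split_ifs with h
      · exact (h1 w h).2.2.1
      · exact hasRes_zero a
    have r2 : HasRes a (if w ∈ W' then φ' w else 0) (if w ∈ W' then ρ' w else 0) := by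
      split_ifs with h
      · exact (h1' w h).2.2.1
      · exact hasRes_zero a
    refine ⟨?_, Subalgebra.add_mem _ a1 a2, r1.add a1 a2 r2, ?_⟩
    · rcases Finset.mem_union.1 hw with h | h
      · exact (h1 w h).1
      · exact (h1' w h).1
    · beta_reduce
      split_ifs with h
      · exact (h1 w h).2.2.2
      · exact (h1' w ((Finset.mem_union.1 hw).resolve_left h)).2.2.2
  · rw [Pi.add_apply, h2 z hz, h2' z hz, ext1 Finset.subset_union_left,
      ext1 Finset.subset_union_right, ← Finset.sum_add_distrib]
    refine Finset.sum_congr rfl fun w _ => ?_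
    by_cases e1 : w ∈ W <;> by_cases e2 : w ∈ W' <;> simp [e1, e2, add_mul]
  · rw [ext1 Finset.subset_union_left, ext1 Finset.subset_union_right, ← Finset.sum_add_distrib]
    refine Finset.sum_congr rfl fun w _ => ?_
    by_cases e1 : w ∈ W <;> by_cases e2 : w ∈ W' <;> simp [e1, e2, add_mul]
    exact Or.inl (hv w e2 e1)

/-- Linear independence forces every coefficient of a presentation of zero to vanish outside `S`, so
all its residues vanish. This makes the residue independent of the presentation. -/
lemma HasHLRes.eq_zero {c : ℂ} (h : HasHLRes S a 0 c) : c = 0 := by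
  classical
  obtain ⟨W, φ, ρ, v, h1, h2, rfl⟩ := h
  let ψ : List ℂ →₀ anOff S := Finsupp.indicator W fun w hw =>
    ⟨_, indicator_mem_anOff fun z hz => analyticAt_regFun (h1 w hw).2.1 hz⟩
  have hsupp : ψ.support ⊆ W := Finsupp.support_indicator_subset _ _
  have hψ : ∀ w (hw : w ∈ W), (ψ w : ℂ → ℂ) = (S : Set ℂ)ᶜ.indicator (φ w) := fun w hw => by
    rw [show ψ w = _ from Finsupp.indicator_of_mem hw _]
  have hzero : ψ = 0 := by
    refine linAn_injective (fun w hw => (h1 w (hsupp hw)).1) fun z hz => ?_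
    rw [linAn, Finsupp.sum_of_support_subset ψ hsupp _ (by simp), Finset.sum_apply]
    refine Eq.trans (Finset.sum_congr rfl fun w hw => ?_) (h2 z hz).symm
    rw [Pi.mul_apply, hψ w hw, Set.indicator_of_mem (dom_subset_compl S hz)]
  refine Finset.sum_eq_zero fun w hw => ?_
  rw [(h1 w hw).2.2.1.eq_zero, zero_mul]
  filter_upwards [eventually_notMem S a] with z hz
  have := congrFun (hψ w hw) z
  rw [hzero, Set.indicator_of_mem (by simpa using hz)] at this
  exact this.symm

lemma HasHLRes.unique {f : ℂ → ℂ} {c d : ℂ} (h : HasHLRes S a f c) (h' : HasHLRes S a f d) :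
    c = d := by
  have := (h.add (h'.smul (-1))).congr (g := 0) fun z _ => by simp
  have := this.eq_zero
  linear_combination this

/-- The residue of the derivative of `F` is the regularized value of `m_a F`. -/
theorem hasHLRes_derivMap (a : ℂ) (F : HLC S) :
    HasHLRes S a (derivMap S F) (val S a (monH S a F)) := by
  refine HLC_induction (p := fun f => ∀ hf : f ∈ HLC S,
    HasHLRes S a (derivMap S ⟨f, hf⟩) (val S a (monH S a ⟨f, hf⟩))) (fun w hw _ => ?_) (fun _ => ?_)
    (fun f hf g hg h1 h2 _ => ?_) (fun c f hf h _ => ?_) F.2 F.2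
  · change HasHLRes S a (derivMap S (word w hw)) (val S a (monH S a (word w hw)))
    induction w using List.reverseRecOn with
    | nil =>
      change HasHLRes S a (derivMap S (one S)) (val S a (monH S a (one S)))
      rw [derivMap_one, monH_one, map_zero]
      exact hasHLRes_zero S a
    | append_singleton v b _ =>
      have hb : b ∈ S := hw b (by simp)
      have hv : ∀ d ∈ v, d ∈ S := fun d hd => hw d (by simp [hd])
      -- The presentation ∂L_{vb} = L_v / (z - b) has the residue δ_ab L_v(a), which is the value of
      -- m_a L_{vb} at `a` by `val_monH_append`.
      refine ⟨{v}, fun _ z => (z - b)⁻¹, fun _ => if b = a then 1 else 0,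
        fun _ => val S a (word v hv), fun w hw' => ?_, fun z hz => ?_, ?_⟩
      · obtain rfl := Finset.mem_singleton.1 hw'
        exact ⟨hv, inv_sub_mem_regFun hb, hasRes_inv_sub a b, hasRegValue_val a (word w hv)⟩
      · rw [Finset.sum_singleton, derivMap_word_apply hv hb hw hz]
      · rw [Finset.sum_singleton, val_monH_append hv hb, ite_mul, one_mul, zero_mul]
  · have e : (⟨0, by assumption⟩ : HLC S) = 0 := rfl
    rw [e, map_zero, map_zero, map_zero]
    exact hasHLRes_zero S a
  · have e : (⟨f + g, by assumption⟩ : HLC S) = ⟨f, hf⟩ + ⟨g, hg⟩ := rfl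
    rw [e, map_add, map_add, map_add]
    exact (h1 hf).add (h2 hg)
  · have e : (⟨c • f, by assumption⟩ : HLC S) = c • ⟨f, hf⟩ := rfl
    rw [e, map_smul, map_smul, map_smul]
    exact (h hf).smul c

/-- The residue at `a`. -/
def residue (S : Finset ℂ) (a : ℂ) : dHLC S →ₗ[ℂ] ℂ := val S a ∘ₗ monH S a ∘ₗ integral S

lemma hasHLRes_residue (a : ℂ) (f : dHLC S) : HasHLRes S a f (residue S a f) := by
  have := hasHLRes_derivMap a (integral S f)
  rwa [derivMap_integral] at this

/-- The logarithm `L_a`. -/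
def letter (a : S) : HLC S := word [(a : ℂ)] (by simp)

lemma derivMap_letter_apply (a : S) {z : ℂ} (hz : z ∈ dom S) :
    (derivMap S (letter a) : ℂ → ℂ) z = 1 / (z - a) := by
  have := derivMap_word_apply (S := S) (v := []) (b := a) (by simp) a.2 (by simp) hz
  rw [hlogOn_nil hz, mul_one] at this
  rw [one_div]
  exact this

/-- Subtraction of all residues. -/
def resProj (S : Finset ℂ) : dHLC S →ₗ[ℂ] dHLC S :=
  LinearMap.id - ∑ a : S, (residue S a).smulRight (derivMap S (letter a))

lemma resProj_apply (f : dHLC S) :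
    resProj S f = f - ∑ a : S, residue S a f • derivMap S (letter a) := by
  simp [resProj]

lemma resProj_eq_iff {f g : dHLC S} : resProj S f = g ↔ IsResProj S f g := by
  have e : ∀ z ∈ dom S, (resProj S f : ℂ → ℂ) z =
      (f : ℂ → ℂ) z - ∑ a : S, residue S a f / (z - a) := by
    intro z hz
    rw [resProj_apply, Submodule.coe_sub, Pi.sub_apply, AddSubmonoidClass.coe_finsetSum,
      Finset.sum_apply]
    congr 1
    refine Finset.sum_congr rfl fun a _ => ?_
    rw [Submodule.coe_smul, Pi.smul_apply, derivMap_letter_apply a hz, smul_eq_mul, mul_one_div]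
  constructor
  · rintro rfl
    exact ⟨fun a => residue S a f, fun a => hasHLRes_residue _ f, e⟩
  · rintro ⟨r, h1, h2⟩
    have hr : r = fun a : S => residue S a f := funext fun a =>
      (h1 a).unique (hasHLRes_residue _ f)
    subst hr
    exact dHLC_ext fun z hz => (e z hz).trans (h2 z hz).symm

/-! ### The hexagon -/

/-- Each 1 / (z - a) integrates to L_a, whose regularized value at 0 is zero even for a = 0. -/
lemma integral_resProj (f : dHLC S) :
    integral S (resProj S f) = integral S f - ∑ a : S, residue S a f • letter a := by
  refine eq_of_derivMap_eq ?_ ?_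
  · rw [derivMap_integral, resProj_apply, map_sub, derivMap_integral, map_sum]
    simp
  · rw [val_integral, map_sub, val_integral, map_sum]
    simp [letter, val_zero_word]

/-- The hexagon after application of m. Both sides are m_a F minus a constant, where F is the
integral of f: on the left the constant is the residue (m_a F)(a), since m_b L_a = δ_ab; on the
right it is the evaluation at `a`. -/
lemma genMonH_integral_resProj (f : dHLC S) :
    genMonH S (integral S (resProj S f)) =
      evalProj S ((integral S).compLeft S (genMonD S f)) := by
  ext a : 1
  have h1 : genMonH S (integral S (resProj S f)) a =
      monH S a (integral S f) - residue S a f • one S := by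
    change monH S a _ = _
    rw [integral_resProj, map_sub, map_sum]
    congr 1
    have : ∀ b : S, monH S a (residue S b f • letter b) =
        if b = a then residue S b f • one S else 0 := by
      intro b
      rw [map_smul, letter, monH_letter b.2]
      by_cases hb : b = a
      · simp [hb]
      · have : (b : ℂ) ≠ a := fun h => hb (Subtype.ext h)
        simp [hb, this]
    simp only [this, Finset.sum_ite_eq', Finset.mem_univ, if_true]
  -- Integrating the derivative of m_a F loses its value at 0; subtracting the value at `a`
  -- afterwards cancels this constant.
  have h2 : (integral S).compLeft S (genMonD S f) a =
      monH S a (integral S f) - val S 0 (monH S a (integral S f)) • one S := by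
    change integral S (monD S a f) = _
    conv_lhs => rw [← derivMap_integral f, monD_derivMap]
    exact integral_derivMap _
  rw [h1, evalProj_apply, h2, map_sub, map_smul, val_one]
  change _ - val S a (monH S a (integral S f)) • one S = _
  module

end

end Hyperlog

end

theorem mainTheorem12 (S : Finset ℂ) :
    ∃ (mH : HLC S →ₗ[ℂ] (S → HLC S)) (mD : dHLC S →ₗ[ℂ] (S → dHLC S))
      (piD : dHLC S →ₗ[ℂ] dHLC S) (int0 : dHLC S →ₗ[ℂ] HLC S)
      (piM : (S → HLC S) →ₗ[ℂ] (S → HLC S)) (mInv : (S → HLC S) →ₗ[ℂ] HLC S),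
      -- the generic infinitesimal monodromy on `HL^ℂ` and on `∂_z HL^ℂ`, with its images
      (∀ f x, mH f = x ↔ IsGenMonodromy S f (fun a => x a)) ∧ Function.Surjective mH ∧
      (∀ f x, mD f = x ↔ IsGenMonodromy S f (fun a => x a)) ∧ Function.Surjective mD ∧
      -- the two projections, the integral, and the inverse monodromy
      (∀ f g, piD f = g ↔ IsResProj S f g) ∧
      (∀ f F, int0 f = F ↔ IsIntZero S f F) ∧
      (∀ x y, piM x = y ↔ IsEvalProj S (fun a => x a) (fun a => y a)) ∧
      (∀ x X, mInv x = X ↔ IsGenMonodromyInv S (fun a => x a) X) ∧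
      -- the hexagon commutes
      int0 ∘ₗ piD = mInv ∘ₗ piM ∘ₗ int0.compLeft S ∘ₗ mD := by
  obtain ⟨mInv, hInv⟩ := exists_genMonInv S
  refine ⟨genMonH S, genMonD S, resProj S, integral S, evalProj S, mInv,
    fun _ _ => genMonH_eq_iff, genMonH_surjective S, fun _ _ => genMonD_eq_iff,
    genMonD_surjective S, fun _ _ => resProj_eq_iff, fun _ _ => integral_eq_iff,
    fun _ _ => evalProj_eq_iff, hInv, LinearMap.ext fun f => ?_⟩
  -- The integral of the projected `f` has the two properties that characterize the value of m⁻¹: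
  -- the right generic monodromy and the value 0 at 0.
  exact ((hInv _ _).2 (isGenMonodromyInv_iff.2
    ⟨genMonH_integral_resProj f, val_integral _⟩)).symm
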